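/- Let $(X,\mathrm{dist})$ be a metric space, $\mu$ a finite Borel measure on $X$ (for instance a probability measure), and $\phi=(\phi_{\mathbf t})_{\mathbf t\in\mathbb R^d}$ a continuous action of $\mathbb R^d$ on $X$ preserving $\mu$. Write $e(s)=e^{2\pi i s}$, $L^2_0=\{f\in L^2(X,\mu;\mathbb C):\int f\,d\mu=0\}$, and $C^0$ for the continuous functions $X\to\mathbb C$. Assume that $\phi$ is Hölder continuous: there are $\rho'>0$ and $C$ with $\mathrm{dist}(\phi_{\mathbf s}y,\phi_{\mathbf t}y)\le C|\mathbf s-\mathbf t|^{\rho'}$ for all $y\in X$ and $|\mathbf s-\mathbf t|\le 1$. Let $(\mathcal B,\|\cdot\|_{\mathcal B})$ be a complex vector space of functions $X\to\mathbb C$, complete in its norm, closed under pointwise products and complex conjugation, with $\|fg\|_{\mathcal B}\ll\|f\|_{\mathcal B}\|g\|_{\mathcal B}$, and satisfying condition (N): * (N1) for some $\rho>0$, every $f\in\mathcal B$ is a bounded $\rho$-Hölder function, with $\sup_y|f(y)|\ll\|f\|_{\mathcal B}$ and $|f(y)-f(z)|\ll\|f\|_{\mathcal B}\,\mathrm{dist}(y,z)^{\rho}$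 for all $y,z\in X$; * (N2) for some $\mathcal K>0$, $f\circ\phi_{\mathbf t}\in\mathcal B$ and $\|f\circ\phi_{\mathbf t}\|_{\mathcal B}\ll\|f\|_{\mathcal B}(1+|\mathbf t|)^{\mathcal K}$ for all $f\in\mathcal B$, $\mathbf t\in\mathbb R^d$. Let $x\in X$ and suppose that $\phi$ has polynomially decaying twisted integrals at $x$: there is $\kappa>0$ with $$\sup_{\mathbf a\in\mathbb R^d}\left|\frac1{(2T)^d}\int_{[-T,T]^d}f(\phi_{\mathbf t}x)\,e(\langle\mathbf a,\mathbf t\rangle)\,d\mathbf t\right|\ll\|f\|_{\mathcal B}T^{-\kappa}\qquad\text{for all }T>0,\ f\in\mathcal B\cap L^2_0 .$$ (In these hypotheses the implied constants do not depend on $f,g,y,z,\mathbf t,T$.) Let $\mathcal C$ be the set of all $f\in C^0\cap L^2_0$ that are uniform limits of elements of $\mathcal B$; it is all of $C^0\cap L^2_0$ when $\mathcal B$ is uniformly dense in $C^0$. Then the following hold. 1. There is $\varepsilon_0>0$ such that for all $\varepsilon_1,\dots,\varepsilon_d\in(0,\varepsilon_0)$, with $B_N=\{(n_1^{1+\varepsilon_1},\dots,n_d^{1+\varepsilon_d}):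 n_j\in\{0,\dots,N-1\}\}$, $$\frac1{N^d}\sum_{\mathbf b\in B_N}f(\phi_{\mathbf b}x)\to0\quad(N\to\infty)\qquad\text{for all } f\in\mathcal C,$$ and there are $\delta>0$ and $C$ such that $$\left|\frac1{N^d}\sum_{\mathbf b\in B_N}f(\phi_{\mathbf b}x)\right|\le C\|f\|_{\mathcal B}N^{-\delta}\qquad\text{for all } N\ge1,\ f\in\mathcal B\cap L^2_0 .$$ 2. There is $\delta>0$ such that for every family $(\theta_{\mathbf n})_{\mathbf n\in\mathbb N^d}$ of bounded i.i.d. real random variables on a probability space, almost surely $$\frac1{N^d}\sum_{\mathbf n\in[1,N]^d\cap\mathbb N^d}\theta_{\mathbf n}f(\phi_{\mathbf n}x)\to0\quad(N\to\infty)\qquad\text{for all } f\in\mathcal C,$$ and almost surely there is $C$ such that $$\left|\frac1{N^d}\sum_{\mathbf n\in[1,N]^d\cap\mathbb N^d}\theta_{\mathbf n}f(\phi_{\mathbf n}x)\right|\le C\|f\|_{\mathcal B}N^{-\delta}\qquad\text{for all } N\ge1,\ f\in\mathcal B\cap L^2_0 .$$ -/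

import Mathlib

open MeasureTheory ProbabilityTheory Filter Topology

universe w

/-- A Banach algebra `𝓑` of complex-valued functions on `X`: a normed space `𝓑` (its completeness is
the instance `CompleteSpace 𝓑` where it is used) together with an injective linear map `ev` that
identifies its elements with functions on `X`, such that the resulting space of functions is closed
under pointwise products and complex conjugation and the product is bounded for the norm. -/
structure FunctionAlgebra (X 𝓑 : Type*) [NormedAddCommGroup 𝓑] [NormedSpace ℂ 𝓑] where
  /-- the function on `X` that an element of `𝓑` is -/
  ev : 𝓑 →ₗ[ℂ] (X → ℂ)
  ev_injective : Function.Injective ev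
  mul_mem : ∀ f g : 𝓑, ∃ h : 𝓑, ∀ y, ev h y = ev f y * ev g y
  conj_mem : ∀ f : 𝓑, ∃ h : 𝓑, ∀ y, ev h y = starRingEnd ℂ (ev f y)
  norm_mul_le : ∃ C : ℝ, ∀ f g h : 𝓑, (∀ y, ev h y = ev f y * ev g y) → ‖h‖ ≤ C * ‖f‖ * ‖g‖

/-- `f ∈ L²₀(μ)`: square integrable with mean zero. -/
def InL20 {X : Type*} [MeasurableSpace X] (μ : Measure X) (f : X → ℂ) : Prop :=
  MemLp f 2 μ ∧ ∫ y, f y ∂μ = 0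

/-- The action is Hölder continuous in time, uniformly over the space. -/
def HolderAction {d : ℕ} {X : Type*} [MetricSpace X] (φ : Flow (Fin d → ℝ) X) : Prop :=
  ∃ ρ : ℝ, 0 < ρ ∧ ∃ C : ℝ, ∀ (y : X) (s t : Fin d → ℝ), ‖s - t‖ ≤ 1 →
    dist (φ s y) (φ t y) ≤ C * ‖s - t‖ ^ ρ

/-- First half of condition (N): `𝓑` embeds continuously into the bounded `ρ`-Hölder functions.
(For a finite Borel measure this puts every element of `𝓑` into `L¹ ∩ L²`.) -/
def ConditionN1 {X 𝓑 : Type*} [MetricSpace X] [NormedAddCommGroup 𝓑] [NormedSpace ℂ 𝓑]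
    (B : FunctionAlgebra X 𝓑) : Prop :=
  ∃ ρ : ℝ, 0 < ρ ∧ ∃ C : ℝ, ∀ f : 𝓑, (∀ y, ‖B.ev f y‖ ≤ C * ‖f‖) ∧
    ∀ y z, ‖B.ev f y - B.ev f z‖ ≤ C * ‖f‖ * dist y z ^ ρ

/-- Second half of condition (N): `𝓑` is invariant under the action, and the action increases the
norm at most polynomially. -/
def ConditionN2 {d : ℕ} {X 𝓑 : Type*} [MetricSpace X] [NormedAddCommGroup 𝓑] [NormedSpace ℂ 𝓑]
    (φ : Flow (Fin d → ℝ) X) (B : FunctionAlgebra X 𝓑) : Prop :=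
  ∃ K : ℝ, 0 < K ∧ ∃ C : ℝ, ∀ (t : Fin d → ℝ) (f : 𝓑),
    ∃ g : 𝓑, (∀ y, B.ev g y = B.ev f (φ t y)) ∧ ‖g‖ ≤ C * ‖f‖ * (1 + ‖t‖) ^ K

/-- Condition (N). -/
def ConditionN {d : ℕ} {X 𝓑 : Type*} [MetricSpace X] [NormedAddCommGroup 𝓑] [NormedSpace ℂ 𝓑]
    (φ : Flow (Fin d → ℝ) X) (B : FunctionAlgebra X 𝓑) : Prop :=
  ConditionN1 B ∧ ConditionN2 φ B

/-- The twisted average `(2T)^{-d} ∫_{[-T,T]^d} f(φ_t x) e(⟨a,t⟩) dt`, where `e(s) = exp(2πis)`. -/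
noncomputable def twistedAverage {d : ℕ} {X : Type*} [TopologicalSpace X]
    (φ : Flow (Fin d → ℝ) X) (f : X → ℂ) (x : X) (T : ℝ) (a : Fin d → ℝ) : ℂ :=
  (1 / ((2 * T) ^ d : ℝ) : ℝ) *
    ∫ t in Set.Icc (fun _ : Fin d => -T) (fun _ : Fin d => T),
      f (φ t x) * Complex.exp (2 * Real.pi * Complex.I * ((∑ i, a i * t i : ℝ) : ℂ))

/-- `φ` has polynomially decaying twisted integrals at `x` (with respect to `𝓑` and `μ`): the
supremum over `a` of the twisted averages is `≪ ‖f‖ T^{-κ}`, uniformly over `f ∈ 𝓑 ∩ L²₀`. -/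
def PolyDecayingTwistedIntegrals {d : ℕ} {X 𝓑 : Type*} [MetricSpace X] [MeasurableSpace X]
    [NormedAddCommGroup 𝓑] [NormedSpace ℂ 𝓑] (φ : Flow (Fin d → ℝ) X) (μ : Measure X)
    (B : FunctionAlgebra X 𝓑) (x : X) : Prop :=
  ∃ κ : ℝ, 0 < κ ∧ ∃ C : ℝ, ∀ f : 𝓑, InL20 μ (B.ev f) → ∀ T : ℝ, 0 < T → ∀ a : Fin d → ℝ,
    ‖twistedAverage φ (B.ev f) x T a‖ ≤ C * ‖f‖ * T ^ (-κ)

/-- The continuous functions in `L²₀` that are uniform limits of elements of `𝓑`. If `𝓑` is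
uniformly dense in the continuous functions (as `C^r` is on a compact manifold) this is all of
`C⁰ ∩ L²₀`. -/
def IsTestFunction {X 𝓑 : Type*} [MetricSpace X] [MeasurableSpace X] [NormedAddCommGroup 𝓑]
    [NormedSpace ℂ 𝓑] (μ : Measure X) (B : FunctionAlgebra X 𝓑) (f : X → ℂ) : Prop :=
  Continuous f ∧ InL20 μ f ∧ ∀ η : ℝ, 0 < η → ∃ g : 𝓑, ∀ y, ‖f y - B.ev g y‖ ≤ η

/-- `N^{-d} ∑ f(φ_b x)` over `b = (n₁^{1+ε₁}, …, n_d^{1+ε_d})` with `0 ≤ n_j ≤ N - 1`. -/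
noncomputable def sparseAverage {d : ℕ} {X : Type*} [TopologicalSpace X]
    (φ : Flow (Fin d → ℝ) X) (ε : Fin d → ℝ) (f : X → ℂ) (x : X) (N : ℕ) : ℂ :=
  (1 / (N : ℂ) ^ d) * ∑ n : Fin d → Fin N, f (φ (fun i => ((n i : ℕ) : ℝ) ^ (1 + ε i)) x)

/-- `N^{-d} ∑ θ_n f(φ_n x)` over `n ∈ [1,N]^d`. -/
noncomputable def weightedAverage {d : ℕ} {X : Type*} [TopologicalSpace X]
    (φ : Flow (Fin d → ℝ) X) (θ : (Fin d → ℕ) → ℝ) (f : X → ℂ) (x : X) (N : ℕ) : ℂ :=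
  (1 / (N : ℂ) ^ d) * ∑ n ∈ Finset.Icc (fun _ : Fin d => 1) (fun _ : Fin d => N),
    (θ n : ℂ) * f (φ (fun i => (n i : ℝ)) x)

/-- A family of bounded independent identically distributed real random variables. -/
structure IsBoundedIID {ι Ω : Type*} [MeasurableSpace Ω] (P : Measure Ω) (θ : ι → Ω → ℝ) :
    Prop where
  measurable : ∀ n, Measurable (θ n)
  indep : iIndepFun θ P
  ident : ∀ m n, IdentDistrib (θ m) (θ n) P P
  bounded : ∃ M : ℝ, ∀ n, ∀ᵐ ω ∂P, |θ n ω| ≤ M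

/-- `x` is equidistributed along `n^{1+ε}` for all small `ε₁, …, ε_d > 0`. -/
def EquidistributedAlongPowers {d : ℕ} {X 𝓑 : Type*} [MetricSpace X] [MeasurableSpace X]
    [NormedAddCommGroup 𝓑] [NormedSpace ℂ 𝓑] (φ : Flow (Fin d → ℝ) X) (μ : Measure X)
    (B : FunctionAlgebra X 𝓑) (x : X) : Prop :=
  ∃ ε₀ : ℝ, 0 < ε₀ ∧ ∀ ε : Fin d → ℝ, (∀ i, 0 < ε i ∧ ε i < ε₀) →
    ∀ f : X → ℂ, IsTestFunction μ B f →
      Tendsto (fun N : ℕ => sparseAverage φ ε f x N) atTop (𝓝 0)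

/-- The rates of equidistribution along `n^{1+ε}` decay polynomially in `𝓑`. -/
def PolyRatesAlongPowers {d : ℕ} {X 𝓑 : Type*} [MetricSpace X] [MeasurableSpace X]
    [NormedAddCommGroup 𝓑] [NormedSpace ℂ 𝓑] (φ : Flow (Fin d → ℝ) X) (μ : Measure X)
    (B : FunctionAlgebra X 𝓑) (x : X) : Prop :=
  ∃ ε₀ : ℝ, 0 < ε₀ ∧ ∀ ε : Fin d → ℝ, (∀ i, 0 < ε i ∧ ε i < ε₀) →
    ∃ δ : ℝ, 0 < δ ∧ ∃ C : ℝ, ∀ f : 𝓑, InL20 μ (B.ev f) → ∀ N : ℕ, 1 ≤ N →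
      ‖sparseAverage φ ε (B.ev f) x N‖ ≤ C * ‖f‖ * (N : ℝ) ^ (-δ)

/-- `x` is equidistributed with random weights: for every bounded iid family of weights, almost
surely the weighted averages tend to `0` for all test functions at once. -/
def EquidistributedRandomWeights {d : ℕ} {X 𝓑 : Type*} [MetricSpace X] [MeasurableSpace X]
    [NormedAddCommGroup 𝓑] [NormedSpace ℂ 𝓑] (φ : Flow (Fin d → ℝ) X) (μ : Measure X)
    (B : FunctionAlgebra X 𝓑) (x : X) : Prop :=
  ∀ (Ω : Type w) [MeasurableSpace Ω] (P : Measure Ω) [IsProbabilityMeasure P]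
    (θ : (Fin d → ℕ) → Ω → ℝ), IsBoundedIID P θ →
    ∀ᵐ ω ∂P, ∀ f : X → ℂ, IsTestFunction μ B f →
      Tendsto (fun N : ℕ => weightedAverage φ (fun n => θ n ω) f x N) atTop (𝓝 0)

/-- The rates of equidistribution with random weights decay polynomially in `𝓑`: one exponent for
all weights, and almost surely one constant for all `f` and `N`. -/
def PolyRatesRandomWeights {d : ℕ} {X 𝓑 : Type*} [MetricSpace X] [MeasurableSpace X]
    [NormedAddCommGroup 𝓑] [NormedSpace ℂ 𝓑] (φ : Flow (Fin d → ℝ) X) (μ : Measure X)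
    (B : FunctionAlgebra X 𝓑) (x : X) : Prop :=
  ∃ δ : ℝ, 0 < δ ∧
    ∀ (Ω : Type w) [MeasurableSpace Ω] (P : Measure Ω) [IsProbabilityMeasure P]
      (θ : (Fin d → ℕ) → Ω → ℝ), IsBoundedIID P θ →
      ∀ᵐ ω ∂P, ∃ C : ℝ, ∀ f : 𝓑, InL20 μ (B.ev f) → ∀ N : ℕ, 1 ≤ N →
        ‖weightedAverage φ (fun n => θ n ω) (B.ev f) x N‖ ≤ C * ‖f‖ * (N : ℝ) ^ (-δ)

/-!
The hypothesis controls integrals of elements of `𝓑` over cubes of the orbit of `x`, twisted by any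
character, with a bound uniform in the character. Multiplying the integrand by a function whose
Fourier series converges absolutely therefore costs only the sum of the coefficients. With periodic
hat functions, whose coefficients are nonnegative, this gives two things: bounds over boxes instead
of cubes (`norm_integral_indicator_mul_tw_le`, `exists_norm_integral_box_tw_le`), and bounds for
averages over lattice points `q ℤ^d` (`FlowBounds.norm_sum_lattice_le`). `FlowBounds` collects these
and the other consequences of the hypotheses with common constants. An element of `𝓑` whose mean is
not zero is treated by subtracting a multiple of a fixed element
(`FlowBounds.exists_norm_integral_box_le`); constants need not belong to `𝓑`.

*Random weights.* The mean of the weights contributes an average over integer points. For the centred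
weights, one estimate has to hold for all `f` at once. Applied to `|g|²`, the lattice averages show
that an element small at the points of the sparse lattice `m ℤ^d` is small in quadratic mean over all
integer points of the cube (`FlowBounds.exists_sum_sq_le_of_lattice`). Up to a small error the unit
ball is thus described by `(N / m)^d` values, hence covered by `exp (o (N^d))` elements
(`FlowBounds.exists_cover`), and Hoeffding's inequality, a union bound and the Borel–Cantelli lemma
give the estimate (`FlowBounds.exists_random_sum_le`).

*The sequences `n ^ (1 + ε)`.* Write `n = j Q + r` with `0 ≤ r < Q`. On the block `j` the sequence is
nearly arithmetic, with the speed `L_j = (1 + ε) (j Q) ^ ε` in each coordinate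
(`norm_sum_block_sub_le`), so that the blocks sample the orbit only at distances about `L_j`. If the
point `p` of the sequence may be replaced, on average, by `p + v L_j` for every `v ∈ [0, 1]^d`, then
integrating over `v` turns the sum into integrals over boxes (`norm_sum_block_integral_le`), and these
are small. To justify the replacement, average `f` along the speed, over the times `H a L_j` with
`a < H`, apply the Cauchy–Schwarz inequality, and thicken the points of the sequence to small boxes.
The box integrals of the resulting squares are governed by their means
(`FlowBounds.exists_sum_sq_block_le`), so it remains to bound the sum over `j` of
`∫ |∑_a (f ∘ φ_{H a L_j} - f ∘ φ_{(H a + v) L_j})|² dμ`. Expanding the square gives differences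
`Γ (k L_j) - Γ ((k ± v) L_j)` of values of the correlation function `Γ` of `f`, where `k` is a multiple
of `H`. No mixing is available, and none is needed: as `L_j` is proportional to `j ^ ε` and varies
slowly, the average over `j` is an integral in which replacing `k` by `k ± v` is a change of scale by a
factor close to one (`norm_integral_comp_rpow_sub_le`, `norm_sum_correlation_sub_le`,
`FlowBounds.sum_integral_sq_le`). All parameters are powers of `m ≈ N ^ (1 / A)`; for `ε ≤ 1 / A` the
speeds are `O(m)`, and every error is a negative power of `m` (`FlowBounds.polyRatesAlongPowers`).

Convergence for all test functions follows from the rates by approximation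
(`FlowBounds.tendsto_of_isTestFunction`).
-/

/-! ### Periodic hat functions -/

/-- The hat function of half-width and height `R` around the integers: `max (0, R - ‖x‖)`, where
`‖x‖` is the distance of `x` to the nearest integer. -/
noncomputable def hat (R x : ℝ) : ℝ := max 0 (R - |x - round x|)

/-- The cosine coefficients of `hat R`, for `n ≥ 1` (the value at `n = 0` is the junk value `0`; the
constant term of the Fourier series is `R ^ 2`). -/
noncomputable def hatCoeff (R : ℝ) (n : ℕ) : ℝ :=
  (1 - Real.cos (2 * Real.pi * n * R)) / (Real.pi ^ 2 * n ^ 2)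

theorem hatCoeff_nonneg (R : ℝ) (n : ℕ) : 0 ≤ hatCoeff R n :=
  div_nonneg (sub_nonneg.2 (Real.cos_le_one _)) (by positivity)

theorem hasSum_of_eq {M : Type*} [AddCommMonoid M] [TopologicalSpace M] {f g : ℕ → M} {a b : M}
    (h : HasSum f a) (hfg : ∀ n, f n = g n) (hab : a = b) : HasSum g b := by
  rwa [← hab, ← funext hfg]

/-- The Fourier series of the second Bernoulli polynomial, even in `x`. -/
theorem hasSum_cos_div_sq {x : ℝ} (hx : |x| ≤ 1) :
    HasSum (fun n : ℕ => 1 / (n : ℝ) ^ 2 * Real.cos (2 * Real.pi * n * x))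
      (Real.pi ^ 2 * (x ^ 2 - |x| + 1 / 6)) := by
  have h := hasSum_one_div_nat_pow_mul_cos (k := 1) one_ne_zero (x := |x|) ⟨abs_nonneg x, hx⟩
  have h2 : Polynomial.eval |x| (Polynomial.map (algebraMap ℚ ℝ) (Polynomial.bernoulli (2 * 1)))
      = |x| ^ 2 - |x| + 6⁻¹ := bernoulliFun_two |x|
  rw [h2, sq_abs] at h
  refine hasSum_of_eq h (fun n => ?_) ?_
  · rcases abs_cases x with ⟨h, _⟩ | ⟨h, _⟩ <;> rw [h]
    rw [← Real.cos_neg]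
    ring_nf
  · simp only [Nat.factorial]
    push_cast
    ring

theorem hasSum_hat {R : ℝ} (h0 : 0 ≤ R) (h1 : R ≤ 1 / 2) (x : ℝ) :
    HasSum (fun n : ℕ => hatCoeff R n * Real.cos (2 * Real.pi * n * x)) (hat R x - R ^ 2) := by
  have hcos : ∀ n : ℕ, Real.cos (2 * Real.pi * n * x)
      = Real.cos (2 * Real.pi * n * (x - round x)) := by
    intro n
    rw [← Real.cos_sub_int_mul_two_pi (2 * Real.pi * n * x) (n * round x)]
    congr 1
    push_cast
    ring
  have hy : |x - round x| ≤ 1 / 2 := abs_sub_round x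
  simp only [hcos]
  unfold hat
  generalize x - round x = y at hy
  have hy' := abs_le.1 hy
  have e0 := hasSum_cos_div_sq (x := y) (by linarith)
  have e1 := hasSum_cos_div_sq (x := y - R) (by rw [abs_le]; constructor <;> linarith)
  have e2 := hasSum_cos_div_sq (x := y + R) (by rw [abs_le]; constructor <;> linarith)
  refine hasSum_of_eq ((((e0.mul_left 2).sub e1).sub e2).mul_left (1 / (2 * Real.pi ^ 2)))
    (fun n => ?_) ?_
  · rw [mul_sub (2 * Real.pi * n), mul_add (2 * Real.pi * n), Real.cos_add, Real.cos_sub, hatCoeff]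
    have := Real.pi_ne_zero
    rcases eq_or_ne n 0 with rfl | hn
    · simp
    · have : (n : ℝ) ≠ 0 := by exact_mod_cast hn
      field_simp
      ring
  · have := Real.pi_ne_zero
    have key : |y - R| + |y + R| - 2 * |y| = 2 * max 0 (R - |y|) := by
      rcases max_cases 0 (R - |y|) with ⟨h, _⟩ | ⟨h, _⟩ <;> rw [h] <;>
        rcases abs_cases y with ⟨h1, _⟩ | ⟨h1, _⟩ <;>
        rcases abs_cases (y - R) with ⟨h2, _⟩ | ⟨h2, _⟩ <;>
        rcases abs_cases (y + R) with ⟨h3, _⟩ | ⟨h3, _⟩ <;>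
        linarith
    field_simp
    linear_combination 6 * key

theorem hasSum_hatCoeff {R : ℝ} (h0 : 0 ≤ R) (h1 : R ≤ 1 / 2) :
    HasSum (hatCoeff R) (R - R ^ 2) := by
  have := hasSum_hat h0 h1 0
  simpa [hat, h0] using this

theorem hat_nonneg (R x : ℝ) : 0 ≤ hat R x := le_max_left _ _

theorem hat_le {R : ℝ} (h0 : 0 ≤ R) (x : ℝ) : hat R x ≤ R :=
  max_le h0 (by linarith [abs_nonneg (x - round x)])

theorem hat_of_abs_le {R x : ℝ} (hx : |x| ≤ 1 / 2) : hat R x = max 0 (R - |x|) := by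
  have h1 : |x - round x| = |x| := by
    refine le_antisymm ?_ ?_
    · have := round_le x 0
      simpa using this
    · rcases eq_or_ne (round x) 0 with h | h
      · simp [h]
      · have h2 : (1 : ℝ) ≤ |(round x : ℝ)| := by
          exact_mod_cast Int.one_le_abs h
        have h3 : |(round x : ℝ)| ≤ |x - round x| + |x| := by
          have := abs_sub (x - round x) x
          rw [sub_sub_cancel_left, abs_neg] at this
          exact this
        linarith
  rw [hat, h1]

theorem measurable_hat (R : ℝ) : Measurable (hat R) := by
  unfold hat
  have : Measurable fun x : ℝ => (round x : ℝ) := by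
    simp only [round_eq]
    exact measurable_from_top.comp (Int.measurable_floor.comp (measurable_id.add_const _))
  fun_prop

/-! ### Characters and twisted integrals -/

/-- The character `t ↦ e(⟨a, t⟩) = exp (2πi ⟨a, t⟩)` of `ℝ^d`. -/
noncomputable def tw {d : ℕ} (a t : Fin d → ℝ) : ℂ :=
  Complex.exp (2 * Real.pi * Complex.I * ((∑ i, a i * t i : ℝ) : ℂ))

theorem norm_tw {d : ℕ} (a t : Fin d → ℝ) : ‖tw a t‖ = 1 := by
  rw [tw, show (2 * Real.pi * Complex.I * ((∑ i, a i * t i : ℝ) : ℂ))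
    = ((2 * Real.pi * ∑ i, a i * t i : ℝ) : ℂ) * Complex.I by push_cast; ring]
  exact Complex.norm_exp_ofReal_mul_I _

theorem continuous_tw {d : ℕ} (a : Fin d → ℝ) : Continuous (tw a) := by
  unfold tw; fun_prop

theorem tw_zero {d : ℕ} (t : Fin d → ℝ) : tw 0 t = 1 := by simp [tw]

theorem integrable_mul_tw {d : ℕ} {ν : Measure (Fin d → ℝ)} {Φ : (Fin d → ℝ) → ℂ}
    (hΦ : Integrable Φ ν) (a : Fin d → ℝ) : Integrable (fun t => Φ t * tw a t) ν :=
  hΦ.mul_bdd (c := 1) (continuous_tw a).aestronglyMeasurable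
    (Eventually.of_forall fun t => (norm_tw a t).le)

/-- A character times a cosine wave in one coordinate is a combination of two characters. -/
theorem cos_mul_tw {d : ℕ} (i : Fin d) (s u : ℝ) (a t : Fin d → ℝ) :
    (Real.cos (2 * Real.pi * (u * (t i - s))) : ℂ) * tw a t
      = 1 / 2 * (Complex.exp (-(2 * Real.pi * (u * s)) * Complex.I) *
            tw (a + Pi.single i u) t
          + Complex.exp (2 * Real.pi * (u * s) * Complex.I) * tw (a - Pi.single i u) t) := by
  have h1 : ∑ j, (a + Pi.single i u : Fin d → ℝ) j * t j = ∑ j, a j * t j + u * t i := by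
    simp [add_mul, Finset.sum_add_distrib, Pi.single_apply]
  have h2 : ∑ j, (a - Pi.single i u : Fin d → ℝ) j * t j = ∑ j, a j * t j - u * t i := by
    simp [sub_mul, Finset.sum_sub_distrib, Pi.single_apply]
  simp only [tw, h1, h2]
  rw [← Complex.exp_add, ← Complex.exp_add, Complex.ofReal_cos, Complex.cos, div_mul_eq_mul_div,
    add_mul, ← Complex.exp_add, ← Complex.exp_add, one_div, inv_mul_eq_div]
  push_cast
  congr 3 <;> ring

/-- A cosine wave in one coordinate shifts the frequency of the character, so a bound that is uniform
in the frequency is not affected. -/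
theorem norm_integral_cos_mul_tw_le {d : ℕ} {ν : Measure (Fin d → ℝ)} {Φ : (Fin d → ℝ) → ℂ}
    (hΦ : Integrable Φ ν) {E : ℝ} (hE : ∀ a, ‖∫ t, Φ t * tw a t ∂ν‖ ≤ E) (i : Fin d) (s u : ℝ)
    (a : Fin d → ℝ) :
    ‖∫ t, Φ t * (Real.cos (2 * Real.pi * (u * (t i - s))) : ℂ) * tw a t ∂ν‖ ≤ E := by
  have hz : ∀ r : ℝ, ‖Complex.exp (r * Complex.I)‖ = 1 := fun r => Complex.norm_exp_ofReal_mul_I r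
  set z₁ := Complex.exp (-(2 * Real.pi * (u * s)) * Complex.I) with hz₁
  set z₂ := Complex.exp (2 * Real.pi * (u * s) * Complex.I) with hz₂
  have n1 : ‖z₁‖ = 1 := by
    have := hz (-(2 * Real.pi * (u * s))); push_cast at this; exact this
  have n2 : ‖z₂‖ = 1 := by
    have := hz (2 * Real.pi * (u * s)); push_cast at this; exact this
  have : ∀ t, Φ t * (Real.cos (2 * Real.pi * (u * (t i - s))) : ℂ) * tw a t
      = 1 / 2 * (z₁ * (Φ t * tw (a + Pi.single i u) t)
        + z₂ * (Φ t * tw (a - Pi.single i u) t)) := by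
    intro t
    rw [mul_assoc, cos_mul_tw]
    ring
  simp only [this]
  rw [integral_const_mul, integral_add ((integrable_mul_tw hΦ _).const_mul _)
    ((integrable_mul_tw hΦ _).const_mul _), integral_const_mul, integral_const_mul]
  calc _ ≤ 1 / 2 * (‖z₁ * ∫ t, Φ t * tw (a + Pi.single i u) t ∂ν‖
        + ‖z₂ * ∫ t, Φ t * tw (a - Pi.single i u) t ∂ν‖) := by
        rw [norm_mul, show ‖(1 / 2 : ℂ)‖ = 1 / 2 by norm_num]
        exact mul_le_mul_of_nonneg_left (norm_add_le _ _) (by norm_num)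
    _ ≤ 1 / 2 * (E + E) := by
        rw [norm_mul, norm_mul, n1, n2, one_mul, one_mul]
        gcongr <;> exact hE _
    _ = E := by ring

/-- Multiplying by a periodic hat function does not spoil a bound on twisted integrals that is
uniform in the twist, since the Fourier coefficients of the hat are nonnegative with sum `R`. -/
theorem norm_integral_hat_mul_tw_le {d : ℕ} {ν : Measure (Fin d → ℝ)} {Φ : (Fin d → ℝ) → ℂ}
    (hΦ : Integrable Φ ν) {E : ℝ} (hE : ∀ a, ‖∫ t, Φ t * tw a t ∂ν‖ ≤ E) (i : Fin d) (s P : ℝ)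
    {R : ℝ} (h0 : 0 ≤ R) (h1 : R ≤ 1 / 2) (a : Fin d → ℝ) :
    ‖∫ t, Φ t * (hat R ((t i - s) / P) : ℂ) * tw a t ∂ν‖ ≤ R * E := by
  set c : ℕ → (Fin d → ℝ) → ℂ := fun n t =>
    (Real.cos (2 * Real.pi * (n / P * (t i - s))) : ℂ)
  set G : ℕ → (Fin d → ℝ) → ℂ := fun n t => (hatCoeff R n : ℂ) * (Φ t * c n t * tw a t)
  have hcm : ∀ n, Continuous (c n) := fun n => by simp only [c]; fun_prop
  have hci : ∀ n, Integrable (fun t => Φ t * c n t * tw a t) ν := fun n =>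
    integrable_mul_tw (hΦ.mul_bdd (c := 1) (hcm n).aestronglyMeasurable
      (Eventually.of_forall fun t => by
        simp only [c, Complex.norm_real]; exact Real.abs_cos_le_one _)) a
  have hGi : ∀ n, Integrable (G n) ν := fun n => (hci n).const_mul _
  have hsum : ∀ t, HasSum (fun n => G n t)
      (Φ t * (hat R ((t i - s) / P) : ℂ) * tw a t - (R ^ 2 : ℝ) * (Φ t * tw a t)) := by
    intro t
    have h := (Complex.hasSum_ofReal.2 (hasSum_hat h0 h1 ((t i - s) / P))).mul_left (Φ t * tw a t)
    refine hasSum_of_eq h (fun n => ?_) ?_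
    · simp only [G, c]
      rw [show 2 * Real.pi * (n / P * (t i - s)) = 2 * Real.pi * n * ((t i - s) / P) by ring]
      push_cast
      ring
    · push_cast
      ring
  have hnorm : ∀ n, ∫ t, ‖G n t‖ ∂ν ≤ hatCoeff R n * ∫ t, ‖Φ t‖ ∂ν := by
    intro n
    rw [← integral_const_mul]
    refine integral_mono (hGi n).norm (hΦ.norm.const_mul _) fun t => ?_
    simp only [G, c, norm_mul, norm_tw, mul_one, Complex.norm_real,
      Real.norm_of_nonneg (hatCoeff_nonneg R n)]
    exact mul_le_mul_of_nonneg_left (mul_le_of_le_one_right (norm_nonneg _)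
      (Real.abs_cos_le_one _)) (hatCoeff_nonneg R n)
  have hs : Summable fun n => ∫ t, ‖G n t‖ ∂ν :=
    Summable.of_nonneg_of_le (fun n => integral_nonneg fun t => norm_nonneg _) hnorm
      ((hasSum_hatCoeff h0 h1).summable.mul_right _)
  have hI := hasSum_integral_of_summable_integral_norm hGi hs
  have hterm : ∀ n, ‖∫ t, G n t ∂ν‖ ≤ hatCoeff R n * E := by
    intro n
    simp only [G]
    rw [integral_const_mul, norm_mul, Complex.norm_real, Real.norm_of_nonneg (hatCoeff_nonneg R n)]
    exact mul_le_mul_of_nonneg_left (norm_integral_cos_mul_tw_le hΦ hE i s (n / P) a)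
      (hatCoeff_nonneg R n)
  have hb := tsum_of_norm_bounded ((hasSum_hatCoeff h0 h1).mul_right E) hterm
  have hhat : Integrable (fun t => Φ t * (hat R ((t i - s) / P) : ℂ) * tw a t) ν := by
    refine integrable_mul_tw (hΦ.mul_bdd (c := R) ?_ (Eventually.of_forall fun t => ?_)) a
    · refine Measurable.aestronglyMeasurable ?_
      exact Complex.measurable_ofReal.comp ((measurable_hat R).comp (by fun_prop))
    · rw [Complex.norm_real, Real.norm_of_nonneg (hat_nonneg _ _)]
      exact hat_le h0 _
  have heq : ∫ t, Φ t * (hat R ((t i - s) / P) : ℂ) * tw a t ∂ν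
      = ∑' n, ∫ t, G n t ∂ν + (R ^ 2 : ℝ) * ∫ t, Φ t * tw a t ∂ν := by
    rw [hI.tsum_eq]
    simp only [(hsum _).tsum_eq]
    rw [integral_sub hhat ((integrable_mul_tw hΦ a).const_mul _), integral_const_mul]
    ring
  rw [heq]
  calc _ ≤ (R - R ^ 2) * E + R ^ 2 * E := by
        refine (norm_add_le _ _).trans (add_le_add hb ?_)
        rw [norm_mul, Complex.norm_real, Real.norm_of_nonneg (by positivity)]
        exact mul_le_mul_of_nonneg_left (hE a) (by positivity)
    _ = R * E := by ring

/-! ### Integrals over boxes -/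

theorem measureReal_slab_le {d : ℕ} {T p q : ℝ} (hT : 0 ≤ T) (hpq : p ≤ q) (i : Fin d) :
    volume.real (Set.Icc (fun _ : Fin d => -T) (fun _ => T) ∩ {t | t i ∈ Set.Icc p q})
      ≤ (q - p) * (2 * T) ^ (d - 1) := by
  set a : Fin d → ℝ := Function.update (fun _ => -T) i p
  set b : Fin d → ℝ := Function.update (fun _ => T) i q
  have hab : a ≤ b := by
    intro l
    by_cases h : l = i
    · subst h; simpa [a, b] using hpq
    · simp [a, b, h]; linarith
  have hsub : Set.Icc (fun _ : Fin d => -T) (fun _ => T) ∩ {t | t i ∈ Set.Icc p q} ⊆ Set.Icc a b := by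
    rintro t ⟨⟨h1, h2⟩, h3⟩
    constructor <;> intro l <;> by_cases h : l = i
    · subst h; simpa [a] using h3.1
    · simpa [a, h] using h1 l
    · subst h; simpa [b] using h3.2
    · simpa [b, h] using h2 l
  refine (measureReal_mono hsub (by exact (measure_Icc_lt_top).ne)).trans (le_of_eq ?_)
  rw [measureReal_def, Real.volume_Icc_pi_toReal hab]
  have : ∀ l, b l - a l = Function.update (fun _ : Fin d => 2 * T) i (q - p) l := by
    intro l
    by_cases h : l = i
    · subst h; simp [a, b]
    · simp [a, b, h]; ring
  simp only [this]
  rw [Finset.prod_update_of_mem (Finset.mem_univ i), Finset.prod_const,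
    Finset.card_univ_sdiff]
  simp

/-- Restricting one coordinate to an interval: the indicator is compared with a trapezoid, a
multiple of the difference of two hats, whose Fourier series converges absolutely. -/
theorem norm_integral_indicator_mul_tw_le {d : ℕ} {T : ℝ} (hT : 0 < T) {Φ : (Fin d → ℝ) → ℂ}
    (hΦm : Measurable Φ) {M : ℝ} (hM : ∀ t, ‖Φ t‖ ≤ M) {E : ℝ}
    (hE : ∀ a, ‖∫ t in Set.Icc (fun _ : Fin d => -T) (fun _ => T), Φ t * tw a t‖ ≤ E)
    (i : Fin d) {a b : ℝ} (ha : -T ≤ a) (hab : a ≤ b) (hb : b ≤ T) {r : ℝ} (hr : 0 < r)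
    (hr4 : r ≤ 1 / 4) (ξ : Fin d → ℝ) :
    ‖∫ t in Set.Icc (fun _ : Fin d => -T) (fun _ => T),
        Φ t * (Set.Ico a b).indicator 1 (t i) * tw ξ t‖
      ≤ E / r + M * (16 * T * r * (2 * T) ^ (d - 1)) := by
  set Q := Set.Icc (fun _ : Fin d => -T) (fun _ => T) with hQ
  have hQfin : volume Q ≠ ⊤ := measure_Icc_lt_top.ne
  have hQm : MeasurableSet Q := measurableSet_Icc
  have : IsFiniteMeasure (volume.restrict Q) := ⟨by
    rw [Measure.restrict_apply_univ]; exact measure_Icc_lt_top⟩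
  have hM0 : 0 ≤ M := (norm_nonneg _).trans (hM 0)
  have hbi : ∀ {g : (Fin d → ℝ) → ℂ} {c : ℝ}, Measurable g → (∀ t, ‖g t‖ ≤ c) →
      Integrable g (volume.restrict Q) := fun hg hc =>
    Integrable.of_bound hg.aestronglyMeasurable _ (Eventually.of_forall hc)
  have hΦi := hbi hΦm hM
  have hE0 : 0 ≤ E := (norm_nonneg _).trans (hE 0)
  -- `u` maps the cube into `[-1/2, 1/2]` and `[a, b]` to `[-R', R']`; the trapezoid `W / r` is `1`
  -- for `|u| ≤ R'` and `0` for `|u| ≥ R' + r`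
  set c := (a + b) / 2 with hc
  set R' := (b - a) / (16 * T) with hR'
  have hR'0 : 0 ≤ R' := div_nonneg (by linarith) (by positivity)
  have hR'8 : R' ≤ 1 / 8 := by rw [hR', div_le_iff₀ (by positivity)]; linarith
  set u : (Fin d → ℝ) → ℝ := fun t => (t i - c) / (8 * T) with hu
  have hum : Measurable u := by simp only [hu]; fun_prop
  set W : (Fin d → ℝ) → ℂ := fun t => ((hat (R' + r) (u t) : ℂ) - (hat R' (u t) : ℂ)) with hW
  have hhm : ∀ R, Measurable fun t => (hat R (u t) : ℂ) := fun R =>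
    Complex.measurable_ofReal.comp ((measurable_hat R).comp hum)
  have hhb : ∀ R, 0 ≤ R → ∀ t, ‖(hat R (u t) : ℂ)‖ ≤ R := fun R hR t => by
    rw [Complex.norm_real, Real.norm_of_nonneg (hat_nonneg _ _)]; exact hat_le hR _
  have hWm : Measurable W := (hhm _).sub (hhm _)
  set S : Set (Fin d → ℝ) := (Q ∩ {t | t i ∈ Set.Icc (a - 8 * T * r) a}) ∪
    (Q ∩ {t | t i ∈ Set.Icc b (b + 8 * T * r)}) with hS
  have hSvol : volume.real S ≤ 16 * T * r * (2 * T) ^ (d - 1) := by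
    have h8 : 0 ≤ 8 * T * r := by positivity
    refine (measureReal_union_le _ _).trans ?_
    have h1 := measureReal_slab_le (d := d) hT.le (show a - 8 * T * r ≤ a by linarith) i
    have h2 := measureReal_slab_le (d := d) hT.le (show b ≤ b + 8 * T * r by linarith) i
    refine (add_le_add h1 h2).trans (le_of_eq ?_)
    ring
  have hSm : MeasurableSet S := by
    have : ∀ p q : ℝ, MeasurableSet {t : Fin d → ℝ | t i ∈ Set.Icc p q} := fun p q =>
      measurable_pi_apply i measurableSet_Icc
    exact (hQm.inter (this _ _)).union (hQm.inter (this _ _))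
  -- the trapezoid agrees with the indicator off the two slabs
  have hdiff : ∀ t ∈ Q, ‖(Set.Ico a b).indicator (1 : ℝ → ℂ) (t i) - W t / r‖
      ≤ S.indicator (fun _ => (1 : ℝ)) t := by
    intro t ht
    have ht1 := ht.1 i
    have ht2 := ht.2 i
    have hT8 : (0 : ℝ) < 8 * T := by positivity
    have huT : |u t| * (8 * T) = |t i - c| := by
      rw [hu]; simp only; rw [abs_div, abs_of_pos hT8]; field_simp
    have hR'T : R' * (8 * T) = (b - a) / 2 := by rw [hR']; field_simp; ring
    have hu2 : |u t| ≤ 1 / 2 := by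
      have : |t i - c| ≤ 2 * T := by rw [abs_le]; constructor <;> simp only [hc] <;> linarith
      nlinarith
    have hWr : W t = ((max 0 (R' + r - |u t|) - max 0 (R' - |u t|) : ℝ) : ℂ) := by
      simp only [hW]
      rw [hat_of_abs_le hu2, hat_of_abs_le hu2]
      push_cast; ring
    have hind : (Set.Ico a b).indicator (1 : ℝ → ℂ) (t i)
        = (((Set.Ico a b).indicator 1 (t i) : ℝ) : ℂ) := by
      by_cases h : t i ∈ Set.Ico a b <;> simp [h]
    rw [hWr, hind, ← Complex.ofReal_div, ← Complex.ofReal_sub, Complex.norm_real, Real.norm_eq_abs]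
    have hw0 : 0 ≤ max 0 (R' + r - |u t|) - max 0 (R' - |u t|) := by
      rw [sub_nonneg]; exact max_le_max le_rfl (by linarith)
    have hw1 : max 0 (R' + r - |u t|) - max 0 (R' - |u t|) ≤ r := by
      rw [sub_le_iff_le_add]
      exact max_le (by linarith [le_max_left 0 (R' - |u t|)])
        (by linarith [le_max_right 0 (R' - |u t|)])
    have hq0 := div_nonneg hw0 hr.le
    have hq1 : (max 0 (R' + r - |u t|) - max 0 (R' - |u t|)) / r ≤ 1 := by
      rw [div_le_one hr]; exact hw1
    by_cases htS : t ∈ S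
    · rw [Set.indicator_of_mem htS]
      by_cases h : t i ∈ Set.Ico a b <;> simp only [h, Set.indicator_of_mem,
        not_false_eq_true, Set.indicator_of_notMem, Pi.one_apply] <;> rw [abs_le] <;>
        constructor <;> linarith
    · rw [Set.indicator_of_notMem htS]
      have hS1 : ¬ (a - 8 * T * r ≤ t i ∧ t i ≤ a) := fun h => htS (Or.inl ⟨ht, h⟩)
      have hS2 : ¬ (b ≤ t i ∧ t i ≤ b + 8 * T * r) := fun h => htS (Or.inr ⟨ht, h⟩)
      by_cases h : t i ∈ Set.Ico a b
      · have h1 : |t i - c| ≤ (b - a) / 2 := by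
          rw [abs_le]; constructor <;> simp only [hc] <;> linarith [h.1, h.2]
        have h2 : |u t| ≤ R' := by nlinarith
        rw [Set.indicator_of_mem h, max_eq_right (by linarith), max_eq_right (by linarith),
          Pi.one_apply, show R' + r - |u t| - (R' - |u t|) = r by ring, div_self hr.ne']
        simp
      · have h1 : (b - a) / 2 + 8 * T * r ≤ |t i - c| := by
          rw [Set.mem_Ico, not_and_or, not_le, not_lt] at h
          rcases h with h | h
          · have : t i < a - 8 * T * r := by
              by_contra hcon
              exact hS1 ⟨not_lt.1 hcon, h.le⟩
            rw [le_abs]; right; simp only [hc]; linarith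
          · have : b + 8 * T * r < t i := by
              by_contra hcon
              exact hS2 ⟨h, not_lt.1 hcon⟩
            rw [le_abs]; left; simp only [hc]; linarith
        have h2 : R' + r ≤ |u t| := by
          by_contra hcon
          push Not at hcon
          nlinarith
        rw [Set.indicator_of_notMem h, max_eq_left (by linarith), max_eq_left (by linarith)]
        simp
  have hindm : Measurable fun t : Fin d → ℝ => (Set.Ico a b).indicator (1 : ℝ → ℂ) (t i) :=
    (measurable_one.indicator measurableSet_Ico).comp (measurable_pi_apply i)
  have hWb : ∀ t, ‖W t‖ ≤ (R' + r) + R' := fun t =>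
    (norm_sub_le _ _).trans (add_le_add (hhb _ (by positivity) t) (hhb _ hR'0 t))
  have hWi : Integrable (fun t => Φ t * W t * tw ξ t) (volume.restrict Q) :=
    integrable_mul_tw (hΦi.mul_bdd hWm.aestronglyMeasurable (Eventually.of_forall hWb)) ξ
  have hIi : Integrable (fun t => Φ t * (Set.Ico a b).indicator (1 : ℝ → ℂ) (t i) * tw ξ t)
      (volume.restrict Q) :=
    integrable_mul_tw (hΦi.mul_bdd (c := 1) hindm.aestronglyMeasurable
      (Eventually.of_forall fun t => by
        by_cases h : t i ∈ Set.Ico a b <;> simp [h])) ξ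
  -- main term
  have hmain : ‖∫ t in Q, Φ t * W t * tw ξ t‖ ≤ E := by
    have hi : ∀ R, 0 ≤ R → Integrable (fun t => Φ t * (hat R (u t) : ℂ) * tw ξ t)
        (volume.restrict Q) := fun R hR =>
      integrable_mul_tw (hΦi.mul_bdd (hhm R).aestronglyMeasurable
        (Eventually.of_forall (hhb R hR))) ξ
    have : ∀ t, Φ t * W t * tw ξ t
        = Φ t * (hat (R' + r) (u t) : ℂ) * tw ξ t - Φ t * (hat R' (u t) : ℂ) * tw ξ t := by
      intro t; simp only [hW]; ring
    simp only [this]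
    rw [integral_sub (hi _ (by positivity)) (hi _ hR'0)]
    -- the period `8 T` exceeds the side of the cube, and `(R' + r) + R' ≤ 1`
    have h1 := norm_integral_hat_mul_tw_le hΦi hE i c (8 * T) (R := R' + r) (by positivity)
      (by linarith) ξ
    have h2 := norm_integral_hat_mul_tw_le hΦi hE i c (8 * T) (R := R') hR'0 (by linarith) ξ
    refine (norm_sub_le _ _).trans ((add_le_add h1 h2).trans ?_)
    nlinarith
  have hsplit : ∫ t in Q, Φ t * (Set.Ico a b).indicator (1 : ℝ → ℂ) (t i) * tw ξ t
      = (∫ t in Q, Φ t * W t * tw ξ t) / r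
        + ∫ t in Q, Φ t * ((Set.Ico a b).indicator (1 : ℝ → ℂ) (t i) - W t / r) * tw ξ t := by
    rw [← integral_div, ← integral_add (hWi.div_const _)]
    · congr 1; funext t; ring
    · refine (hIi.sub (hWi.div_const (r : ℂ))).congr (Eventually.of_forall fun t => ?_)
      simp only [Pi.sub_apply]; ring
  rw [hsplit]
  refine (norm_add_le _ _).trans (add_le_add ?_ ?_)
  · rw [norm_div, Complex.norm_real, Real.norm_of_nonneg hr.le]
    gcongr
  · have hSi : Integrable (fun t => M * S.indicator (fun _ => (1 : ℝ)) t) (volume.restrict Q) :=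
      ((integrable_const (1 : ℝ)).indicator hSm).const_mul M
    calc _ ≤ ∫ t in Q, M * S.indicator (fun _ => (1 : ℝ)) t := by
          refine norm_integral_le_of_norm_le hSi ?_
          filter_upwards [ae_restrict_mem hQm] with t ht
          rw [norm_mul, norm_tw, mul_one, norm_mul]
          exact mul_le_mul (hM t) (hdiff t ht) (norm_nonneg _) hM0
      _ = M * (volume.restrict Q).real S := by
          rw [integral_const_mul, integral_indicator hSm, setIntegral_const, smul_eq_mul, mul_one]
      _ ≤ M * (16 * T * r * (2 * T) ^ (d - 1)) := by
          refine mul_le_mul_of_nonneg_left (le_trans ?_ hSvol) hM0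
          rw [measureReal_restrict_apply hSm]
          refine measureReal_mono Set.inter_subset_left ?_
          exact ((measure_mono (show S ⊆ Q from by
            rintro t (h | h)
            · exact h.1
            · exact h.1)).trans_lt measure_Icc_lt_top).ne

/-- The half-open box `∏ [a l, b l)`. -/
abbrev box {d : ℕ} (a b : Fin d → ℝ) : Set (Fin d → ℝ) :=
  Set.univ.pi fun l => Set.Ico (a l) (b l)

theorem measurableSet_box {d : ℕ} (a b : Fin d → ℝ) : MeasurableSet (box a b) :=
  MeasurableSet.univ_pi fun _ => measurableSet_Ico

theorem measureReal_box {d : ℕ} {a b : Fin d → ℝ} (h : ∀ l, a l ≤ b l) :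
    volume.real (box a b) = ∏ l, (b l - a l) := by
  rw [measureReal_def, Real.volume_pi_Ico_toReal h]

theorem measure_box_lt_top {d : ℕ} (a b : Fin d → ℝ) : volume (box a b) < ⊤ := by
  rw [Real.volume_pi_Ico]
  exact ENNReal.prod_lt_top fun _ _ => ENNReal.ofReal_lt_top

theorem integrableOn_box {d : ℕ} {E : Type*} [NormedAddCommGroup E]
    {F : (Fin d → ℝ) → E} (hF : Continuous F) (a b : Fin d → ℝ) :
    IntegrableOn F (box a b) := by
  refine (hF.continuousOn.integrableOn_compact (K := Set.Icc a b) isCompact_Icc).mono_set ?_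
  intro t ht
  exact ⟨fun l => (ht l trivial).1, fun l => (ht l trivial).2.le⟩

theorem norm_setIntegral_box_le {d : ℕ} {E : Type*} [NormedAddCommGroup E] [NormedSpace ℝ E]
    {F : (Fin d → ℝ) → E} {M : ℝ} {a b : Fin d → ℝ} (h : ∀ l, a l ≤ b l)
    (hM : ∀ t, ‖F t‖ ≤ M) : ‖∫ t in box a b, F t‖ ≤ M * ∏ l, (b l - a l) := by
  rw [← measureReal_box h]
  exact norm_setIntegral_le_of_norm_le_const (measure_box_lt_top a b) fun t _ => hM t

/-- A bound on the twisted integrals over centred cubes implies, with a smaller exponent, a bound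
on the twisted integrals over boxes: the coordinates are cut one after the other, each cut halving
the exponent. -/
theorem exists_norm_integral_box_tw_le {d : ℕ} {κ : ℝ} (hκ : 0 < κ) {C : ℝ} (hC : 0 ≤ C) :
    ∃ C' : ℝ, 0 ≤ C' ∧ ∀ (F : (Fin d → ℝ) → ℂ) (M : ℝ), Continuous F → 0 ≤ M →
      (∀ t, ‖F t‖ ≤ M) →
      ∀ T : ℝ, 1 ≤ T →
      (∀ ξ, ‖∫ t in Set.Icc (fun _ : Fin d => -T) (fun _ => T), F t * tw ξ t‖
        ≤ C * M * (T ^ d * T ^ (-κ))) →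
      ∀ a b ξ : Fin d → ℝ, (∀ l, -T ≤ a l) → (∀ l, a l ≤ b l) → (∀ l, b l ≤ T) →
        ‖∫ t in box a b, F t * tw ξ t‖ ≤ C' * M * (T ^ d * T ^ (-(κ / 2 ^ d))) := by
  have key : ∀ S : Finset (Fin d), ∃ C' : ℝ, 0 ≤ C' ∧ ∀ (F : (Fin d → ℝ) → ℂ) (M : ℝ),
      Continuous F → 0 ≤ M → (∀ t, ‖F t‖ ≤ M) → ∀ T : ℝ, 1 ≤ T →
      (∀ ξ, ‖∫ t in Set.Icc (fun _ : Fin d => -T) (fun _ => T), F t * tw ξ t‖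
        ≤ C * M * (T ^ d * T ^ (-κ))) →
      ∀ a b ξ : Fin d → ℝ, (∀ l, -T ≤ a l) → (∀ l, a l ≤ b l) → (∀ l, b l ≤ T) →
        ‖∫ t in Set.Icc (fun _ : Fin d => -T) (fun _ => T),
          F t * (∏ l ∈ S, (Set.Ico (a l) (b l)).indicator (1 : ℝ → ℂ) (t l)) * tw ξ t‖
          ≤ C' * M * (T ^ d * T ^ (-(κ / 2 ^ S.card))) := by
    intro S
    induction S using Finset.induction_on with
    | empty =>
      refine ⟨C, hC, fun F M _ _ _ T _ h a b ξ _ _ _ => ?_⟩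
      simpa using h ξ
    | insert i S hi ih =>
      obtain ⟨C', hC', ih⟩ := ih
      refine ⟨4 * C' + 2 * 2 ^ d, by positivity, fun F M hF hM0 hM T hT h a b ξ ha hab hb => ?_⟩
      have hT0 : 0 < T := by linarith
      set k := κ / 2 ^ S.card with hk
      have hk0 : 0 < k := by positivity
      have hr0 : 0 < T ^ (-(k / 2)) := Real.rpow_pos_of_pos hT0 _
      have hr1 : T ^ (-(k / 2)) ≤ 1 := Real.rpow_le_one_of_one_le_of_nonpos hT (by linarith)
      have hindm : ∀ l, Measurable fun t : Fin d → ℝ =>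
          (Set.Ico (a l) (b l)).indicator (1 : ℝ → ℂ) (t l) := fun l =>
        (measurable_one.indicator measurableSet_Ico).comp (measurable_pi_apply l)
      -- ramps of width `r ≈ T ^ (-k / 2)` balance `T ^ (-k) / r` against `r`
      have hc := norm_integral_indicator_mul_tw_le hT0
        (Φ := fun t => F t * ∏ l ∈ S, (Set.Ico (a l) (b l)).indicator (1 : ℝ → ℂ) (t l))
        (hF.measurable.mul (Finset.measurable_prod _ fun l _ => hindm l)) (M := M)
        (fun t => by
          rw [norm_mul, norm_prod]
          refine (mul_le_of_le_one_right (norm_nonneg _) (Finset.prod_le_one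
            (fun _ _ => norm_nonneg _) fun l _ => ?_)).trans (hM t)
          by_cases hl : t l ∈ Set.Ico (a l) (b l) <;> simp [hl])
        (fun ζ => ih F M hF hM0 hM T hT h a b ζ ha hab hb) i (ha i) (hab i) (hb i)
        (r := T ^ (-(k / 2)) / 4) (by positivity) (by linarith) ξ
      have hprod : ∀ t : Fin d → ℝ, F t *
          (∏ l ∈ insert i S, (Set.Ico (a l) (b l)).indicator (1 : ℝ → ℂ) (t l)) * tw ξ t
          = F t * (∏ l ∈ S, (Set.Ico (a l) (b l)).indicator (1 : ℝ → ℂ) (t l)) *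
            (Set.Ico (a i) (b i)).indicator 1 (t i) * tw ξ t := by
        intro t; rw [Finset.prod_insert hi]; ring
      simp only [hprod]
      refine hc.trans (le_of_eq ?_)
      have e1 : -(κ / 2 ^ (insert i S).card) = -(k / 2) := by
        rw [Finset.card_insert_of_notMem hi, hk, pow_succ]; field_simp
      have e2 : T ^ (-k) = T ^ (-(k / 2)) * T ^ (-(k / 2)) := by
        rw [← Real.rpow_add hT0]; ring_nf
      have e3 : T * (2 * T) ^ (d - 1) * 2 = 2 ^ d * T ^ d := by
        have hd : 0 < d := Fin.pos i
        obtain ⟨e, rfl⟩ : ∃ e, d = e + 1 := ⟨d - 1, by omega⟩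
        simp only [Nat.add_sub_cancel, mul_pow, pow_succ]; ring
      rw [e1, e2]
      calc _ = 4 * C' * M * (T ^ d * T ^ (-(k / 2)))
            + M * (2 * (T * (2 * T) ^ (d - 1) * 2) * T ^ (-(k / 2))) := by
            field_simp; ring
        _ = _ := by rw [e3]; ring
  obtain ⟨C', hC', h⟩ := key Finset.univ
  refine ⟨C', hC', fun F M hF hM0 hM T hT hx a b ξ ha hab hb => ?_⟩
  have := h F M hF hM0 hM T hT hx a b ξ ha hab hb
  rw [Finset.card_univ, Fintype.card_fin] at this
  convert this using 2
  have hsub : box a b ⊆ Set.Icc (fun _ : Fin d => -T) (fun _ => T) := fun t ht =>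
    ⟨fun l => (ha l).trans (ht l trivial).1, fun l => (ht l trivial).2.le.trans (hb l)⟩
  have hind : ∀ t : Fin d → ℝ, F t *
      (∏ l, (Set.Ico (a l) (b l)).indicator (1 : ℝ → ℂ) (t l)) * tw ξ t
      = (box a b).indicator (fun t => F t * tw ξ t) t := by
    intro t
    by_cases ht : t ∈ box a b
    · rw [Set.indicator_of_mem ht, Finset.prod_eq_one, mul_one]
      intro l _
      rw [Set.indicator_of_mem (ht l trivial)]; rfl
    · rw [Set.indicator_of_notMem ht]
      simp only [box, Set.mem_pi, Set.mem_univ, true_imp_iff, not_forall] at ht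
      obtain ⟨l, hl⟩ := ht
      rw [Finset.prod_eq_zero (Finset.mem_univ l) (Set.indicator_of_notMem hl _)]
      simp
  simp only [hind]
  rw [setIntegral_indicator (measurableSet_box a b), Set.inter_eq_right.2 hsub]

/-! ### Quantitative bounds on the function algebra -/

/-- Complex conjugation is bounded on a complete function algebra, by the closed graph theorem. -/
theorem FunctionAlgebra.exists_conj_norm_le {X 𝓑 : Type*} [NormedAddCommGroup 𝓑]
    [NormedSpace ℂ 𝓑] [CompleteSpace 𝓑] (B : FunctionAlgebra X 𝓑)
    (hev : ∃ C : ℝ, ∀ f y, ‖B.ev f y‖ ≤ C * ‖f‖) :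
    ∃ C : ℝ, ∀ f, ∃ g, (∀ y, B.ev g y = starRingEnd ℂ (B.ev f y)) ∧ ‖g‖ ≤ C * ‖f‖ := by
  choose c hc using B.conj_mem
  obtain ⟨C, hC⟩ := hev
  have hevc : ∀ y, Continuous fun f => B.ev f y := by
    intro y
    let L : 𝓑 →ₗ[ℂ] ℂ := (LinearMap.proj y).comp B.ev
    exact (L.mkContinuous C fun f => hC f y).continuous
  let L : 𝓑 →ₗ[ℝ] 𝓑 :=
    { toFun := c
      map_add' := fun f g => B.ev_injective (funext fun y => by
        rw [hc, map_add, map_add, Pi.add_apply, Pi.add_apply, map_add, hc, hc])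
      map_smul' := fun r f => B.ev_injective (funext fun y => by
        rw [hc, ← Complex.coe_smul, ← Complex.coe_smul, map_smul, RingHom.id_apply, map_smul,
          Pi.smul_apply, Pi.smul_apply, hc, smul_eq_mul, smul_eq_mul, map_mul,
          Complex.conj_ofReal]) }
  have hL : Continuous L := by
    refine LinearMap.continuous_of_isClosed_graph L ?_
    have : (L.graph : Set (𝓑 × 𝓑))
        = ⋂ y, {p | B.ev p.2 y = starRingEnd ℂ (B.ev p.1 y)} := by
      ext p
      simp only [SetLike.mem_coe, LinearMap.mem_graph_iff, Set.mem_iInter, Set.mem_ofPred_eq]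
      constructor
      · intro h y
        rw [h]; exact hc _ _
      · intro h
        exact B.ev_injective (funext fun y => by rw [h y]; exact (hc _ _).symm)
    rw [this]
    exact isClosed_iInter fun y => isClosed_eq ((hevc y).comp continuous_snd)
      (Complex.continuous_conj.comp ((hevc y).comp continuous_fst))
  refine ⟨‖(⟨L, hL⟩ : 𝓑 →L[ℝ] 𝓑)‖, fun f => ⟨c f, hc f, ?_⟩⟩
  exact (⟨L, hL⟩ : 𝓑 →L[ℝ] 𝓑).le_opNorm f

section Bounds

variable {d : ℕ} {X 𝓑 : Type*} [MetricSpace X] [MeasurableSpace X] [NormedAddCommGroup 𝓑]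
  [NormedSpace ℂ 𝓑]

/-- The consequences of the hypotheses that the proof uses, with common constants: `C` for all
implied constants, `ρ` for the Hölder exponent along orbits, `K` for the growth of norms under the
flow, `κ` for the decay of twisted integrals over boxes. -/
structure FlowBounds (φ : Flow (Fin d → ℝ) X) (μ : Measure X) (B : FunctionAlgebra X 𝓑) (x : X)
    (C ρ : ℝ) (K : ℕ) (κ : ℝ) : Prop where
  one_le : 1 ≤ C
  rho_pos : 0 < ρ
  rho_le : ρ ≤ 1
  kappa_pos : 0 < κ
  continuous : ∀ f, Continuous (B.ev f)
  bound : ∀ f y, ‖B.ev f y‖ ≤ C * ‖f‖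
  holder : ∀ f y s t, ‖B.ev f (φ s y) - B.ev f (φ t y)‖ ≤ C * ‖f‖ * ‖s - t‖ ^ ρ
  trans : ∀ t f, ∃ g, (∀ y, B.ev g y = B.ev f (φ t y)) ∧ ‖g‖ ≤ C * ‖f‖ * (1 + ‖t‖) ^ K
  mul_conj : ∀ f g, ∃ h, (∀ y, B.ev h y = B.ev f y * starRingEnd ℂ (B.ev g y)) ∧
    ‖h‖ ≤ C * ‖f‖ * ‖g‖
  twisted : ∀ f, InL20 μ (B.ev f) → ∀ T : ℝ, 1 ≤ T → ∀ a b ξ : Fin d → ℝ, (∀ l, -T ≤ a l) →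
    (∀ l, a l ≤ b l) → (∀ l, b l ≤ T) →
    ‖∫ t in box a b, B.ev f (φ t x) * tw ξ t‖ ≤ C * ‖f‖ * (T ^ d * T ^ (-κ))

/-- The Hölder exponent along orbits is the product of those of the functions and of the action,
lowered to `1` if necessary; the bound for times further apart than `1` is the bound on the supremum.
The exponent `κ` is the one that survives the cutting of `d` coordinates. -/
theorem exists_flowBounds [CompleteSpace 𝓑] (φ : Flow (Fin d → ℝ) X) (μ : Measure X)
    (hφ : HolderAction φ) (B : FunctionAlgebra X 𝓑) (hN : ConditionN φ B)
    (x : X) (hx : PolyDecayingTwistedIntegrals φ μ B x) :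
    ∃ C ρ K κ, FlowBounds φ μ B x C ρ K κ := by
  obtain ⟨⟨ρ₁, hρ₁, C₁, h1⟩, K, hK, C₂, h2⟩ := hN
  obtain ⟨ρ₂, hρ₂, C₃, h3⟩ := hφ
  obtain ⟨κ, hκ, C₄, h4⟩ := hx
  obtain ⟨C₅, h5⟩ := B.norm_mul_le
  obtain ⟨C₆, h6⟩ := B.exists_conj_norm_le ⟨C₁, fun f => (h1 f).1⟩
  have hcont : ∀ f, Continuous (B.ev f) := by
    intro f
    rw [Metric.continuous_iff']
    intro y ε hε
    have : Tendsto (fun z => C₁ * ‖f‖ * dist z y ^ ρ₁) (𝓝 y) (𝓝 0) := by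
      have h : Continuous fun z => C₁ * ‖f‖ * dist z y ^ ρ₁ :=
        continuous_const.mul ((continuous_id.dist continuous_const).rpow_const fun _ =>
          Or.inr hρ₁.le)
      simpa [Real.zero_rpow hρ₁.ne'] using h.tendsto y
    filter_upwards [this.eventually_lt_const hε] with z hz
    rw [dist_eq_norm]
    exact ((h1 f).2 z y).trans_lt hz
  have hC₁ : ∀ f, ∀ y, ‖B.ev f y‖ ≤ |C₁| * ‖f‖ := fun f y => ((h1 f).1 y).trans
    (mul_le_mul_of_nonneg_right (le_abs_self _) (norm_nonneg _))
  obtain ⟨C₇, hC₇, h7⟩ := exists_norm_integral_box_tw_le (d := d) hκ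
    (C := 2 ^ d * |C₄|) (by positivity)
  set ρ := min 1 (ρ₁ * ρ₂) with hρ
  set A := |C₁| + 1 with hA
  set H := A * (|C₃| ^ ρ₁ + 2) with hH
  set C := 1 + A + H + |C₂| + |C₅| * |C₆| + C₇ * (A + 1) with hC
  have hA0 : 0 < A := by positivity
  have hH0 : 0 ≤ H := by positivity
  have p1 : 0 ≤ |C₅| * |C₆| := by positivity
  have p2 : 0 ≤ C₇ * (A + 1) := by positivity
  have p3 : 0 ≤ |C₂| := abs_nonneg _
  have hρ0 : 0 < ρ := lt_min one_pos (mul_pos hρ₁ hρ₂)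
  have hCs : ∀ c : ℝ, c ≤ C → ∀ f : 𝓑, c * ‖f‖ ≤ C * ‖f‖ := fun c hc f =>
    mul_le_mul_of_nonneg_right hc (norm_nonneg _)
  refine ⟨C, ρ, ⌈K⌉₊, κ / 2 ^ d, by linarith, hρ0, min_le_left _ _,
    by positivity, hcont, ?_, ?_, ?_, ?_, ?_⟩
  · intro f y
    exact (hC₁ f y).trans (hCs _ (by linarith) f)
  · intro f y s t
    have hn : 0 ≤ ‖s - t‖ ^ ρ := Real.rpow_nonneg (norm_nonneg _) _
    refine le_trans ?_ (mul_le_mul_of_nonneg_right (hCs H (by linarith) f) hn)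
    rcases le_total ‖s - t‖ 1 with h | h
    · have e1 : dist (φ s y) (φ t y) ≤ |C₃| * ‖s - t‖ ^ ρ₂ := (h3 y s t h).trans
        (mul_le_mul_of_nonneg_right (le_abs_self _) (Real.rpow_nonneg (norm_nonneg _) _))
      have e2 : dist (φ s y) (φ t y) ^ ρ₁ ≤ |C₃| ^ ρ₁ * ‖s - t‖ ^ ρ := by
        refine (Real.rpow_le_rpow dist_nonneg e1 hρ₁.le).trans ?_
        rw [Real.mul_rpow (abs_nonneg _) (Real.rpow_nonneg (norm_nonneg _) _),
          ← Real.rpow_mul (norm_nonneg _)]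
        refine mul_le_mul_of_nonneg_left ?_ (Real.rpow_nonneg (abs_nonneg _) _)
        refine Real.rpow_le_rpow_of_exponent_ge' (norm_nonneg _) h hρ0.le ?_
        rw [mul_comm]; exact min_le_right _ _
      have e3 : C₁ * ‖f‖ ≤ A * ‖f‖ :=
        mul_le_mul_of_nonneg_right (by linarith [le_abs_self C₁]) (norm_nonneg _)
      calc _ ≤ C₁ * ‖f‖ * dist (φ s y) (φ t y) ^ ρ₁ := (h1 f).2 _ _
        _ ≤ A * ‖f‖ * (|C₃| ^ ρ₁ * ‖s - t‖ ^ ρ) :=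
            mul_le_mul e3 e2 (Real.rpow_nonneg dist_nonneg _) (by positivity)
        _ ≤ A * ‖f‖ * ((|C₃| ^ ρ₁ + 2) * ‖s - t‖ ^ ρ) := by
            gcongr; linarith
        _ = H * ‖f‖ * ‖s - t‖ ^ ρ := by rw [hH]; ring
    · have e1 : 1 ≤ ‖s - t‖ ^ ρ := Real.one_le_rpow h hρ0.le
      have e2 : 0 ≤ |C₃| ^ ρ₁ := by positivity
      calc _ ≤ |C₁| * ‖f‖ + |C₁| * ‖f‖ := (norm_sub_le _ _).trans (add_le_add (hC₁ f _) (hC₁ f _))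
        _ ≤ A * 2 * ‖f‖ := by rw [hA]; nlinarith [norm_nonneg f]
        _ ≤ A * (|C₃| ^ ρ₁ + 2) * ‖f‖ := by gcongr; linarith
        _ ≤ H * ‖f‖ * ‖s - t‖ ^ ρ := le_mul_of_one_le_right (by positivity) e1
  · intro t f
    obtain ⟨g, hg, hg2⟩ := h2 t f
    refine ⟨g, hg, hg2.trans ?_⟩
    have e1 : (1 + ‖t‖) ^ K ≤ (1 + ‖t‖) ^ ⌈K⌉₊ := by
      rw [← Real.rpow_natCast]
      exact Real.rpow_le_rpow_of_exponent_le (by linarith [norm_nonneg t]) (Nat.le_ceil K)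
    have e2 : C₂ * ‖f‖ ≤ C * ‖f‖ := hCs _ (by linarith [le_abs_self C₂]) f
    exact mul_le_mul e2 e1 (by positivity) (by positivity)
  · intro f g
    obtain ⟨g', hg', hg2⟩ := h6 g
    obtain ⟨h, hh⟩ := B.mul_mem f g'
    refine ⟨h, fun y => by rw [hh, hg'], (h5 f g' h hh).trans ?_⟩
    calc C₅ * ‖f‖ * ‖g'‖ ≤ |C₅| * ‖f‖ * (|C₆| * ‖g‖) := by
          refine mul_le_mul (mul_le_mul_of_nonneg_right (le_abs_self _) (norm_nonneg _))
            (hg2.trans (mul_le_mul_of_nonneg_right (le_abs_self _) (norm_nonneg _)))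
            (norm_nonneg _) (by positivity)
      _ = |C₅| * |C₆| * ‖f‖ * ‖g‖ := by ring
      _ ≤ C * ‖f‖ * ‖g‖ := by
          gcongr; linarith
  · intro f hf T hT a b ξ ha hab hb
    have hT0 : 0 < T := by linarith
    have hcF : Continuous fun t => B.ev f (φ t x) :=
      (hcont f).comp (φ.continuous continuous_id continuous_const)
    have hb' := h7 (fun t => B.ev f (φ t x)) ((A + 1) * ‖f‖) hcF (by positivity)
      (fun t => (hC₁ f _).trans (by gcongr; linarith)) T hT ?_ a b ξ ha hab hb
    · refine hb'.trans (mul_le_mul_of_nonneg_right ?_ (by positivity))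
      rw [← mul_assoc]
      exact hCs _ (by linarith) f
    · intro ζ
      have := h4 f hf T hT0 ζ
      rw [twistedAverage, norm_mul, Complex.norm_real, Real.norm_of_nonneg (by positivity),
        one_div, inv_mul_le_iff₀ (by positivity)] at this
      refine this.trans ?_
      have e : C₄ * ‖f‖ ≤ |C₄| * ((A + 1) * ‖f‖) := by
        refine mul_le_mul (le_abs_self _) ?_ (norm_nonneg _) (abs_nonneg _)
        nlinarith [norm_nonneg f]
      calc (2 * T) ^ d * (C₄ * ‖f‖ * T ^ (-κ)) ≤ (2 * T) ^ d * (|C₄| * ((A + 1) * ‖f‖) * T ^ (-κ)) := by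
            gcongr
        _ = _ := by rw [mul_pow]; ring

end Bounds

section Bounds

variable {d : ℕ} {X 𝓑 : Type*} [MetricSpace X] [MeasurableSpace X] [NormedAddCommGroup 𝓑]
  [NormedSpace ℂ 𝓑]
variable {φ : Flow (Fin d → ℝ) X} {μ : Measure X} {B : FunctionAlgebra X 𝓑} {x : X}
  {C ρ : ℝ} {K : ℕ} {κ : ℝ}

theorem FlowBounds.nonneg (hB : FlowBounds φ μ B x C ρ K κ) : 0 ≤ C := zero_le_one.trans hB.one_le

theorem FlowBounds.continuous_orbit (hB : FlowBounds φ μ B x C ρ K κ) (f : 𝓑) :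
    Continuous fun t => B.ev f (φ t x) :=
  (hB.continuous f).comp (φ.continuous continuous_id continuous_const)

theorem FlowBounds.memLp [BorelSpace X] [IsFiniteMeasure μ] (hB : FlowBounds φ μ B x C ρ K κ)
    (f : 𝓑) (p : ENNReal) : MemLp (B.ev f) p μ :=
  MemLp.of_bound (hB.continuous f).aestronglyMeasurable (C * ‖f‖)
    (Eventually.of_forall (hB.bound f))

theorem FlowBounds.integrable [BorelSpace X] [IsFiniteMeasure μ]
    (hB : FlowBounds φ μ B x C ρ K κ) (f : 𝓑) : Integrable (B.ev f) μ :=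
  memLp_one_iff_integrable.1 (hB.memLp f 1)

theorem FlowBounds.inL20 [BorelSpace X] [IsFiniteMeasure μ] (hB : FlowBounds φ μ B x C ρ K κ)
    {f : 𝓑} (h : ∫ y, B.ev f y ∂μ = 0) : InL20 μ (B.ev f) :=
  ⟨hB.memLp f 2, h⟩

theorem FlowBounds.integral_flow [BorelSpace X]
    (hμ : ∀ t : Fin d → ℝ, MeasurePreserving (φ t) μ μ) (hB : FlowBounds φ μ B x C ρ K κ)
    (f : 𝓑) (t : Fin d → ℝ) : ∫ y, B.ev f (φ t y) ∂μ = ∫ y, B.ev f y ∂μ := by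
  have := integral_map (μ := μ) (hμ t).measurable.aemeasurable (f := B.ev f)
    (hB.continuous f).aestronglyMeasurable
  rw [(hμ t).map_eq] at this
  exact this.symm

/-- Differences of translates along the flow have mean zero, whether or not the function has. -/
theorem FlowBounds.exists_flow_sub [BorelSpace X] [IsFiniteMeasure μ]
    (hμ : ∀ t : Fin d → ℝ, MeasurePreserving (φ t) μ μ) (hB : FlowBounds φ μ B x C ρ K κ)
    (f : 𝓑) (t : Fin d → ℝ) :
    ∃ g, (∀ y, B.ev g y = B.ev f (φ t y) - B.ev f y) ∧ InL20 μ (B.ev g) ∧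
      ‖g‖ ≤ (C + 1) * ‖f‖ * (1 + ‖t‖) ^ K := by
  obtain ⟨g, hg, hgn⟩ := hB.trans t f
  have he : ∀ y, B.ev (g - f) y = B.ev f (φ t y) - B.ev f y := fun y => by
    rw [map_sub, Pi.sub_apply, hg]
  refine ⟨g - f, he, hB.inL20 ?_, (norm_sub_le _ _).trans ?_⟩
  · have h1 : Integrable (fun y => B.ev f (φ t y)) μ :=
      (hB.integrable g).congr (Eventually.of_forall hg)
    simp only [he]
    rw [integral_sub h1 (hB.integrable f), hB.integral_flow hμ, sub_self]
  · have : (1 : ℝ) ≤ (1 + ‖t‖) ^ K := one_le_pow₀ (by linarith [norm_nonneg t])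
    nlinarith [norm_nonneg f]

/-- The algebra contains an element by which means can be corrected: `0` if every element has mean
zero, an element of mean one otherwise. The constants need not belong to the algebra. -/
theorem FlowBounds.exists_corrector [BorelSpace X] [IsFiniteMeasure μ]
    (hB : FlowBounds φ μ B x C ρ K κ) :
    ∃ h : 𝓑, ∀ G : 𝓑, InL20 μ (B.ev (G - (∫ y, B.ev G y ∂μ) • h)) := by
  have hint : ∀ (G h : 𝓑) (c : ℂ), ∫ y, B.ev (G - c • h) y ∂μ
      = ∫ y, B.ev G y ∂μ - c * ∫ y, B.ev h y ∂μ := by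
    intro G h c
    simp only [map_sub, map_smul, Pi.sub_apply, Pi.smul_apply, smul_eq_mul]
    rw [integral_sub (hB.integrable G) ((hB.integrable h).const_mul c), integral_const_mul]
  by_cases hz : ∀ G : 𝓑, ∫ y, B.ev G y ∂μ = 0
  · exact ⟨0, fun G => hB.inL20 (hz _)⟩
  · push Not at hz
    obtain ⟨g, hg⟩ := hz
    refine ⟨(∫ y, B.ev g y ∂μ)⁻¹ • g, fun G => hB.inL20 ?_⟩
    rw [hint]
    simp only [map_smul, Pi.smul_apply, smul_eq_mul]
    rw [integral_const_mul, inv_mul_cancel₀ hg, mul_one, sub_self]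

/-- Box averages along the orbit of an arbitrary element of the algebra are bounded by its mean, up
to a polynomially small error. -/
theorem FlowBounds.exists_norm_integral_box_le [BorelSpace X] [IsFiniteMeasure μ]
    (hB : FlowBounds φ μ B x C ρ K κ) :
    ∃ C' : ℝ, 0 ≤ C' ∧ ∀ (G : 𝓑) (T : ℝ), 1 ≤ T → ∀ a b : Fin d → ℝ, (∀ l, -T ≤ a l) →
      (∀ l, a l ≤ b l) → (∀ l, b l ≤ T) →
      ‖∫ t in box a b, B.ev G (φ t x)‖
        ≤ C' * (‖∫ y, B.ev G y ∂μ‖ * ∏ l, (b l - a l) + ‖G‖ * (T ^ d * T ^ (-κ))) := by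
  obtain ⟨h, hh⟩ := hB.exists_corrector
  have hC := hB.nonneg
  set m := μ.real Set.univ
  have hm : 0 ≤ m := measureReal_nonneg
  refine ⟨C * (1 + C * m * ‖h‖) + C * ‖h‖, by positivity, fun G T hT a b ha hab hb => ?_⟩
  set c := ∫ y, B.ev G y ∂μ with hc
  have hcn : ‖c‖ ≤ C * ‖G‖ * m := norm_integral_le_of_norm_le_const
    (Eventually.of_forall (hB.bound G))
  have hsplit : ∫ t in box a b, B.ev G (φ t x)
      = (∫ t in box a b, B.ev (G - c • h) (φ t x)) + c * ∫ t in box a b, B.ev h (φ t x) := by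
    rw [← integral_const_mul, ← integral_add (integrableOn_box (hB.continuous_orbit _) a b)
      ((integrableOn_box (hB.continuous_orbit _) a b).const_mul c)]
    congr 1; funext t
    simp
  have h1 := hB.twisted (G - c • h) (hh G) T hT a b 0 ha hab hb
  simp only [tw_zero, mul_one] at h1
  have h2 : ‖∫ t in box a b, B.ev h (φ t x)‖ ≤ C * ‖h‖ * ∏ l, (b l - a l) :=
    norm_setIntegral_box_le hab fun t => hB.bound h _
  have h3 : ‖G - c • h‖ ≤ (1 + C * m * ‖h‖) * ‖G‖ := by
    refine (norm_sub_le _ _).trans ?_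
    rw [norm_smul]
    nlinarith [mul_le_mul_of_nonneg_right hcn (norm_nonneg h)]
  have hT0 : 0 < T := by linarith
  have hp : 0 ≤ ∏ l, (b l - a l) := Finset.prod_nonneg fun l _ => sub_nonneg.2 (hab l)
  have hq : 0 ≤ T ^ d * T ^ (-κ) := by positivity
  rw [hsplit]
  calc _ ≤ C * ((1 + C * m * ‖h‖) * ‖G‖) * (T ^ d * T ^ (-κ))
        + ‖c‖ * (C * ‖h‖ * ∏ l, (b l - a l)) := by
        refine (norm_add_le _ _).trans (add_le_add (h1.trans (by gcongr)) ?_)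
        rw [norm_mul]; gcongr
    _ ≤ C * (1 + C * m * ‖h‖) * (‖c‖ * ∏ l, (b l - a l) + ‖G‖ * (T ^ d * T ^ (-κ)))
        + C * ‖h‖ * (‖c‖ * ∏ l, (b l - a l) + ‖G‖ * (T ^ d * T ^ (-κ))) := by
        have e1 : 0 ≤ C * (1 + C * m * ‖h‖) * (‖c‖ * ∏ l, (b l - a l)) := by positivity
        have e2 : 0 ≤ C * ‖h‖ * (‖G‖ * (T ^ d * T ^ (-κ))) := by positivity
        nlinarith
    _ = _ := by ring

end Bounds

/-! ### Grids of boxes -/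

theorem exists_mem_Ico_of_mem_Ico {a : ℕ → ℝ} {M : ℕ} {t : ℝ} (ht : t ∈ Set.Ico (a 0) (a M)) :
    ∃ n : Fin M, t ∈ Set.Ico (a n) (a (n + 1)) := by
  induction M with
  | zero => exact absurd ht (by simp)
  | succ M ih =>
    by_cases h : t < a M
    · obtain ⟨n, hn⟩ := ih ⟨ht.1, h⟩
      exact ⟨n.castSucc, hn⟩
    · exact ⟨Fin.last M, not_lt.1 h, ht.2⟩

/-- An integral over a box is the sum of the integrals over the cells of a grid. -/
theorem setIntegral_box_eq_sum {d : ℕ} {E : Type*} [NormedAddCommGroup E] [NormedSpace ℝ E]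
    {a : Fin d → ℕ → ℝ} (ha : ∀ l, Monotone (a l)) (M : ℕ) {F : (Fin d → ℝ) → E}
    (hF : ∀ a b, IntegrableOn F (box a b)) :
    ∫ t in box (fun l => a l 0) (fun l => a l M), F t
      = ∑ n : Fin d → Fin M, ∫ t in box (fun l => a l (n l)) (fun l => a l (n l + 1)), F t := by
  rw [← integral_iUnion_fintype (fun n => measurableSet_box _ _) ?_ fun n => hF _ _]
  · congr 2
    ext t
    simp only [Set.mem_iUnion]
    constructor
    · intro ht
      choose n hn using fun l => exists_mem_Ico_of_mem_Ico (ht l trivial)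
      exact ⟨n, fun l _ => hn l⟩
    · rintro ⟨n, hn⟩ l _
      exact ⟨(ha l (Nat.zero_le _)).trans (hn l trivial).1,
        (hn l trivial).2.trans_le (ha l (n l).2)⟩
  · intro n n' hnn
    obtain ⟨l, hl⟩ := Function.ne_iff.1 hnn
    have hl' : (n l : ℕ) ≠ n' l := fun h => hl (Fin.ext h)
    have := (ha l).pairwise_disjoint_on_Ico_succ hl'
    rw [Function.onFun, Set.disjoint_left]
    intro t ht ht'
    exact Set.disjoint_left.1 this (ht l trivial) (ht' l trivial)

theorem setIntegral_box_add {d : ℕ} {E : Type*} [NormedAddCommGroup E] [NormedSpace ℝ E]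
    (a b c : Fin d → ℝ) (F : (Fin d → ℝ) → E) :
    ∫ t in box (a + c) (b + c), F t = ∫ t in box a b, F (t + c) := by
  have := (measurePreserving_add_right (volume : Measure (Fin d → ℝ)) c).setIntegral_preimage_emb
    (measurableEmbedding_addRight c) F (box (a + c) (b + c))
  rw [← this]
  congr 2
  ext t
  simp [box]

/-! ### Lattice averages -/

/-- Periodic hats in several coordinates, one Fourier expansion after the other. -/
theorem norm_integral_prod_hat_mul_tw_le {d : ℕ} {ν : Measure (Fin d → ℝ)} {Φ : (Fin d → ℝ) → ℂ}
    (hΦ : Integrable Φ ν) {E : ℝ} (hE : ∀ a, ‖∫ t, Φ t * tw a t ∂ν‖ ≤ E) (P : ℝ)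
    {R : ℝ} (h0 : 0 ≤ R) (h1 : R ≤ 1 / 2) :
    ‖∫ t, Φ t * (∏ l, (hat R (t l / P) : ℂ)) ∂ν‖ ≤ R ^ d * E := by
  have hm : ∀ l : Fin d, Measurable fun t : Fin d → ℝ => (hat R (t l / P) : ℂ) := fun l =>
    Complex.measurable_ofReal.comp ((measurable_hat R).comp (by fun_prop))
  have hb : ∀ (l : Fin d) (t : Fin d → ℝ), ‖(hat R (t l / P) : ℂ)‖ ≤ R := fun l t => by
    rw [Complex.norm_real, Real.norm_of_nonneg (hat_nonneg _ _)]; exact hat_le h0 _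
  have key : ∀ S : Finset (Fin d), Integrable (fun t => Φ t * (∏ l ∈ S, (hat R (t l / P) : ℂ))) ν ∧
      ∀ a, ‖∫ t, Φ t * (∏ l ∈ S, (hat R (t l / P) : ℂ)) * tw a t ∂ν‖ ≤ R ^ S.card * E := by
    intro S
    induction S using Finset.induction_on with
    | empty => simpa using ⟨hΦ, hE⟩
    | insert i S hi ih =>
      have e : ∀ t : Fin d → ℝ, Φ t * (∏ l ∈ insert i S, (hat R (t l / P) : ℂ))
          = Φ t * (∏ l ∈ S, (hat R (t l / P) : ℂ)) * (hat R (t i / P) : ℂ) := fun t => by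
        rw [Finset.prod_insert hi]; ring
      simp only [e]
      refine ⟨ih.1.mul_bdd (hm i).aestronglyMeasurable (Eventually.of_forall (hb i)), fun a => ?_⟩
      have := norm_integral_hat_mul_tw_le ih.1 ih.2 i 0 P h0 h1 a
      simp only [sub_zero] at this
      rw [Finset.card_insert_of_notMem hi, pow_succ']
      linarith
  have := (key Finset.univ).2 0
  simpa [tw_zero] using this

section Bounds

variable {d : ℕ} {X 𝓑 : Type*} [MetricSpace X] [MeasurableSpace X] [NormedAddCommGroup 𝓑]
  [NormedSpace ℂ 𝓑]
variable {φ : Flow (Fin d → ℝ) X} {μ : Measure X} {B : FunctionAlgebra X 𝓑} {x : X}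
  {C ρ : ℝ} {K : ℕ} {κ : ℝ}

theorem hat_add_natCast (R x : ℝ) (n : ℕ) : hat R (x + n) = hat R x := by
  simp [hat]

/-- Averages over the points of the lattice `q ℤ^d` in a cube: the lattice sum is compared with the
integral against a product of hats of period `q`. -/
theorem FlowBounds.norm_sum_lattice_le (hB : FlowBounds φ μ B x C ρ K κ) {f : 𝓑}
    (hf : InL20 μ (B.ev f)) {q M : ℕ} (hq : 1 ≤ q) (hM : 1 ≤ M) :
    ‖∑ n : Fin d → Fin M, B.ev f (φ (fun l => (q : ℝ) * (n l : ℕ)) x)‖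
      ≤ C * (1 + 4 ^ d) * ‖f‖ * ((M : ℝ) ^ d * (q : ℝ) ^ d
          * ((q : ℝ) * M) ^ (-(ρ * κ / (2 * (d + 1))))) := by
  have hC := hB.nonneg
  have hρ := hB.rho_pos
  have hκ := hB.kappa_pos
  have hq1 : (1 : ℝ) ≤ q := by exact_mod_cast hq
  have hM1 : (1 : ℝ) ≤ M := by exact_mod_cast hM
  have hq0 : (0 : ℝ) < q := by linarith
  set T : ℝ := q * M with hTdef
  have hT1 : 1 ≤ T := by nlinarith
  have hT0 : 0 < T := by linarith
  have hqT : (q : ℝ) ≤ T := by nlinarith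
  -- the hats have half-width `s` in the orbit parameter
  set s : ℝ := T ^ (-(κ / (2 * (d + 1)))) / 2 with hs
  have hs0 : 0 < s := by positivity
  have hs1 : s ≤ 1 / 2 := by
    have : T ^ (-(κ / (2 * (d + 1)))) ≤ 1 :=
      Real.rpow_le_one_of_one_le_of_nonpos hT1 (by rw [neg_nonpos]; positivity)
    linarith
  set r : ℝ := s / q with hr
  have hr0 : 0 < r := by positivity
  have hrq : r * q = s := by rw [hr]; field_simp
  have hr1 : r ≤ 1 / 2 := by rw [hr, div_le_iff₀ hq0]; nlinarith
  set F : (Fin d → ℝ) → ℂ := fun t => B.ev f (φ t x) with hF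
  have hFc : Continuous F := hB.continuous_orbit f
  set W : (Fin d → ℝ) → ℝ := fun t => ∏ l, hat r (t l / q) with hW
  have hW0 : ∀ t, 0 ≤ W t := fun t => Finset.prod_nonneg fun l _ => hat_nonneg _ _
  have hWm : Measurable W := Finset.measurable_prod _ fun l _ =>
    (measurable_hat r).comp (by fun_prop)
  have hWb : ∀ t, ‖W t‖ ≤ r ^ d := fun t => by
    rw [Real.norm_of_nonneg (hW0 t)]
    calc W t ≤ ∏ _l : Fin d, r := Finset.prod_le_prod (fun l _ => hat_nonneg _ _)
          fun l _ => hat_le hr0.le _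
      _ = r ^ d := by simp
  have hWi : ∀ a b, IntegrableOn W (box a b) := fun a b =>
    Measure.integrableOn_of_bounded (measure_box_lt_top a b).ne hWm.aestronglyMeasurable
      (Eventually.of_forall hWb)
  have hFW : ∀ a b, IntegrableOn (fun t => F t * (W t : ℂ)) (box a b) := fun a b =>
    (integrableOn_box hFc a b).mul_bdd (c := r ^ d)
      (Complex.measurable_ofReal.comp hWm).aestronglyMeasurable
      (Eventually.of_forall fun t => by
        rw [Complex.norm_real]; exact hWb t)
  set a : Fin d → ℕ → ℝ := fun _ n => (q : ℝ) * n - q / 2 with ha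
  have hmono : ∀ l, Monotone (a l) := fun l m n hmn => by
    have : (m : ℝ) ≤ n := by exact_mod_cast hmn
    simp only [ha]; nlinarith
  -- the integral of the product of hats over one cell
  set lo : Fin d → ℝ := fun _ => -((q : ℝ) / 2)
  set hi : Fin d → ℝ := fun _ => (q : ℝ) / 2
  set w := ∫ t in box lo hi, W t with hw
  set pt : (Fin d → Fin M) → Fin d → ℝ := fun n l => (q : ℝ) * (n l : ℕ) with hpt
  have hcell : ∀ n : Fin d → Fin M,
      box (fun l => a l (n l)) (fun l => a l (n l + 1)) = box (lo + pt n) (hi + pt n) := by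
    intro n
    congr 1 <;> funext l <;> simp only [ha, lo, hi, hpt, Pi.add_apply] <;> push_cast <;> ring
  have hWper : ∀ n t, W (t + pt n) = W t := by
    intro n t
    simp only [hW, hpt, Pi.add_apply]
    refine Finset.prod_congr rfl fun l _ => ?_
    rw [show (t l + (q : ℝ) * (n l : ℕ)) / q = t l / q + (n l : ℕ) by field_simp,
      hat_add_natCast]
  have hsupp : ∀ t ∈ box lo hi, W t ≠ 0 → ‖t‖ ≤ s := by
    intro t ht hWt
    refine (pi_norm_le_iff_of_nonneg hs0.le).2 fun l => ?_
    have h1 : hat r (t l / q) ≠ 0 := Finset.prod_ne_zero_iff.1 hWt l (Finset.mem_univ l)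
    have h2 : |t l / q| ≤ 1 / 2 := by
      rw [abs_div, abs_of_pos hq0, div_le_iff₀ hq0, abs_le]
      have := ht l trivial
      simp only [lo, hi, Set.mem_Ico] at this
      constructor <;> linarith
    rw [hat_of_abs_le h2] at h1
    have h3 : 0 < r - |t l / q| := by
      by_contra hcon
      exact h1 (max_eq_left (not_lt.1 hcon))
    rw [abs_div, abs_of_pos hq0, sub_pos, div_lt_iff₀ hq0, hrq] at h3
    exact h3.le
  have hwlow : (r * s / 2) ^ d ≤ w := by
    set lo' : Fin d → ℝ := fun _ => -(s / 2)
    set hi' : Fin d → ℝ := fun _ => s / 2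
    have hsub : box lo' hi' ⊆ box lo hi := by
      intro t ht l _
      have := ht l trivial
      simp only [lo', hi', lo, hi, Set.mem_Ico] at this ⊢
      constructor <;> linarith
    calc (r * s / 2) ^ d = ∫ t in box lo' hi', (r / 2) ^ d := by
          rw [setIntegral_const, measureReal_box (fun l => by simp only [lo', hi']; linarith)]
          simp only [lo', hi', sub_neg_eq_add, add_halves, Finset.prod_const, Finset.card_univ,
            Fintype.card_fin, smul_eq_mul]
          rw [← mul_pow]; congr 1; ring
      _ ≤ ∫ t in box lo' hi', W t := by
          refine setIntegral_mono_on (integrableOn_const (measure_box_lt_top _ _).ne) (hWi _ _)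
            (measurableSet_box _ _) fun t ht => ?_
          calc (r / 2) ^ d = ∏ _l : Fin d, (r / 2) := by
                rw [Finset.prod_const, Finset.card_univ, Fintype.card_fin]
            _ ≤ W t := by
              refine Finset.prod_le_prod (fun _ _ => by positivity) fun l _ => ?_
              have h1 := ht l trivial
              simp only [lo', hi', Set.mem_Ico] at h1
              have h2 : |t l / q| ≤ r / 2 := by
                rw [abs_div, abs_of_pos hq0, div_le_iff₀ hq0, abs_le]
                constructor <;> linarith
              rw [hat_of_abs_le (by linarith)]
              exact le_max_of_le_right (by linarith)
      _ ≤ w := setIntegral_mono_set (hWi _ _) (Eventually.of_forall hW0)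
            (Eventually.of_forall hsub)
  have hw0 : 0 < w := lt_of_lt_of_le (by positivity) hwlow
  have hbox : ∫ t in box (fun l => a l 0) (fun l => a l M), F t * (W t : ℂ)
      = ∑ n : Fin d → Fin M, ∫ t in box lo hi, F (t + pt n) * (W t : ℂ) := by
    rw [setIntegral_box_eq_sum hmono M hFW]
    refine Finset.sum_congr rfl fun n _ => ?_
    rw [hcell, setIntegral_box_add]
    simp only [hWper]
  have hcmp : ∀ n : Fin d → Fin M, ‖F (pt n) * w - ∫ t in box lo hi, F (t + pt n) * (W t : ℂ)‖
      ≤ C * ‖f‖ * s ^ ρ * w := by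
    intro n
    have hi1 : IntegrableOn (fun t => F (t + pt n) * (W t : ℂ)) (box lo hi) :=
      (integrableOn_box (hFc.comp (continuous_id.add continuous_const)) lo hi).mul_bdd (c := r ^ d)
        (Complex.measurable_ofReal.comp hWm).aestronglyMeasurable
        (Eventually.of_forall fun t => by
          rw [Complex.norm_real]; exact hWb t)
    have hi2 : IntegrableOn (fun t => (W t : ℂ)) (box lo hi) := (hWi lo hi).ofReal
    have e1 : F (pt n) * w = ∫ t in box lo hi, F (pt n) * (W t : ℂ) := by
      rw [integral_const_mul, hw, integral_complex_ofReal]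
    rw [e1, ← integral_sub (hi2.const_mul _) hi1, hw, ← integral_const_mul]
    refine norm_integral_le_of_norm_le ((hWi lo hi).const_mul _) ?_
    filter_upwards [ae_restrict_mem (measurableSet_box lo hi)] with t ht
    rw [← sub_mul, norm_mul, Complex.norm_real, Real.norm_of_nonneg (hW0 t)]
    by_cases hWt : W t = 0
    · simp [hWt]
    · refine mul_le_mul_of_nonneg_right ?_ (hW0 t)
      refine (hB.holder f x (pt n) (t + pt n)).trans ?_
      refine mul_le_mul_of_nonneg_left (Real.rpow_le_rpow (norm_nonneg _) ?_ hρ.le) (by positivity)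
      rw [sub_add_cancel_right, norm_neg]
      exact hsupp t ht hWt
  have hmain : ‖∫ t in box (fun l => a l 0) (fun l => a l M), F t * (W t : ℂ)‖
      ≤ r ^ d * (C * ‖f‖ * (T ^ d * T ^ (-κ))) := by
    have := norm_integral_prod_hat_mul_tw_le (R := r)
      (integrableOn_box hFc (fun l => a l 0) (fun l => a l M))
      (E := C * ‖f‖ * (T ^ d * T ^ (-κ)))
      (fun ξ => hB.twisted f hf T hT1 _ _ ξ
        (fun l => by simp only [ha]; push_cast; nlinarith)
        (fun l => hmono l (Nat.zero_le M)) (fun l => by simp only [ha]; nlinarith)) q hr0.le hr1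
    simpa only [hW, Complex.ofReal_prod] using this
  have htot : ‖∑ n : Fin d → Fin M, F (pt n)‖ * w
      ≤ (M : ℝ) ^ d * (C * ‖f‖ * s ^ ρ * w) + r ^ d * (C * ‖f‖ * (T ^ d * T ^ (-κ))) := by
    have e : (∑ n : Fin d → Fin M, F (pt n)) * w
        = ∑ n : Fin d → Fin M, (F (pt n) * w - ∫ t in box lo hi, F (t + pt n) * (W t : ℂ))
          + ∫ t in box (fun l => a l 0) (fun l => a l M), F t * (W t : ℂ) := by
      rw [hbox, Finset.sum_sub_distrib, Finset.sum_mul]; ring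
    have e2 : ‖∑ n : Fin d → Fin M, F (pt n)‖ * w = ‖(∑ n : Fin d → Fin M, F (pt n)) * w‖ := by
      rw [norm_mul, Complex.norm_real, Real.norm_of_nonneg hw0.le]
    rw [e2, e]
    refine (norm_add_le _ _).trans (add_le_add ?_ hmain)
    refine (norm_sum_le_of_le _ fun n _ => hcmp n).trans (le_of_eq ?_)
    simp
  have hfin : ‖∑ n : Fin d → Fin M, F (pt n)‖
      ≤ (M : ℝ) ^ d * (C * ‖f‖ * s ^ ρ) + 2 ^ d / s ^ d * (C * ‖f‖ * (T ^ d * T ^ (-κ))) := by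
    refine le_of_mul_le_mul_right (htot.trans ?_) hw0
    rw [add_mul]
    refine add_le_add (le_of_eq (by ring)) ?_
    have e : r ^ d = 2 ^ d / s ^ d * (r * s / 2) ^ d := by
      rw [div_mul_eq_mul_div, eq_div_iff (by positivity), ← mul_pow, ← mul_pow]; congr 1; ring
    rw [e]
    calc _ = 2 ^ d / s ^ d * (C * ‖f‖ * (T ^ d * T ^ (-κ))) * (r * s / 2) ^ d := by ring
      _ ≤ _ := by gcongr
  refine hfin.trans ?_
  set k := ρ * κ / (2 * (d + 1)) with hk
  have b1 : s ^ ρ ≤ T ^ (-k) := by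
    have : s ≤ T ^ (-(κ / (2 * (d + 1)))) := by
      have : 0 ≤ T ^ (-(κ / (2 * (d + 1)))) := by positivity
      linarith
    refine (Real.rpow_le_rpow hs0.le this hρ.le).trans (le_of_eq ?_)
    rw [← Real.rpow_mul hT0.le]; congr 1; rw [hk]; field_simp
  have b2 : 2 ^ d / s ^ d * T ^ (-κ) ≤ 4 ^ d * T ^ (-k) := by
    have e : s ^ d = T ^ (-(κ / (2 * (d + 1)) * d)) / 2 ^ d := by
      rw [hs, div_pow, ← Real.rpow_natCast, ← Real.rpow_mul hT0.le]; congr 2; ring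
    rw [e]
    have e2 : (2 : ℝ) ^ d / (T ^ (-(κ / (2 * (d + 1)) * d)) / 2 ^ d) * T ^ (-κ)
        = 4 ^ d * (T ^ (κ / (2 * (d + 1)) * d) * T ^ (-κ)) := by
      rw [Real.rpow_neg hT0.le, show (4 : ℝ) = 2 * 2 by norm_num, mul_pow]; field_simp
    rw [e2, ← Real.rpow_add hT0]
    refine mul_le_mul_of_nonneg_left (Real.rpow_le_rpow_of_exponent_le hT1 ?_) (by positivity)
    have hd : (0 : ℝ) ≤ d := Nat.cast_nonneg d
    have hk1 : k ≤ κ / (2 * (d + 1)) := by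
      rw [hk]; gcongr; nlinarith [hB.rho_le]
    have hk2 : κ / (2 * (d + 1)) * (d + 1) = κ / 2 := by field_simp
    nlinarith
  have hqd : (1 : ℝ) ≤ (q : ℝ) ^ d := one_le_pow₀ hq1
  calc _ ≤ (M : ℝ) ^ d * (C * ‖f‖ * T ^ (-k)) + C * ‖f‖ * T ^ d * (4 ^ d * T ^ (-k)) := by
        refine add_le_add (by gcongr) ?_
        calc _ = C * ‖f‖ * T ^ d * (2 ^ d / s ^ d * T ^ (-κ)) := by ring
          _ ≤ _ := by gcongr
    _ ≤ (M : ℝ) ^ d * (C * ‖f‖ * T ^ (-k)) * q ^ d + C * ‖f‖ * T ^ d * (4 ^ d * T ^ (-k)) := by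
        refine add_le_add ?_ le_rfl
        exact le_mul_of_one_le_right (by positivity) hqd
    _ = _ := by rw [hTdef, mul_pow]; ring

end Bounds

/-! ### Sums over cubes of integer points -/

theorem sum_cube_mul {d : ℕ} {E : Type*} [AddCommMonoid E] (M q : ℕ) (u : (Fin d → ℕ) → E) :
    ∑ n : Fin d → Fin (M * q), u (fun l => n l)
      = ∑ j : Fin d → Fin M, ∑ r : Fin d → Fin q, u (fun l => r l + q * j l) := by
  rw [← Fintype.sum_prod_type']
  refine (Fintype.sum_equiv ((Equiv.arrowProdEquivProdArrow (Fin d) (fun _ => Fin M)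
    (fun _ => Fin q)).symm.trans (Equiv.arrowCongr (Equiv.refl _) finProdFinEquiv)) _ _ ?_).symm
  rintro ⟨j, r⟩
  rfl

theorem sum_Icc_one_eq {d : ℕ} {E : Type*} [AddCommMonoid E] (N : ℕ) (u : (Fin d → ℕ) → E) :
    ∑ n ∈ Finset.Icc (fun _ : Fin d => 1) (fun _ => N), u n
      = ∑ n : Fin d → Fin N, u (fun l => n l + 1) := by
  symm
  refine Finset.sum_bij (fun n _ l => (n l : ℕ) + 1) ?_ ?_ ?_ ?_
  · intro n _
    rw [Finset.mem_Icc]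
    exact ⟨fun l => Nat.le_add_left _ _, fun l => (n l).2⟩
  · intro n _ n' _ h
    funext l
    exact Fin.ext (Nat.succ_injective (congrFun h l))
  · intro n hn
    rw [Finset.mem_Icc] at hn
    have h1 : ∀ l, 1 ≤ n l := hn.1
    have h2 : ∀ l, n l ≤ N := hn.2
    refine ⟨fun l => ⟨n l - 1, by have := h1 l; have := h2 l; omega⟩, Finset.mem_univ _, ?_⟩
    funext l
    have := h1 l
    simp only
    omega
  · intro n _
    rfl

theorem pow_sub_pow_le {a b : ℝ} (hb : 0 ≤ b) (ha : 0 < a) (d : ℕ) :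
    a ^ d - b ^ d ≤ a ^ d * (d * ((a - b) / a)) := by
  have h := one_add_mul_le_pow (a := b / a - 1) (by have := div_nonneg hb ha.le; linarith) d
  rw [add_sub_cancel, div_pow, le_div_iff₀ (by positivity)] at h
  have : (a - b) / a = 1 - b / a := by field_simp
  rw [this]
  linarith

/-- Passing to a smaller cube costs at most the bound of the summand times the number of points
left out. -/
theorem norm_sum_cube_sub_le {d : ℕ} {E : Type*} [NormedAddCommGroup E] {N N' s : ℕ}
    (h : N' + s ≤ N) (u : (Fin d → ℕ) → E) {b : ℝ} (hu : ∀ n, ‖u n‖ ≤ b) :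
    ‖∑ n : Fin d → Fin N, u (fun l => n l) - ∑ n : Fin d → Fin N', u (fun l => n l + s)‖
      ≤ b * ((N : ℝ) ^ d * (d * (((N : ℝ) - N') / N))) := by
  have hb : 0 ≤ b := (norm_nonneg _).trans (hu 0)
  rcases Nat.eq_zero_or_pos N with rfl | hN
  · obtain ⟨rfl, rfl⟩ : N' = 0 ∧ s = 0 := by omega
    simp
  let e : (Fin d → Fin N') ↪ (Fin d → Fin N) :=
    ⟨fun n l => ⟨n l + s, by have := (n l).2; omega⟩, fun n n' hnn => by
      funext l
      have := congrFun hnn l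
      simp only [Fin.mk.injEq, Nat.add_right_cancel_iff] at this
      exact Fin.ext this⟩
  have e1 : ∑ n : Fin d → Fin N', u (fun l => n l + s)
      = ∑ n ∈ Finset.univ.map e, u (fun l => n l) := by
    rw [Finset.sum_map]; rfl
  rw [e1, ← Finset.sum_sdiff (Finset.subset_univ (Finset.univ.map e)), add_sub_cancel_right]
  refine (norm_sum_le_of_le _ fun n _ => hu _).trans ?_
  rw [Finset.sum_const, Finset.card_sdiff_of_subset (Finset.subset_univ _), Finset.card_map,
    Finset.card_univ, Finset.card_univ, Fintype.card_fun, Fintype.card_fun, Fintype.card_fin,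
    Fintype.card_fin, Fintype.card_fin, nsmul_eq_mul, mul_comm,
    Nat.cast_sub (Nat.pow_le_pow_left (by omega) d)]
  push_cast
  exact mul_le_mul_of_nonneg_left (pow_sub_pow_le (Nat.cast_nonneg _)
    (by exact_mod_cast hN) d) hb

/-- The integer part of an `A`-th root. -/
theorem exists_nat_root {A : ℕ} (hA : A ≠ 0) {N : ℕ} (hN : 1 ≤ N) :
    ∃ m : ℕ, 1 ≤ m ∧ m ^ A ≤ N ∧ (N : ℝ) ≤ (2 * m) ^ A := by
  classical
  have h1 : 1 ^ A ≤ N := by simpa using hN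
  set m := Nat.findGreatest (fun m => m ^ A ≤ N) N with hm
  have hm1 : 1 ≤ m := Nat.le_findGreatest hN h1
  have hmA : m ^ A ≤ N := Nat.findGreatest_spec (P := fun m => m ^ A ≤ N) hN h1
  refine ⟨m, hm1, hmA, ?_⟩
  have h2 : N ≤ (m + 1) ^ A := by
    by_contra hcon
    push Not at hcon
    have h3 : m + 1 ≤ N := (Nat.le_self_pow hA _).trans hcon.le
    have : m + 1 ≤ m := Nat.le_findGreatest (P := fun m => m ^ A ≤ N) h3 hcon.le
    omega
  have h4 : N ≤ (2 * m) ^ A := h2.trans (Nat.pow_le_pow_left (by omega) A)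
  exact_mod_cast h4

theorem rpow_neg_le_of_le_pow {A : ℕ} (hA : A ≠ 0) {N m : ℝ} (hm : 0 < m) (hN : 0 < N)
    (h : N ≤ (2 * m) ^ A) {s : ℝ} (hs : 0 ≤ s) : m ^ (-s) ≤ 2 ^ s * N ^ (-(s / A)) := by
  have hA' : (A : ℝ) ≠ 0 := by exact_mod_cast hA
  have h1 : N ^ (s / A) ≤ (2 * m) ^ s := by
    calc N ^ (s / A) ≤ ((2 * m) ^ A) ^ (s / A) :=
          Real.rpow_le_rpow hN.le h (by positivity)
      _ = (2 * m) ^ s := by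
          rw [← Real.rpow_natCast, ← Real.rpow_mul (by positivity)]; congr 1; field_simp
  rw [Real.rpow_neg hm.le, Real.rpow_neg hN.le, ← div_eq_mul_inv, le_div_iff₀ (by positivity),
    inv_mul_le_iff₀ (by positivity), ← Real.mul_rpow hm.le (by norm_num), mul_comm m]
  exact h1

section Bounds

variable {d : ℕ} {X 𝓑 : Type*} [MetricSpace X] [MeasurableSpace X] [NormedAddCommGroup 𝓑]
  [NormedSpace ℂ 𝓑]
variable {φ : Flow (Fin d → ℝ) X} {μ : Measure X} {B : FunctionAlgebra X 𝓑} {x : X}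
  {C ρ : ℝ} {K : ℕ} {κ : ℝ}

theorem norm_le_of_forall_mem_Icc {v : Fin d → ℝ} {b : ℝ} (hb : 0 ≤ b)
    (h : ∀ l, 0 ≤ v l ∧ v l ≤ b) : ‖v‖ ≤ b :=
  (pi_norm_le_iff_of_nonneg hb).2 fun l => by
    rw [Real.norm_of_nonneg (h l).1]; exact (h l).2

/-- The sum over a full cube of integer points is determined, up to a polynomially small error, by
the sum over the sublattice `q ℤ^d`. No assumption on the mean is needed, as differences of
translates have mean zero. -/
theorem FlowBounds.norm_sum_cube_sub_sum_lattice_le [BorelSpace X] [IsFiniteMeasure μ]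
    (hμ : ∀ t : Fin d → ℝ, MeasurePreserving (φ t) μ μ) (hB : FlowBounds φ μ B x C ρ K κ)
    (g : 𝓑) {q M N : ℕ} (hq : 1 ≤ q) (hM : 1 ≤ M) (hN : N = M * q) :
    ‖∑ n : Fin d → Fin N, B.ev g (φ (fun l => ((n l : ℕ) : ℝ) + 1) x)
        - (q : ℂ) ^ d * ∑ n : Fin d → Fin M, B.ev g (φ (fun l => (q : ℝ) * (n l : ℕ)) x)‖
      ≤ C * (1 + 4 ^ d) * ((C + 1) * ‖g‖ * (1 + q) ^ K) * (((M : ℝ) * q) ^ d * (q : ℝ) ^ d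
          * ((q : ℝ) * M) ^ (-(ρ * κ / (2 * (d + 1))))) := by
  subst hN
  have hC := hB.nonneg
  have hq0 : (0 : ℝ) ≤ q := Nat.cast_nonneg q
  set k := ρ * κ / (2 * (d + 1)) with hk
  set b := C * (1 + 4 ^ d) * ((C + 1) * ‖g‖ * (1 + q) ^ K) * ((M : ℝ) ^ d * (q : ℝ) ^ d
    * ((q : ℝ) * M) ^ (-k)) with hb
  have e1 : ∑ n : Fin d → Fin (M * q), B.ev g (φ (fun l => ((n l : ℕ) : ℝ) + 1) x)
      = ∑ r : Fin d → Fin q, ∑ j : Fin d → Fin M,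
        B.ev g (φ (fun l => ((r l : ℕ) + q * (j l : ℕ) : ℝ) + 1) x) := by
    have := sum_cube_mul M q (fun n : Fin d → ℕ => B.ev g (φ (fun l => (n l : ℝ) + 1) x))
    rw [this, Finset.sum_comm]
    push_cast
    rfl
  have e2 : (q : ℂ) ^ d * ∑ n : Fin d → Fin M, B.ev g (φ (fun l => (q : ℝ) * (n l : ℕ)) x)
      = ∑ _r : Fin d → Fin q, ∑ n : Fin d → Fin M,
        B.ev g (φ (fun l => (q : ℝ) * (n l : ℕ)) x) := by
    simp [Finset.sum_const]
  rw [e1, e2, ← Finset.sum_sub_distrib]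
  have hr : ∀ r : Fin d → Fin q, ‖∑ j : Fin d → Fin M,
        B.ev g (φ (fun l => ((r l : ℕ) + q * (j l : ℕ) : ℝ) + 1) x)
      - ∑ n : Fin d → Fin M, B.ev g (φ (fun l => (q : ℝ) * (n l : ℕ)) x)‖ ≤ b := by
    intro r
    set t : Fin d → ℝ := fun l => (r l : ℕ) + 1 with ht
    -- the residue class of `r + 1` modulo `q` is compared with that of `0`
    obtain ⟨g', hg', hg0, hgn⟩ := hB.exists_flow_sub hμ g t
    have htn : ‖t‖ ≤ q := norm_le_of_forall_mem_Icc hq0 fun l =>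
      ⟨by positivity, by have := (r l).2; simp only [ht]; exact_mod_cast this⟩
    have hs := hB.norm_sum_lattice_le hg0 hq hM
    rw [← Finset.sum_sub_distrib]
    have : ∀ j : Fin d → Fin M, B.ev g (φ (fun l => ((r l : ℕ) + q * (j l : ℕ) : ℝ) + 1) x)
        - B.ev g (φ (fun l => (q : ℝ) * (j l : ℕ)) x)
        = B.ev g' (φ (fun l => (q : ℝ) * (j l : ℕ)) x) := by
      intro j
      have e : (fun l => ((r l : ℕ) + q * (j l : ℕ) : ℝ) + 1) = t + fun l => (q : ℝ) * (j l : ℕ) := by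
        funext l
        simp only [ht, Pi.add_apply]; ring
      rw [hg', ← φ.map_add, e]
    simp only [this]
    refine hs.trans ?_
    rw [hb]
    have : ‖g'‖ ≤ (C + 1) * ‖g‖ * (1 + q) ^ K := hgn.trans (by gcongr)
    gcongr
  refine (norm_sum_le_of_le _ fun r _ => hr r).trans (le_of_eq ?_)
  rw [Finset.sum_const, Finset.card_univ, Fintype.card_fun, Fintype.card_fin, Fintype.card_fin,
    nsmul_eq_mul, hb]
  push_cast
  rw [mul_pow]
  ring

/-- Averages over cubes of integer points of elements of mean zero decay polynomially. -/
theorem FlowBounds.exists_norm_sum_cube_le [BorelSpace X] [IsFiniteMeasure μ]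
    (hμ : ∀ t : Fin d → ℝ, MeasurePreserving (φ t) μ μ) (hB : FlowBounds φ μ B x C ρ K κ) :
    ∃ C' : ℝ, 0 ≤ C' ∧ ∀ f : 𝓑, InL20 μ (B.ev f) → ∀ N : ℕ, 1 ≤ N →
      ‖∑ n : Fin d → Fin N, B.ev f (φ (fun l => ((n l : ℕ) : ℝ) + 1) x)‖
        ≤ C' * ‖f‖ * ((N : ℝ) ^ d * (N : ℝ) ^ (-(ρ * κ / (2 * (d + 1))))) := by
  have hC := hB.nonneg
  refine ⟨C * (1 + 4 ^ d) * ((C + 1) * (1 + 1) ^ K) + C * (1 + 4 ^ d), by positivity,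
    fun f hf N hN => ?_⟩
  have h1 := hB.norm_sum_cube_sub_sum_lattice_le hμ f le_rfl hN (mul_one N).symm
  have h2 := hB.norm_sum_lattice_le hf le_rfl hN
  simp only [mul_one, Nat.cast_one, one_pow, one_mul] at h1 h2
  have h3 := norm_add_le_of_le h1 h2
  rw [sub_add_cancel] at h3
  refine h3.trans (le_of_eq ?_)
  ring

/-- An element that is small on the points of the lattice `m ℤ^d` in a cube is small in quadratic
mean over all integer points of the cube, once the side of the cube is a large power of `m`. -/
theorem FlowBounds.exists_sum_sq_le_of_lattice [BorelSpace X] [IsFiniteMeasure μ]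
    (hμ : ∀ t : Fin d → ℝ, MeasurePreserving (φ t) μ μ) (hB : FlowBounds φ μ B x C ρ K κ) :
    ∃ A : ℕ, 2 ≤ A ∧ ∃ C' : ℝ, 0 ≤ C' ∧ ∀ (g : 𝓑) (N m : ℕ), 1 ≤ m → m ^ A ≤ N → ∀ η : ℝ,
      (∀ n : Fin d → Fin (N / m), ‖B.ev g (φ (fun l => (m : ℝ) * (n l : ℕ)) x)‖ ≤ η) →
      ∑ n : Fin d → Fin N, ‖B.ev g (φ (fun l => ((n l : ℕ) : ℝ) + 1) x)‖ ^ 2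
        ≤ (N : ℝ) ^ d * (η ^ 2 + C' * ‖g‖ ^ 2 / m) := by
  have hC := hB.nonneg
  have hρ := hB.rho_pos
  have hκ := hB.kappa_pos
  set k := ρ * κ / (2 * (d + 1)) with hk
  have hk0 : 0 < k := by positivity
  set c₁ := C * (1 + 4 ^ d) * ((C + 1) * C * 2 ^ K) with hc₁
  have hc₁0 : 0 ≤ c₁ := by positivity
  obtain ⟨a, ha⟩ := exists_nat_ge (((K + d + 1 : ℕ) : ℝ) / k)
  -- translations up to `m` and the index of the sublattice cost `m ^ (K + d)`, which
  -- `(m M) ^ (-k) ≤ 2 ^ k m ^ (-(K + d + 1))` compensates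
  refine ⟨a + 2, by omega, c₁ * 2 ^ k + C ^ 2 * d, by positivity, fun g N m hm hmN η hη => ?_⟩
  have hm1 : (1 : ℝ) ≤ m := by exact_mod_cast hm
  have hm0 : (0 : ℝ) < m := by linarith
  have hmle : m ≤ N := (Nat.le_self_pow (by omega) m).trans hmN
  have hN1 : 1 ≤ N := hm.trans hmle
  have hN0 : (0 : ℝ) < N := by exact_mod_cast hN1
  set M := N / m with hM
  have hM1 : 1 ≤ M := (Nat.one_le_div_iff (by omega)).2 hmle
  have hMm : M * m ≤ N := Nat.div_mul_le_self N m
  have hMm' : N ≤ M * m + m := by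
    have := Nat.lt_div_mul_add (a := N) (b := m) (by omega)
    rw [← hM] at this
    omega
  have hMmR : (M : ℝ) * m ≤ N := by exact_mod_cast hMm
  have hMmR' : (N : ℝ) ≤ M * m + m := by exact_mod_cast hMm'
  have hM1R : (1 : ℝ) ≤ M := by exact_mod_cast hM1
  -- the comparison with the sublattice is applied to `|g|²`, which belongs to the algebra
  obtain ⟨h, hh, hhn⟩ := hB.mul_conj g g
  have hh2 : ∀ y, B.ev h y = ((‖B.ev g y‖ ^ 2 : ℝ) : ℂ) := fun y => by
    rw [hh, Complex.mul_conj, Complex.normSq_eq_norm_sq]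
  set v : (Fin d → ℕ) → ℝ := fun n => ‖B.ev g (φ (fun l => (n l : ℝ) + 1) x)‖ ^ 2 with hv
  have hvb : ∀ n, ‖v n‖ ≤ C ^ 2 * ‖g‖ ^ 2 := fun n => by
    rw [Real.norm_of_nonneg (by positivity), ← mul_pow]
    exact pow_le_pow_left₀ (norm_nonneg _) (hB.bound g _) 2
  have hrem := norm_sum_cube_sub_le (d := d) (N := N) (N' := M * m) (s := 0) (by omega) v hvb
  have hlat := hB.norm_sum_cube_sub_sum_lattice_le hμ h hm hM1 rfl
  simp only [hh2] at hlat
  have hlat' : |∑ n : Fin d → Fin (M * m), v (fun l => n l)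
      - (m : ℝ) ^ d * ∑ n : Fin d → Fin M, ‖B.ev g (φ (fun l => (m : ℝ) * (n l : ℕ)) x)‖ ^ 2|
      ≤ C * (1 + 4 ^ d) * ((C + 1) * ‖h‖ * (1 + m) ^ K) * (((M : ℝ) * m) ^ d * (m : ℝ) ^ d
        * ((m : ℝ) * M) ^ (-k)) := by
    refine le_trans (le_of_eq ?_) hlat
    rw [← Real.norm_eq_abs, ← Complex.norm_real]
    simp only [hv]
    push_cast
    rfl
  have hsmall : (m : ℝ) ^ d * ∑ n : Fin d → Fin M,
      ‖B.ev g (φ (fun l => (m : ℝ) * (n l : ℕ)) x)‖ ^ 2 ≤ (N : ℝ) ^ d * η ^ 2 := by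
    calc _ ≤ (m : ℝ) ^ d * ∑ _n : Fin d → Fin M, η ^ 2 := by
          gcongr with n; exact hη n
      _ = ((M : ℝ) * m) ^ d * η ^ 2 := by
          rw [Finset.sum_const, Finset.card_univ, Fintype.card_fun, Fintype.card_fin,
            Fintype.card_fin, nsmul_eq_mul, mul_pow]; push_cast; ring
      _ ≤ _ := by gcongr
  have herr : C * (1 + 4 ^ d) * ((C + 1) * ‖h‖ * (1 + m) ^ K) * (((M : ℝ) * m) ^ d * (m : ℝ) ^ d
      * ((m : ℝ) * M) ^ (-k)) ≤ (N : ℝ) ^ d * (c₁ * 2 ^ k * ‖g‖ ^ 2 / m) := by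
    have q1 : (1 + (m : ℝ)) ^ K ≤ 2 ^ K * (m : ℝ) ^ K := by
      rw [← mul_pow]; exact pow_le_pow_left₀ (by positivity) (by linarith) K
    have q2 : ((m : ℝ) * M) ^ (-k) ≤ 2 ^ k * ((m : ℝ) ^ (K + d + 1))⁻¹ := by
      have : (m : ℝ) ^ (a + 1) ≤ m * M * 2 := by
        have e : (m : ℝ) ^ (a + 2) ≤ N := by exact_mod_cast hmN
        have e2 : (m : ℝ) ^ (a + 1) ≤ m ^ (a + 2) := pow_le_pow_right₀ hm1 (by omega)
        nlinarith
      have h2 : ((m : ℝ) ^ (a + 1) / 2) ≤ m * M := by linarith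
      calc ((m : ℝ) * M) ^ (-k) ≤ ((m : ℝ) ^ (a + 1) / 2) ^ (-k) :=
            Real.rpow_le_rpow_of_nonpos (by positivity) h2 (by linarith)
        _ = 2 ^ k * (((m : ℝ) ^ (a + 1)) ^ k)⁻¹ := by
            rw [Real.rpow_neg (by positivity), Real.div_rpow (by positivity) (by norm_num), inv_div,
              div_eq_mul_inv]
        _ ≤ 2 ^ k * ((m : ℝ) ^ (K + d + 1))⁻¹ := by
            gcongr
            rw [← Real.rpow_natCast _ (a + 1), ← Real.rpow_mul hm0.le, ← Real.rpow_natCast]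
            refine Real.rpow_le_rpow_of_exponent_le hm1 ?_
            have e1 := (div_le_iff₀ hk0).1 ha
            push_cast at e1 ⊢
            nlinarith
    calc _ ≤ C * (1 + 4 ^ d) * ((C + 1) * (C * ‖g‖ * ‖g‖) * (2 ^ K * (m : ℝ) ^ K)) * ((N : ℝ) ^ d
          * (m : ℝ) ^ d * (2 ^ k * ((m : ℝ) ^ (K + d + 1))⁻¹)) := by gcongr
      _ = _ := by rw [hc₁, pow_add, pow_add, pow_one]; field_simp
  have hrem' : ∑ n : Fin d → Fin N, v (fun l => n l)
      ≤ ∑ n : Fin d → Fin (M * m), v (fun l => n l) + (N : ℝ) ^ d * (C ^ 2 * d * ‖g‖ ^ 2 / m) := by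
    have h1 := (le_abs_self _).trans hrem
    simp only [add_zero] at h1
    have h2 : ((N : ℝ) - (M * m : ℕ)) / N ≤ 1 / m := by
      rw [div_le_div_iff₀ hN0 hm0]
      have e : (m : ℝ) ^ (a + 2) ≤ N := by exact_mod_cast hmN
      have e2 : (m : ℝ) ^ 2 ≤ m ^ (a + 2) := pow_le_pow_right₀ hm1 (by omega)
      push_cast
      nlinarith
    have h3 : C ^ 2 * ‖g‖ ^ 2 * ((N : ℝ) ^ d * (d * (((N : ℝ) - (M * m : ℕ)) / N)))
        ≤ C ^ 2 * ‖g‖ ^ 2 * ((N : ℝ) ^ d * (d * (1 / m))) := by gcongr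
    have h4 : C ^ 2 * ‖g‖ ^ 2 * ((N : ℝ) ^ d * (d * (1 / m)))
        = (N : ℝ) ^ d * (C ^ 2 * d * ‖g‖ ^ 2 / m) := by ring
    linarith
  have := (le_abs_self _).trans hlat'
  calc _ ≤ (N : ℝ) ^ d * η ^ 2 + (N : ℝ) ^ d * (c₁ * 2 ^ k * ‖g‖ ^ 2 / m)
        + (N : ℝ) ^ d * (C ^ 2 * d * ‖g‖ ^ 2 / m) := by linarith
    _ = _ := by ring

end Bounds

/-! ### Random weights -/

/-- Hoeffding's inequality for weighted sums of centred bounded independent variables. -/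
theorem measureReal_sum_ge_le {ι Ω : Type*} [MeasurableSpace Ω] {P : Measure Ω}
    [IsProbabilityMeasure P] {θ : ι → Ω → ℝ} (hm : ∀ n, Measurable (θ n)) (hi : iIndepFun θ P)
    {M : ℝ} (hM : ∀ n, ∀ᵐ ω ∂P, |θ n ω| ≤ M) (s : Finset ι) {a : ι → ℝ} {b : ℝ} (hb : 0 ≤ b)
    (ha : ∀ n, |a n| ≤ b) {r : ℝ} (hr : 0 ≤ r) :
    P.real {ω | r ≤ ∑ n ∈ s, a n * (θ n ω - ∫ ω', θ n ω' ∂P)}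
      ≤ Real.exp (-r ^ 2 / (2 * (b * M) ^ 2 * s.card)) := by
  have hind : iIndepFun (fun n ω => a n * θ n ω - ∫ ω', a n * θ n ω' ∂P) P :=
    hi.comp (fun n t => a n * t - ∫ ω', a n * θ n ω' ∂P) fun n => by fun_prop
  have hsub : ∀ n ∈ s, HasSubgaussianMGF (fun ω => a n * θ n ω - ∫ ω', a n * θ n ω' ∂P)
      ((‖b * M - -(b * M)‖₊ / 2) ^ 2) P := fun n _ => by
    refine hasSubgaussianMGF_of_mem_Icc ((hm n).const_mul _).aemeasurable ?_
    filter_upwards [hM n] with ω hω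
    rw [Set.mem_Icc, ← abs_le, abs_mul]
    exact mul_le_mul (ha n) hω (abs_nonneg _) hb
  have h := HasSubgaussianMGF.measure_sum_ge_le_of_iIndepFun hind hsub hr
  have e : 2 * ((∑ _i ∈ s, (‖b * M - -(b * M)‖₊ / 2) ^ 2 : NNReal) : ℝ)
      = 2 * (b * M) ^ 2 * s.card := by
    push_cast
    rw [Finset.sum_const, nsmul_eq_mul, Real.norm_eq_abs, div_pow, sq_abs]
    ring
  rw [e] at h
  simpa only [integral_const_mul, ← mul_sub] using h

/-- Hoeffding's inequality for complex coefficients: if the norm of the sum is at least `r`, then its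
real or its imaginary part is at least `r / 2` or at most `-r / 2`, whence the factor `4`. -/
theorem measureReal_norm_sum_ge_le {ι Ω : Type*} [MeasurableSpace Ω] {P : Measure Ω}
    [IsProbabilityMeasure P] {θ : ι → Ω → ℝ} (hm : ∀ n, Measurable (θ n)) (hi : iIndepFun θ P)
    {M : ℝ} (hM : ∀ n, ∀ᵐ ω ∂P, |θ n ω| ≤ M) (s : Finset ι) {z : ι → ℂ} {b : ℝ} (hb : 0 ≤ b)
    (hz : ∀ n, ‖z n‖ ≤ b) {r : ℝ} (hr : 0 ≤ r) :
    P.real {ω | r ≤ ‖∑ n ∈ s, ((θ n ω - ∫ ω', θ n ω' ∂P : ℝ) : ℂ) * z n‖}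
      ≤ 4 * Real.exp (-r ^ 2 / (8 * (b * M) ^ 2 * s.card)) := by
  set S : Ω → ℂ := fun ω => ∑ n ∈ s, ((θ n ω - ∫ ω', θ n ω' ∂P : ℝ) : ℂ) * z n with hS
  have key : ∀ a : ι → ℝ, (∀ n, |a n| ≤ b) →
      P.real {ω | r / 2 ≤ ∑ n ∈ s, a n * (θ n ω - ∫ ω', θ n ω' ∂P)}
        ≤ Real.exp (-r ^ 2 / (8 * (b * M) ^ 2 * s.card)) := fun a ha => by
    refine (measureReal_sum_ge_le hm hi hM s hb ha (r := r / 2) (by positivity)).trans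
      (le_of_eq ?_)
    congr 1
    rw [div_pow, ← neg_div, div_div]
    congr 1
    ring
  have hre : ∀ ω, (S ω).re = ∑ n ∈ s, (z n).re * (θ n ω - ∫ ω', θ n ω' ∂P) := fun ω => by
    simp only [hS, Complex.re_sum, Complex.re_ofReal_mul]
    exact Finset.sum_congr rfl fun n _ => mul_comm _ _
  have him : ∀ ω, (S ω).im = ∑ n ∈ s, (z n).im * (θ n ω - ∫ ω', θ n ω' ∂P) := fun ω => by
    simp only [hS, Complex.im_sum, Complex.im_ofReal_mul]
    exact Finset.sum_congr rfl fun n _ => mul_comm _ _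
  have k1 := key (fun n => (z n).re) fun n => (Complex.abs_re_le_norm _).trans (hz n)
  have k2 := key (fun n => -(z n).re) fun n => by
    rw [abs_neg]; exact (Complex.abs_re_le_norm _).trans (hz n)
  have k3 := key (fun n => (z n).im) fun n => (Complex.abs_im_le_norm _).trans (hz n)
  have k4 := key (fun n => -(z n).im) fun n => by
    rw [abs_neg]; exact (Complex.abs_im_le_norm _).trans (hz n)
  simp only [neg_mul, Finset.sum_neg_distrib, ← hre, ← him] at k1 k2 k3 k4
  have hsub : {ω | r ≤ ‖S ω‖} ⊆ (({ω | r / 2 ≤ (S ω).re} ∪ {ω | r / 2 ≤ -(S ω).re})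
      ∪ {ω | r / 2 ≤ (S ω).im}) ∪ {ω | r / 2 ≤ -(S ω).im} := by
    intro ω hω
    have h1 : r ≤ ‖S ω‖ := hω
    have h2 := Complex.norm_le_abs_re_add_abs_im (S ω)
    by_cases h3 : r / 2 ≤ |(S ω).re|
    · rcases le_abs.1 h3 with h | h
      · exact Or.inl (Or.inl (Or.inl h))
      · exact Or.inl (Or.inl (Or.inr h))
    · have h4 : r / 2 ≤ |(S ω).im| := by linarith
      rcases le_abs.1 h4 with h | h
      · exact Or.inl (Or.inr h)
      · exact Or.inr h
  refine (measureReal_mono hsub).trans ?_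
  refine (measureReal_union_le _ _).trans ?_
  have h1 := measureReal_union_le (μ := P)
    ({ω | r / 2 ≤ (S ω).re} ∪ {ω | r / 2 ≤ -(S ω).re}) {ω | r / 2 ≤ (S ω).im}
  have h2 := measureReal_union_le (μ := P) {ω | r / 2 ≤ (S ω).re} {ω | r / 2 ≤ -(S ω).re}
  linarith

/-- Two complex numbers in the same cell of the grid of width `1 / m` are at distance at most
`2 / m`. -/
theorem norm_sub_le_of_floor_eq {z w : ℂ} {m : ℝ} (hm : 0 < m) (h1 : ⌊z.re * m⌋ = ⌊w.re * m⌋)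
    (h2 : ⌊z.im * m⌋ = ⌊w.im * m⌋) : ‖z - w‖ ≤ 2 / m := by
  have key : ∀ a b : ℝ, ⌊a * m⌋ = ⌊b * m⌋ → |a - b| ≤ 1 / m := fun a b h => by
    have := (Int.abs_sub_lt_one_of_floor_eq_floor h).le
    rw [← sub_mul, abs_mul, abs_of_pos hm] at this
    rwa [le_div_iff₀ hm]
  refine (Complex.norm_le_abs_re_add_abs_im _).trans ?_
  have e1 := key _ _ h1
  have e2 := key _ _ h2
  rw [Complex.sub_re, Complex.sub_im]
  calc _ ≤ 1 / m + 1 / m := add_le_add e1 e2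
    _ = 2 / m := by ring

theorem floor_mem_Icc {a c : ℝ} {m : ℕ} (ha : |a| ≤ c) :
    ⌊a * m⌋ ∈ Finset.Icc (-((⌈c⌉₊ * m : ℕ) : ℤ)) ((⌈c⌉₊ * m : ℕ) : ℤ) := by
  have h := abs_le.1 (ha.trans (Nat.le_ceil c))
  have hm : (0 : ℝ) ≤ m := Nat.cast_nonneg m
  rw [Finset.mem_Icc]
  constructor
  · rw [Int.le_floor]
    push_cast
    nlinarith
  · refine Int.floor_le_iff.2 ?_
    push_cast
    nlinarith

section Bounds

variable {d : ℕ} {X 𝓑 : Type*} [MetricSpace X] [MeasurableSpace X] [NormedAddCommGroup 𝓑]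
  [NormedSpace ℂ 𝓑]
variable {φ : Flow (Fin d → ℝ) X} {μ : Measure X} {B : FunctionAlgebra X 𝓑} {x : X}
  {C ρ : ℝ} {K : ℕ} {κ : ℝ}

/-- Finitely many elements of the unit ball suffice to approximate the unit ball at finitely many
points of the orbit; their number is exponential in the number of points. -/
theorem FlowBounds.exists_cover (hB : FlowBounds φ μ B x C ρ K κ) {ι : Type} [Fintype ι]
    (p : ι → X) {m : ℕ} (hm : 1 ≤ m) :
    ∃ (I : Finset (ι → ℤ × ℤ)) (rep : (ι → ℤ × ℤ) → 𝓑),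
      I.card = ((2 * (⌈C⌉₊ * m) + 1) ^ 2) ^ Fintype.card ι ∧ (∀ c, ‖rep c‖ ≤ 1) ∧
      ∀ f : 𝓑, ‖f‖ ≤ 1 → ∃ c ∈ I, ∀ i, ‖B.ev (f - rep c) (p i)‖ ≤ 2 / m := by
  classical
  set code : 𝓑 → ι → ℤ × ℤ := fun f i => (⌊(B.ev f (p i)).re * m⌋, ⌊(B.ev f (p i)).im * m⌋)
  set J := Finset.Icc (-((⌈C⌉₊ * m : ℕ) : ℤ)) ((⌈C⌉₊ * m : ℕ) : ℤ) with hJ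
  have hJc : J.card = 2 * (⌈C⌉₊ * m) + 1 := by
    rw [hJ, Int.card_Icc]
    omega
  refine ⟨Fintype.piFinset fun _ => J ×ˢ J,
    fun c => if h : ∃ f : 𝓑, ‖f‖ ≤ 1 ∧ code f = c then h.choose else 0, ?_, fun c => ?_,
    fun f hf => ?_⟩
  · simp only [Fintype.card_piFinset, Finset.card_product, hJc, Finset.prod_const, Finset.card_univ]
    ring
  · dsimp only
    split_ifs with h
    · exact h.choose_spec.1
    · simp
  · have hb : ∀ i, ‖B.ev f (p i)‖ ≤ C := fun i =>
      (hB.bound f _).trans (mul_le_of_le_one_right hB.nonneg hf)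
    refine ⟨code f, ?_, fun i => ?_⟩
    · rw [Fintype.mem_piFinset]
      intro i
      exact Finset.mk_mem_product (floor_mem_Icc ((Complex.abs_re_le_norm _).trans (hb i)))
        (floor_mem_Icc ((Complex.abs_im_le_norm _).trans (hb i)))
    · have h : ∃ g : 𝓑, ‖g‖ ≤ 1 ∧ code g = code f := ⟨f, hf, rfl⟩
      dsimp only
      rw [dif_pos h, map_sub, Pi.sub_apply]
      have h2 := congrFun h.choose_spec.2 i
      refine norm_sub_le_of_floor_eq (by exact_mod_cast hm) ?_ ?_
      · exact (congrArg Prod.fst h2).symm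
      · exact (congrArg Prod.snd h2).symm

theorem summable_exp_neg_mul_sqrt {c : ℝ} (hc : 0 < c) :
    Summable fun N : ℕ => Real.exp (-(c * (N : ℝ) ^ (1 / 2 : ℝ))) := by
  have h1 : (fun t : ℝ => Real.exp (-c * t)) =o[atTop] fun t : ℝ => t ^ (-4 : ℝ) :=
    isLittleO_exp_neg_mul_rpow_atTop hc _
  have h2 : Tendsto (fun N : ℕ => (N : ℝ) ^ (1 / 2 : ℝ)) atTop atTop :=
    (tendsto_rpow_atTop (by norm_num)).comp tendsto_natCast_atTop_atTop
  have h3 := (h1.comp_tendsto h2).isBigO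
  refine summable_of_isBigO_nat (g := fun N : ℕ => (N : ℝ) ^ (-2 : ℝ))
    (Real.summable_nat_rpow.2 (by norm_num)) ?_
  refine (h3.congr (fun N => ?_) fun N => ?_)
  · simp only [Function.comp]; rw [neg_mul]
  · simp only [Function.comp]
    rw [← Real.rpow_mul (Nat.cast_nonneg N)]
    norm_num

/-- Centred random sums are small simultaneously for the whole algebra: by
`FlowBounds.exists_sum_sq_le_of_lattice` the values at sparse lattice points determine an element up
to a small quadratic mean error, so the number of elements to be controlled is at most exponential
in the number of those points, which Hoeffding's inequality beats. -/
theorem FlowBounds.exists_random_sum_le [BorelSpace X] [IsFiniteMeasure μ]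
    (hμ : ∀ t : Fin d → ℝ, MeasurePreserving (φ t) μ μ) (hB : FlowBounds φ μ B x C ρ K κ)
    (hd : d ≠ 0) :
    ∃ s : ℝ, 0 < s ∧ ∀ (Ω : Type w) [MeasurableSpace Ω] (P : Measure Ω) [IsProbabilityMeasure P]
      (θ : (Fin d → ℕ) → Ω → ℝ), IsBoundedIID P θ → ∃ C₁ : ℝ, 0 ≤ C₁ ∧
      ∀ᵐ ω ∂P, ∀ᶠ N : ℕ in atTop, ∀ f : 𝓑,
        ‖∑ n ∈ Finset.Icc (fun _ : Fin d => 1) (fun _ => N),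
          ((θ n ω - ∫ ω', θ n ω' ∂P : ℝ) : ℂ) * B.ev f (φ (fun l => (n l : ℝ)) x)‖
            ≤ C₁ * ‖f‖ * ((N : ℝ) ^ d * (N : ℝ) ^ (-s)) := by
  obtain ⟨A, hA2, C', hC', hdet⟩ := hB.exists_sum_sq_le_of_lattice hμ
  have hA : A ≠ 0 := by omega
  have hC := hB.nonneg
  have hC1 := hB.one_le
  have hA0 : (0 : ℝ) < A := by exact_mod_cast (by omega : 0 < A)
  refine ⟨1 / 4 / A, by positivity, fun Ω _ P _ θ hθ => ?_⟩
  obtain ⟨M₀, hM₀⟩ := hθ.bounded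
  set M := |M₀| + 1 with hM
  have hM0 : 0 < M := by positivity
  have hMb : ∀ n, ∀ᵐ ω ∂P, |θ n ω| ≤ M := fun n => by
    filter_upwards [hM₀ n] with ω hω
    linarith [le_abs_self M₀]
  have hroot : ∀ N : ℕ, ∃ m : ℕ, 1 ≤ m ∧ (1 ≤ N → m ^ A ≤ N) ∧ (N : ℝ) ≤ (2 * m) ^ A := by
    intro N
    rcases Nat.eq_zero_or_pos N with rfl | hN
    · exact ⟨1, le_rfl, fun h => absurd h (by norm_num), by simp⟩
    · obtain ⟨m, h1, h2, h3⟩ := exists_nat_root hA hN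
      exact ⟨m, h1, fun _ => h2, h3⟩
  choose m hm1 hmA hmN using hroot
  have hmtop : Tendsto (fun N => (m N : ℝ)) atTop atTop := by
    refine tendsto_atTop.2 fun b => ?_
    filter_upwards [eventually_ge_atTop (⌈(2 * |b|) ^ A⌉₊ + 1)] with N hN
    by_contra hcon
    push Not at hcon
    have h1 : (2 * (m N : ℝ)) ^ A ≤ (2 * |b|) ^ A := by
      gcongr; exact hcon.le.trans (le_abs_self b)
    have h2 : (⌈(2 * |b|) ^ A⌉₊ : ℝ) + 1 ≤ N := by exact_mod_cast hN
    linarith [hmN N, Nat.le_ceil ((2 * |b|) ^ A)]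
  have hmpos : ∀ N, (0 : ℝ) < m N := fun N => by exact_mod_cast hm1 N
  choose I rep hIc hrep hcov using fun N =>
    hB.exists_cover (ι := Fin d → Fin (N / m N)) (fun n => φ (fun l => (m N : ℝ) * (n l : ℕ)) x)
      (hm1 N)
  set F : 𝓑 → (Fin d → ℕ) → ℂ := fun f n => B.ev f (φ (fun l => (n l : ℝ)) x) with hF
  set Z : ℕ → 𝓑 → Ω → ℂ := fun N f ω => ∑ n ∈ Finset.Icc (fun _ : Fin d => 1) (fun _ => N),
    ((θ n ω - ∫ ω', θ n ω' ∂P : ℝ) : ℂ) * F f n with hZ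
  -- the threshold `lam`: the exponent `lam ^ 2 / N ^ d` of Hoeffding's inequality is of order
  -- `N ^ d m ^ (-1/2)`, while the logarithm of the number of elements is of order `N ^ d log m / m`
  set lam : ℕ → ℝ := fun N => (N : ℝ) ^ d * (m N : ℝ) ^ (-(1 / 4) : ℝ) with hlam
  have hlam0 : ∀ N, 0 ≤ lam N := fun N => by
    have := (hmpos N).le
    positivity
  have hcardI : ∀ N : ℕ, (Finset.Icc (fun _ : Fin d => 1) (fun _ => N)).card = N ^ d := fun N => by
    rw [Pi.card_Icc]; simp
  set Bad : ℕ → Set Ω := fun N => ⋃ c ∈ I N, {ω | lam N ≤ ‖Z N (rep N c) ω‖} with hBad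
  set c := 1 / (8 * (C * M) ^ 2) with hc
  have hc0 : 0 < c := by positivity
  have hBadm : ∀ N, 1 ≤ N → P.real (Bad N)
      ≤ 4 * Real.exp ((N : ℝ) ^ d * (2 * Real.log ((2 * ⌈C⌉₊ + 1 : ℕ) * m N) / m N
          - c * (m N : ℝ) ^ (-(1 / 2) : ℝ))) := by
    intro N hN
    have hN0 : (0 : ℝ) < N := by exact_mod_cast hN
    have h1 : P.real (Bad N) ≤ ∑ _c ∈ I N, 4 * Real.exp (-lam N ^ 2 / (8 * (C * M) ^ 2
        * (Finset.Icc (fun _ : Fin d => 1) (fun _ => N)).card)) := by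
      refine (measureReal_biUnion_finset_le _ _).trans (Finset.sum_le_sum fun c _ => ?_)
      exact measureReal_norm_sum_ge_le hθ.measurable hθ.indep hMb _ hC
        (fun n => (hB.bound _ _).trans (mul_le_of_le_one_right hC (hrep N c))) (hlam0 N)
    refine h1.trans ?_
    rw [Finset.sum_const, nsmul_eq_mul, hIc, hcardI]
    have e1 : -lam N ^ 2 / (8 * (C * M) ^ 2 * ((N ^ d : ℕ) : ℝ))
        = -((N : ℝ) ^ d * (c * (m N : ℝ) ^ (-(1 / 2) : ℝ))) := by
      have : ((m N : ℝ) ^ (-(1 / 4) : ℝ)) ^ 2 = (m N : ℝ) ^ (-(1 / 2) : ℝ) := by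
        rw [← Real.rpow_natCast, ← Real.rpow_mul (hmpos N).le]; norm_num
      rw [hlam, mul_pow, this, hc]
      push_cast
      field_simp
    have e2 : ((((2 * (⌈C⌉₊ * m N) + 1) ^ 2) ^ Fintype.card (Fin d → Fin (N / m N)) : ℕ) : ℝ)
        ≤ Real.exp ((N : ℝ) ^ d * (2 * Real.log ((2 * ⌈C⌉₊ + 1 : ℕ) * m N) / m N)) := by
      set D : ℝ := ((2 * ⌈C⌉₊ + 1 : ℕ) : ℝ) * m N with hD
      have hm1R : (1 : ℝ) ≤ m N := by exact_mod_cast hm1 N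
      have hD1 : 1 ≤ D := by
        have : (1 : ℝ) ≤ ((2 * ⌈C⌉₊ + 1 : ℕ) : ℝ) := by exact_mod_cast Nat.le_add_left _ _
        nlinarith
      have hDb : (((2 * (⌈C⌉₊ * m N) + 1) : ℕ) : ℝ) ≤ D := by
        rw [hD]; push_cast; nlinarith
      rw [Fintype.card_fun, Fintype.card_fin, Fintype.card_fin]
      push_cast at hDb ⊢
      rw [← pow_mul]
      calc _ ≤ D ^ (2 * (N / m N) ^ d) := by gcongr
        _ = Real.exp (Real.log D * ((2 * (N / m N) ^ d : ℕ) : ℝ)) := by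
            rw [← Real.rpow_natCast, Real.rpow_def_of_pos (by linarith)]
        _ ≤ _ := by
            refine Real.exp_le_exp.2 ?_
            have hl := Real.log_nonneg hD1
            have h3 : ((N / m N : ℕ) : ℝ) ^ d ≤ (N : ℝ) ^ d / m N := by
              calc ((N / m N : ℕ) : ℝ) ^ d ≤ ((N : ℝ) / m N) ^ d := by
                    gcongr; exact Nat.cast_div_le
                _ = (N : ℝ) ^ d / (m N : ℝ) ^ d := div_pow _ _ _
                _ ≤ (N : ℝ) ^ d / m N := by
                    gcongr
                    exact le_self_pow₀ hm1R hd
            push_cast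
            calc Real.log D * (2 * ((N / m N : ℕ) : ℝ) ^ d)
                ≤ Real.log D * (2 * ((N : ℝ) ^ d / m N)) := by gcongr
              _ = _ := by ring
    rw [e1]
    calc _ ≤ Real.exp ((N : ℝ) ^ d * (2 * Real.log ((2 * ⌈C⌉₊ + 1 : ℕ) * m N) / m N)) *
          (4 * Real.exp (-((N : ℝ) ^ d * (c * (m N : ℝ) ^ (-(1 / 2) : ℝ))))) := by gcongr
      _ = _ := by
          rw [mul_left_comm, ← Real.exp_add]; congr 2; ring
  have hBadsum : Summable fun N => P.real (Bad N) := by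
    refine Summable.of_norm_bounded_eventually_nat
      ((summable_exp_neg_mul_sqrt (c := c / 2) (by positivity)).mul_left 4) ?_
    set D : ℝ := ((2 * ⌈C⌉₊ + 1 : ℕ) : ℝ) with hD
    have hDpos : 0 < D := by rw [hD]; exact_mod_cast Nat.succ_pos _
    have hev : ∀ᶠ N in atTop, 16 * D ^ (1 / 4 : ℝ) / c ≤ (m N : ℝ) ^ (1 / 4 : ℝ) :=
      ((tendsto_rpow_atTop (by norm_num : (0 : ℝ) < 1 / 4)).comp hmtop).eventually_ge_atTop _
    filter_upwards [hev, eventually_ge_atTop 1] with N hN hN1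
    rw [Real.norm_of_nonneg measureReal_nonneg]
    refine (hBadm N hN1).trans ?_
    have hN0 : (0 : ℝ) < N := by exact_mod_cast hN1
    have hN1R : (1 : ℝ) ≤ N := by exact_mod_cast hN1
    have hlog : Real.log (D * m N) ≤ 4 * (D ^ (1 / 4 : ℝ) * (m N : ℝ) ^ (1 / 4 : ℝ)) := by
      have := Real.log_le_rpow_div (x := D * m N) (ε := 1 / 4) (mul_nonneg hDpos.le (hmpos N).le)
        (by norm_num)
      rw [Real.mul_rpow hDpos.le (hmpos N).le] at this
      linarith
    have h1 : 2 * Real.log (D * m N) / m N ≤ c / 2 * (m N : ℝ) ^ (-(1 / 2) : ℝ) := by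
      rw [div_le_iff₀ (hmpos N)]
      have e1 : (m N : ℝ) ^ (-(1 / 2) : ℝ) * m N = (m N : ℝ) ^ (1 / 4 : ℝ) * (m N : ℝ) ^ (1 / 4 : ℝ) := by
        rw [← Real.rpow_add_one (hmpos N).ne', ← Real.rpow_add (hmpos N)]; norm_num
      rw [mul_assoc, e1]
      have h2 : 16 * D ^ (1 / 4 : ℝ) ≤ (m N : ℝ) ^ (1 / 4 : ℝ) * c := (div_le_iff₀ hc0).1 hN
      have h3 : 0 ≤ (m N : ℝ) ^ (1 / 4 : ℝ) := Real.rpow_nonneg (hmpos N).le _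
      nlinarith
    have h2 : (N : ℝ) ^ (-(1 / 2) : ℝ) ≤ (m N : ℝ) ^ (-(1 / 2) : ℝ) := by
      refine Real.rpow_le_rpow_of_nonpos (hmpos N) ?_ (by norm_num)
      exact_mod_cast (Nat.le_self_pow hA _).trans (hmA N hN1)
    have h3 : (N : ℝ) ^ (1 / 2 : ℝ) ≤ (N : ℝ) ^ d * (m N : ℝ) ^ (-(1 / 2) : ℝ) := by
      calc (N : ℝ) ^ (1 / 2 : ℝ) = N * (N : ℝ) ^ (-(1 / 2) : ℝ) := by
            rw [mul_comm, ← Real.rpow_add_one hN0.ne']; norm_num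
        _ ≤ _ := by
            gcongr
            exact le_self_pow₀ hN1R hd
    have h4 : 0 ≤ (N : ℝ) ^ d := by positivity
    gcongr
    nlinarith
  -- Borel–Cantelli
  have hBC : ∀ᵐ ω ∂P, ∀ᶠ N in atTop, ω ∉ Bad N := by
    refine ae_eventually_notMem ?_
    have e : ∀ N, P (Bad N) = ENNReal.ofReal (P.real (Bad N)) := fun N =>
      (ofReal_measureReal (h := measure_ne_top _ _)).symm
    simp only [e]
    exact hBadsum.tsum_ofReal_ne_top
  have hall : ∀ᵐ ω ∂P, ∀ n, |θ n ω| ≤ M := ae_all_iff.2 hMb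
  have hE : ∀ n, |∫ ω', θ n ω' ∂P| ≤ M := fun n => by
    have := norm_integral_le_of_norm_le_const (μ := P) (f := θ n) (C := M) (by
      simpa only [Real.norm_eq_abs] using hMb n)
    simpa using this
  set R := 2 * M * Real.sqrt (4 + 4 * C') with hR
  refine ⟨(1 + R) * 2 ^ (1 / 4 : ℝ), by positivity, ?_⟩
  filter_upwards [hBC, hall] with ω hω1 hω2
  filter_upwards [hω1, eventually_ge_atTop 1] with N hN hN1
  have hN0 : (0 : ℝ) < N := by exact_mod_cast hN1
  -- the bound on the unit ball
  have hball : ∀ f : 𝓑, ‖f‖ ≤ 1 →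
      ‖Z N f ω‖ ≤ (1 + R) * ((N : ℝ) ^ d * (m N : ℝ) ^ (-(1 / 4) : ℝ)) := by
    intro f hf
    -- `f` is compared with the chosen element with nearly the same values on `m ℤ^d`
    obtain ⟨c, hcI, hc2⟩ := hcov N f hf
    have hgood : ‖Z N (rep N c) ω‖ ≤ lam N := by
      by_contra hcon
      push Not at hcon
      exact hN (Set.mem_biUnion hcI hcon.le)
    set g := f - rep N c with hg
    have hgn : ‖g‖ ≤ 2 := (norm_sub_le _ _).trans (by linarith [hrep N c])
    have hsq := hdet g N (m N) (hm1 N) (hmA N hN1) (2 / m N) hc2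
    have hm1R : (1 : ℝ) ≤ m N := by exact_mod_cast hm1 N
    have hsq2 : ∑ n : Fin d → Fin N, ‖B.ev g (φ (fun l => ((n l : ℕ) : ℝ) + 1) x)‖ ^ 2
        ≤ (N : ℝ) ^ d * ((4 + 4 * C') / m N) := by
      refine hsq.trans ?_
      gcongr
      have h1 : (2 / (m N : ℝ)) ^ 2 ≤ 4 / m N := by
        rw [div_pow, div_le_div_iff₀ (by positivity) (by positivity)]
        nlinarith
      have h2 : C' * ‖g‖ ^ 2 / m N ≤ 4 * C' / m N := by
        refine div_le_div_of_nonneg_right ?_ (hmpos N).le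
        have : ‖g‖ ^ 2 ≤ 4 := by nlinarith [norm_nonneg g]
        nlinarith
      calc _ ≤ 4 / (m N : ℝ) + 4 * C' / m N := add_le_add h1 h2
        _ = _ := by ring
    have hCS : ∑ n ∈ Finset.Icc (fun _ : Fin d => 1) (fun _ => N), ‖F g n‖
        ≤ (N : ℝ) ^ d * (Real.sqrt (4 + 4 * C') * (m N : ℝ) ^ (-(1 / 4) : ℝ)) := by
      have e : ∑ n ∈ Finset.Icc (fun _ : Fin d => 1) (fun _ => N), ‖F g n‖ ^ 2
          = ∑ n : Fin d → Fin N, ‖B.ev g (φ (fun l => ((n l : ℕ) : ℝ) + 1) x)‖ ^ 2 := by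
        rw [sum_Icc_one_eq]
        simp only [hF]
        push_cast
        rfl
      have h1 := sq_sum_le_card_mul_sum_sq (s := Finset.Icc (fun _ : Fin d => 1) (fun _ => N))
        (f := fun n => ‖F g n‖)
      rw [e, hcardI] at h1
      have h2 : (∑ n ∈ Finset.Icc (fun _ : Fin d => 1) (fun _ => N), ‖F g n‖) ^ 2
          ≤ ((N : ℝ) ^ d * (Real.sqrt (4 + 4 * C') * (m N : ℝ) ^ (-(1 / 4) : ℝ))) ^ 2 := by
        refine h1.trans ?_
        have h3 : (1 : ℝ) / m N ≤ ((m N : ℝ) ^ (-(1 / 4) : ℝ)) ^ 2 := by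
          rw [← Real.rpow_natCast, ← Real.rpow_mul (hmpos N).le, one_div, ← Real.rpow_neg_one]
          exact Real.rpow_le_rpow_of_exponent_le hm1R (by norm_num)
        calc ((N ^ d : ℕ) : ℝ) * _ ≤ (N : ℝ) ^ d * ((N : ℝ) ^ d * ((4 + 4 * C') / m N)) := by
              push_cast; gcongr
          _ = ((N : ℝ) ^ d) ^ 2 * ((4 + 4 * C') * (1 / m N)) := by ring
          _ ≤ ((N : ℝ) ^ d) ^ 2 * ((4 + 4 * C') * ((m N : ℝ) ^ (-(1 / 4) : ℝ)) ^ 2) := by gcongr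
          _ = _ := by
              rw [mul_pow, mul_pow, Real.sq_sqrt (by positivity)]
      exact le_of_sq_le_sq h2 (by positivity)
    have hZg : ‖Z N g ω‖ ≤ 2 * M * ∑ n ∈ Finset.Icc (fun _ : Fin d => 1) (fun _ => N), ‖F g n‖ := by
      rw [Finset.mul_sum]
      refine norm_sum_le_of_le _ fun n _ => ?_
      rw [norm_mul, Complex.norm_real, Real.norm_eq_abs]
      refine mul_le_mul_of_nonneg_right ?_ (norm_nonneg _)
      exact (abs_sub _ _).trans (by linarith [hω2 n, hE n])
    have hsplit : Z N f ω = Z N (rep N c) ω + Z N g ω := by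
      simp only [hZ, hF, hg]
      rw [← Finset.sum_add_distrib]
      refine Finset.sum_congr rfl fun n _ => ?_
      rw [map_sub, Pi.sub_apply]; ring
    rw [hsplit]
    calc _ ≤ lam N + 2 * M * ((N : ℝ) ^ d * (Real.sqrt (4 + 4 * C') * (m N : ℝ) ^ (-(1 / 4) : ℝ))) :=
          (norm_add_le _ _).trans (add_le_add hgood (hZg.trans (by gcongr)))
      _ = _ := by rw [hlam, hR]; ring
  intro f
  have hmN' := rpow_neg_le_of_le_pow hA (hmpos N) hN0 (hmN N) (s := 1 / 4) (by norm_num)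
  have hgen : ‖Z N f ω‖ ≤ ‖f‖ * ((1 + R) * ((N : ℝ) ^ d * (m N : ℝ) ^ (-(1 / 4) : ℝ))) := by
    rcases eq_or_ne f 0 with rfl | hf
    · simp [hZ, hF]
    · have hf0 : 0 < ‖f‖ := norm_pos_iff.2 hf
      have h1 := hball ((‖f‖⁻¹ : ℂ) • f) (by
        rw [norm_smul, norm_inv, Complex.norm_real, norm_norm, inv_mul_cancel₀ hf0.ne'])
      have h2 : Z N ((‖f‖⁻¹ : ℂ) • f) ω = (‖f‖⁻¹ : ℂ) * Z N f ω := by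
        simp only [hZ, hF]
        rw [Finset.mul_sum]
        refine Finset.sum_congr rfl fun n _ => ?_
        rw [map_smul, Pi.smul_apply, smul_eq_mul]; ring
      rw [h2, norm_mul, norm_inv, Complex.norm_real, norm_norm, inv_mul_le_iff₀ hf0] at h1
      exact h1
  calc _ ≤ ‖f‖ * ((1 + R) * ((N : ℝ) ^ d * (m N : ℝ) ^ (-(1 / 4) : ℝ))) := hgen
    _ ≤ ‖f‖ * ((1 + R) * ((N : ℝ) ^ d * (2 ^ (1 / 4 : ℝ) * (N : ℝ) ^ (-(1 / 4 / A) : ℝ)))) := by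
        gcongr
    _ = _ := by ring

/-- The rate of decay with random weights. -/
theorem FlowBounds.polyRatesRandomWeights [BorelSpace X] [IsFiniteMeasure μ]
    (hμ : ∀ t : Fin d → ℝ, MeasurePreserving (φ t) μ μ) (hB : FlowBounds φ μ B x C ρ K κ)
    (hd : d ≠ 0) : PolyRatesRandomWeights.{w} φ μ B x := by
  obtain ⟨s, hs, hrand⟩ := hB.exists_random_sum_le.{w} hμ hd
  obtain ⟨C₂, hC₂, hmean⟩ := hB.exists_norm_sum_cube_le hμ
  have hC := hB.nonneg
  have hρ := hB.rho_pos
  have hκ := hB.kappa_pos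
  set k := ρ * κ / (2 * (d + 1)) with hk
  have hk0 : 0 < k := by positivity
  set δ := min s k with hδ
  have hδ0 : 0 < δ := lt_min hs hk0
  refine ⟨δ, hδ0, fun Ω _ P _ θ hθ => ?_⟩
  obtain ⟨C₁, hC₁, hae⟩ := hrand Ω P θ hθ
  obtain ⟨M₀, hM₀⟩ := hθ.bounded
  have hall : ∀ᵐ ω ∂P, ∀ n, |θ n ω| ≤ M₀ := ae_all_iff.2 hM₀
  set e := ∫ ω', θ 0 ω' ∂P with he
  have hee : ∀ n, ∫ ω', θ n ω' ∂P = e := fun n => (hθ.ident n 0).integral_eq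
  filter_upwards [hae, hall] with ω h1 h2
  obtain ⟨N₀, hN₀⟩ := eventually_atTop.1 h1
  have hM0 : 0 ≤ M₀ := (abs_nonneg _).trans (h2 0)
  have hδp : ∀ N : ℕ, 1 ≤ N → ∀ a : ℝ, δ ≤ a → (N : ℝ) ^ (-a) ≤ (N : ℝ) ^ (-δ) := fun N hN a ha =>
    Real.rpow_le_rpow_of_exponent_le (by exact_mod_cast hN) (by linarith)
  refine ⟨C₁ + |e| * C₂ + M₀ * C * (N₀ : ℝ) ^ δ, fun f hf N hN => ?_⟩
  have hN0 : (0 : ℝ) < N := by exact_mod_cast hN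
  have hNδ : 0 < (N : ℝ) ^ (-δ) := Real.rpow_pos_of_pos hN0 _
  have hpref : ‖weightedAverage φ (fun n => θ n ω) (B.ev f) x N‖ = ((N : ℝ) ^ d)⁻¹ *
      ‖∑ n ∈ Finset.Icc (fun _ : Fin d => 1) (fun _ => N),
        (θ n ω : ℂ) * B.ev f (φ (fun l => (n l : ℝ)) x)‖ := by
    rw [weightedAverage, norm_mul, one_div, norm_inv, norm_pow, Complex.norm_natCast]
  rw [hpref, inv_mul_le_iff₀ (by positivity)]
  -- the finitely many `N` before the Borel–Cantelli bound sets in are covered by the constant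
  rcases lt_or_ge N N₀ with hlt | hge
  · have hb : ‖∑ n ∈ Finset.Icc (fun _ : Fin d => 1) (fun _ => N),
        (θ n ω : ℂ) * B.ev f (φ (fun l => (n l : ℝ)) x)‖ ≤ (N : ℝ) ^ d * (M₀ * (C * ‖f‖)) := by
      refine (norm_sum_le_of_le (f := fun n => (θ n ω : ℂ) * B.ev f (φ (fun l => (n l : ℝ)) x))
        (n := fun _ => M₀ * (C * ‖f‖)) _ fun n _ => ?_).trans (le_of_eq ?_)
      · rw [norm_mul, Complex.norm_real]
        exact mul_le_mul (h2 n) (hB.bound _ _) (norm_nonneg _) hM0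
      · rw [Finset.sum_const, Pi.card_Icc]; simp
    refine hb.trans (mul_le_mul_of_nonneg_left ?_ (by positivity))
    have h3 : 1 ≤ (N₀ : ℝ) ^ δ * (N : ℝ) ^ (-δ) := by
      rw [Real.rpow_neg hN0.le, ← div_eq_mul_inv, one_le_div (by positivity)]
      exact Real.rpow_le_rpow hN0.le (by exact_mod_cast hlt.le) hδ0.le
    calc M₀ * (C * ‖f‖) ≤ M₀ * (C * ‖f‖) * ((N₀ : ℝ) ^ δ * (N : ℝ) ^ (-δ)) :=
          le_mul_of_one_le_right (by positivity) h3
      _ = M₀ * C * (N₀ : ℝ) ^ δ * ‖f‖ * (N : ℝ) ^ (-δ) := by ring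
      _ ≤ _ := by
          refine mul_le_mul_of_nonneg_right (mul_le_mul_of_nonneg_right ?_ (norm_nonneg _)) hNδ.le
          have : 0 ≤ C₁ + |e| * C₂ := by positivity
          linarith
  · have hr := hN₀ N hge f
    have hm := hmean f hf N hN
    have hsplit : ∑ n ∈ Finset.Icc (fun _ : Fin d => 1) (fun _ => N),
          (θ n ω : ℂ) * B.ev f (φ (fun l => (n l : ℝ)) x)
        = ∑ n ∈ Finset.Icc (fun _ : Fin d => 1) (fun _ => N),
          ((θ n ω - ∫ ω', θ n ω' ∂P : ℝ) : ℂ) * B.ev f (φ (fun l => (n l : ℝ)) x)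
        + (e : ℂ) * ∑ n : Fin d → Fin N, B.ev f (φ (fun l => ((n l : ℕ) : ℝ) + 1) x) := by
      have h3 : ∑ n : Fin d → Fin N, B.ev f (φ (fun l => ((n l : ℕ) : ℝ) + 1) x)
          = ∑ n ∈ Finset.Icc (fun _ : Fin d => 1) (fun _ => N),
            B.ev f (φ (fun l => (n l : ℝ)) x) := by
        rw [sum_Icc_one_eq]; push_cast; rfl
      rw [h3, Finset.mul_sum, ← Finset.sum_add_distrib]
      refine Finset.sum_congr rfl fun n _ => ?_
      rw [hee]; push_cast; ring
    rw [hsplit]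
    calc _ ≤ C₁ * ‖f‖ * ((N : ℝ) ^ d * (N : ℝ) ^ (-s))
          + |e| * (C₂ * ‖f‖ * ((N : ℝ) ^ d * (N : ℝ) ^ (-k))) := by
          refine (norm_add_le _ _).trans (add_le_add hr ?_)
          rw [norm_mul, Complex.norm_real, Real.norm_eq_abs]
          gcongr
      _ ≤ C₁ * ‖f‖ * ((N : ℝ) ^ d * (N : ℝ) ^ (-δ))
          + |e| * (C₂ * ‖f‖ * ((N : ℝ) ^ d * (N : ℝ) ^ (-δ))) := by
          gcongr 1
          · gcongr ?_ * (_ * ?_)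
            exact hδp N hN _ (min_le_left _ _)
          · gcongr ?_ * (_ * (_ * ?_))
            exact hδp N hN _ (min_le_right _ _)
      _ = (N : ℝ) ^ d * ((C₁ + |e| * C₂) * ‖f‖ * (N : ℝ) ^ (-δ)) := by ring
      _ ≤ _ := by
          refine mul_le_mul_of_nonneg_left ?_ (by positivity)
          refine mul_le_mul_of_nonneg_right (mul_le_mul_of_nonneg_right ?_ (norm_nonneg _)) hNδ.le
          have : 0 ≤ M₀ * C * (N₀ : ℝ) ^ δ := by positivity
          linarith

end Bounds

/-! ### Sums over cubes, one coordinate at a time -/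

/-- If replacing the points `x l a` by `y l a` in a single coordinate `l` changes the sums of `Φ`
along that coordinate by little, then replacing them in all coordinates changes the sum over the
cube by little. -/
theorem norm_sum_pi_replace_le {d M : ℕ} {α E : Type*} [Inhabited α] [NormedAddCommGroup E]
    (Φ : (Fin d → α) → E) (x y : Fin d → Fin M → α) {J : ℝ} (hJ : (M : ℝ) ≤ J) {e : Fin d → ℝ}
    (h : ∀ l z, ‖∑ a, (Φ (Function.update z l (x l a)) - Φ (Function.update z l (y l a)))‖
      ≤ J * e l) :
    ‖∑ n : Fin d → Fin M, (Φ (fun l => x l (n l)) - Φ (fun l => y l (n l)))‖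
      ≤ J ^ d * ∑ l, e l := by
  classical
  have hJ0 : 0 ≤ J := (Nat.cast_nonneg M).trans hJ
  have key : ∀ S : Finset (Fin d),
      ‖∑ n : Fin d → Fin M, (Φ (fun l => x l (n l))
        - Φ (fun l => if l ∈ S then y l (n l) else x l (n l)))‖ ≤ J ^ d * ∑ l ∈ S, e l := by
    intro S
    induction S using Finset.induction_on with
    | empty => simp
    | insert l₀ S hl ih =>
      have hstep : ‖∑ n : Fin d → Fin M, (Φ (fun l => if l ∈ S then y l (n l) else x l (n l))
          - Φ (fun l => if l ∈ insert l₀ S then y l (n l) else x l (n l)))‖ ≤ J ^ d * e l₀ := by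
        rw [← (Equiv.funSplitAt l₀ (Fin M)).symm.sum_comp, Fintype.sum_prod_type_right]
        have hrow : ∀ r : {l // l ≠ l₀} → Fin M, ‖∑ a : Fin M,
            (Φ (fun l => if l ∈ S then y l ((Equiv.funSplitAt l₀ (Fin M)).symm (a, r) l)
                else x l ((Equiv.funSplitAt l₀ (Fin M)).symm (a, r) l))
              - Φ (fun l => if l ∈ insert l₀ S
                then y l ((Equiv.funSplitAt l₀ (Fin M)).symm (a, r) l)
                else x l ((Equiv.funSplitAt l₀ (Fin M)).symm (a, r) l)))‖ ≤ J * e l₀ := by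
          intro r
          set z : Fin d → α := fun l => if hl : l = l₀ then default else
            if l ∈ S then y l (r ⟨l, hl⟩) else x l (r ⟨l, hl⟩)
          convert h l₀ z using 6 with a _ l l
          · by_cases hl' : l = l₀
            · subst hl'; simp [hl]
            · simp [z, hl']
          · by_cases hl' : l = l₀
            · subst hl'; simp
            · simp [z, hl']
        refine (norm_sum_le_of_le _ fun r _ => hrow r).trans ?_
        have hc : Fintype.card {l // l ≠ l₀} = d - 1 := by simp
        rw [Finset.sum_const, Finset.card_univ, Fintype.card_fun, hc, Fintype.card_fin, nsmul_eq_mul]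
        have h0 : 0 ≤ J * e l₀ := (norm_nonneg _).trans (h l₀ fun _ => default)
        calc _ ≤ J ^ (d - 1) * (J * e l₀) := by push_cast; gcongr
          _ = _ := by
            rw [← mul_assoc, ← pow_succ, Nat.sub_add_cancel (Nat.one_le_iff_ne_zero.2 fun h0 => by
              subst h0; exact l₀.elim0)]
      rw [Finset.sum_insert hl, mul_add, add_comm]
      refine le_trans (le_of_eq_of_le ?_ (norm_add_le _ _)) (add_le_add ih hstep)
      rw [← Finset.sum_add_distrib]
      simp
  simpa using key Finset.univ

/-- Shifting a cube of side `Q` by `h` along the diagonal. -/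
theorem norm_sum_cube_shift_sub_le {d Q : ℕ} (hQ : 1 ≤ Q) (h : ℕ) {E : Type*}
    [NormedAddCommGroup E] (u : (Fin d → ℕ) → E) {b : ℝ} (hu : ∀ n, ‖u n‖ ≤ b) :
    ‖∑ r : Fin d → Fin Q, (u (fun l => r l + h) - u (fun l => r l))‖
      ≤ (Q : ℝ) ^ d * (d * (2 * h * b / Q)) := by
  have hQ0 : (0 : ℝ) < Q := by exact_mod_cast hQ
  have h1 : ∀ g : ℕ → E, (∀ n, ‖g n‖ ≤ b) → ‖∑ a : Fin Q, (g (a + h) - g a)‖ ≤ 2 * h * b := by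
    intro g hg
    rw [Fin.sum_univ_eq_sum_range (fun a => g (a + h) - g a) Q, Finset.sum_sub_distrib]
    have e1 := Finset.sum_range_add g h Q
    have e2 := Finset.sum_range_add g Q h
    rw [add_comm h Q, e2] at e1
    have e3 : ∑ a ∈ Finset.range Q, g (a + h) - ∑ a ∈ Finset.range Q, g a
        = ∑ a ∈ Finset.range h, g (Q + a) - ∑ a ∈ Finset.range h, g a := by
      rw [sub_eq_sub_iff_add_eq_add]
      simp only [add_comm _ h]
      rw [add_comm, ← e1, add_comm]
    rw [e3]
    have e4 : ∀ k : ℕ → ℕ, ‖∑ a ∈ Finset.range h, g (k a)‖ ≤ h * b := fun k => by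
      refine (norm_sum_le_of_le _ fun a _ => hg (k a)).trans ?_
      simp
    refine (norm_sub_le _ _).trans ?_
    linarith [e4 fun a => Q + a, e4 fun a => a]
  have := norm_sum_pi_replace_le (d := d) u (fun _ (a : Fin Q) => (a : ℕ) + h) (fun _ a => (a : ℕ))
    le_rfl (e := fun _ => 2 * h * b / Q) fun l z => by
      rw [mul_div_cancel₀ _ hQ0.ne']
      exact h1 (fun n => u (Function.update z l n)) fun n => hu _
  simpa using this

/-! ### The sequences `n ^ (1 + ε)` -/

/-- The sequence `n ^ (1 + ε)` is almost an arithmetic progression near `j q`: the slope is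
`(1 + ε) (j q) ^ ε` up to a relative error `2 / j`. -/
theorem rpow_one_add_sub_bounds {ε y h q j : ℝ} (hε : 0 < ε) (hε1 : ε ≤ 1) (hj : 1 ≤ j) (hq : 0 < q)
    (hy : j * q ≤ y) (hh : 0 ≤ h) (hyh : y + h ≤ (j + 2) * q) :
    h * ((1 + ε) * (j * q) ^ ε) ≤ (y + h) ^ (1 + ε) - y ^ (1 + ε) ∧
      (y + h) ^ (1 + ε) - y ^ (1 + ε) ≤ h * ((1 + ε) * (j * q) ^ ε) * (1 + 2 / j) := by
  have hjq : 0 < j * q := by positivity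
  have hy0 : 0 < y := hjq.trans_le hy
  have hyh0 : 0 < y + h := by linarith
  constructor
  · have h1 := one_add_mul_self_le_rpow_one_add (s := h / y) (by
      have : 0 ≤ h / y := by positivity
      linarith) (p := 1 + ε) (by linarith)
    have e : y + h = y * (1 + h / y) := by field_simp
    have hpos : 0 ≤ 1 + h / y := by positivity
    rw [e, Real.mul_rpow hy0.le hpos]
    have h2 : y ^ (1 + ε) * (1 + (1 + ε) * (h / y)) ≤ y ^ (1 + ε) * (1 + h / y) ^ (1 + ε) := by gcongr
    have h3 : y ^ (1 + ε) * (1 + (1 + ε) * (h / y)) = y ^ (1 + ε) + h * ((1 + ε) * y ^ ε) := by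
      rw [Real.rpow_add hy0, Real.rpow_one]; field_simp
    have h4 : (j * q) ^ ε ≤ y ^ ε := Real.rpow_le_rpow hjq.le hy hε.le
    have h5 : h * ((1 + ε) * (j * q) ^ ε) ≤ h * ((1 + ε) * y ^ ε) := by gcongr
    linarith
  · have h1 := one_add_mul_self_le_rpow_one_add (s := -(h / (y + h))) (by
      rw [neg_le_neg_iff, div_le_one hyh0]; linarith) (p := 1 + ε) (by linarith)
    have e : y = (y + h) * (1 + -(h / (y + h))) := by field_simp; ring
    have hpos : 0 ≤ 1 + -(h / (y + h)) := by
      have : h / (y + h) ≤ 1 := (div_le_one hyh0).2 (by linarith)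
      linarith
    have h2 : (y + h) ^ (1 + ε) * (1 + (1 + ε) * -(h / (y + h)))
        ≤ (y + h) ^ (1 + ε) * (1 + -(h / (y + h))) ^ (1 + ε) := by gcongr
    have h3 : (y + h) ^ (1 + ε) * (1 + (1 + ε) * -(h / (y + h)))
        = (y + h) ^ (1 + ε) - h * ((1 + ε) * (y + h) ^ ε) := by
      rw [Real.rpow_add hyh0, Real.rpow_one]; field_simp; ring
    rw [← Real.mul_rpow hyh0.le hpos, ← e, h3] at h2
    have h4 : (y + h) ^ ε ≤ (j * q) ^ ε * (1 + 2 / j) := by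
      calc (y + h) ^ ε ≤ ((j + 2) * q) ^ ε := Real.rpow_le_rpow hyh0.le hyh hε.le
        _ = (j * q * (1 + 2 / j)) ^ ε := by congr 1; field_simp
        _ = (j * q) ^ ε * (1 + 2 / j) ^ ε := Real.mul_rpow hjq.le (by positivity)
        _ ≤ _ := by
          gcongr
          exact (Real.rpow_le_rpow_of_exponent_le (by
            have : 0 ≤ 2 / j := by positivity
            linarith) hε1).trans_eq (Real.rpow_one _)
    have h5 : h * ((1 + ε) * (y + h) ^ ε) ≤ h * ((1 + ε) * ((j * q) ^ ε * (1 + 2 / j))) := by gcongr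
    linarith

/-- Averages over `y ∈ [0, J]` of a bounded function of `a y ^ ε` change little when `a` changes by
at most one: substitute `y ↦ (a / b) ^ (1 / ε) y`. -/
theorem norm_integral_comp_rpow_sub_le {ψ : ℝ → ℂ} (hψ : Continuous ψ) {M : ℝ}
    (hM : ∀ t, ‖ψ t‖ ≤ M) {ε c J a b : ℝ} (hε : 0 < ε) (hε1 : ε ≤ 1) (hJ : 0 ≤ J)
    (ha : 0 ≤ a) (hab : a ≤ b) (hba : b ≤ a + 1) (hb : 0 < b) :
    ‖(∫ y in 0..J, ψ (a * (c * y ^ ε))) - ∫ y in 0..J, ψ (b * (c * y ^ ε))‖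
      ≤ M * (J * (2 / (ε * b))) := by
  have hM0 : 0 ≤ M := (norm_nonneg _).trans (hM 0)
  have hbd : ∀ (a u v : ℝ), u ≤ v → ‖∫ y in u..v, ψ (a * (c * y ^ ε))‖ ≤ M * (v - u) :=
    fun a u v huv => by
      have := intervalIntegral.norm_integral_le_of_norm_le_const (a := u) (b := v) (C := M)
        (f := fun y => ψ (a * (c * y ^ ε))) fun y _ => hM _
      rwa [abs_of_nonneg (by linarith)] at this
  have hcont : ∀ a : ℝ, Continuous fun y : ℝ => ψ (a * (c * y ^ ε)) := fun a => by
    refine hψ.comp ?_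
    exact continuous_const.mul (continuous_const.mul (Real.continuous_rpow_const hε.le))
  rcases ha.eq_or_lt with rfl | ha0
  · refine (norm_sub_le _ _).trans ?_
    have h1 := hbd 0 0 J hJ
    have h2 := hbd b 0 J hJ
    have h3 : 1 ≤ 1 / (ε * b) := by
      rw [le_div_iff₀ (by positivity)]
      nlinarith
    have h4 : M * J * 2 ≤ M * J * (2 * (1 / (ε * b))) := by gcongr; linarith
    have h5 : M * J * (2 * (1 / (ε * b))) = M * (J * (2 / (ε * b))) := by ring
    linarith
  · set r := (a / b) ^ (1 / ε) with hr
    have hq : a / b ≤ 1 := (div_le_one hb).2 hab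
    have hr0 : 0 < r := Real.rpow_pos_of_pos (by positivity) _
    have hr1 : r ≤ 1 := Real.rpow_le_one (by positivity) hq (by positivity)
    have hrε : r ^ ε = a / b := by
      rw [hr, ← Real.rpow_mul (by positivity), one_div_mul_cancel hε.ne', Real.rpow_one]
    have hsub : ∫ y in 0..J, ψ (a * (c * y ^ ε)) = ∫ y in 0..J, ψ (b * (c * (r * y) ^ ε)) := by
      refine intervalIntegral.integral_congr fun y hy => ?_
      rw [Set.uIcc_of_le hJ] at hy
      rw [Real.mul_rpow hr0.le hy.1, hrε]
      congr 1
      field_simp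
    have hscale : ∫ y in 0..J, ψ (b * (c * (r * y) ^ ε))
        = (r⁻¹ : ℝ) • ∫ y in 0..r * J, ψ (b * (c * y ^ ε)) := by
      have := intervalIntegral.integral_comp_mul_left (a := 0) (b := J)
        (fun y => ψ (b * (c * y ^ ε))) hr0.ne'
      simpa using this
    have hint : ∀ u v : ℝ, IntervalIntegrable (fun y => ψ (b * (c * y ^ ε))) volume u v :=
      fun u v => (hcont b).intervalIntegrable u v
    have hsplit := intervalIntegral.integral_add_adjacent_intervals (hint 0 (r * J)) (hint (r * J) J)
    have hrJ : 0 ≤ r * J := by positivity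
    have hrJ' : r * J ≤ J := mul_le_of_le_one_left hJ hr1
    rw [hsub, hscale, ← hsplit]
    set I := ∫ y in 0..r * J, ψ (b * (c * y ^ ε))
    set I' := ∫ y in (r * J)..J, ψ (b * (c * y ^ ε))
    have hI : ‖I‖ ≤ M * (r * J - 0) := hbd b 0 (r * J) hrJ
    have hI' : ‖I'‖ ≤ M * (J - r * J) := hbd b (r * J) J hrJ'
    have hrinv : 0 ≤ r⁻¹ - 1 := sub_nonneg.2 ((one_le_inv₀ hr0).2 hr1)
    have h1 : ‖r⁻¹ • I - (I + I')‖ ≤ (r⁻¹ - 1) * ‖I‖ + ‖I'‖ := by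
      have : r⁻¹ • I - (I + I') = (r⁻¹ - 1) • I - I' := by rw [sub_smul, one_smul]; abel
      rw [this]
      refine (norm_sub_le _ _).trans ?_
      rw [norm_smul, Real.norm_of_nonneg hrinv]
    have h2 : (r⁻¹ - 1) * ‖I‖ ≤ (r⁻¹ - 1) * (M * (r * J - 0)) := by gcongr
    have h3 : (r⁻¹ - 1) * (M * (r * J - 0)) = M * (J - r * J) := by field_simp; ring
    -- Bernoulli's inequality for the exponent `1 / ε ≥ 1`
    have h4 : 1 - r ≤ 1 / (ε * b) := by
      have hB := one_add_mul_self_le_rpow_one_add (s := a / b - 1) (by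
        have : 0 ≤ a / b := by positivity
        linarith) (p := 1 / ε) (by rw [le_div_iff₀ hε]; linarith)
      rw [add_sub_cancel, ← hr] at hB
      have : 1 / ε * (1 - a / b) ≤ 1 / (ε * b) := by
        have e : 1 / ε * (1 - a / b) = 1 / (ε * b) * (b - a) := by field_simp
        rw [e]
        exact mul_le_of_le_one_right (by positivity) (by linarith)
      nlinarith
    have h5 : M * J * (1 - r) ≤ M * J * (1 / (ε * b)) := by gcongr
    have h6 : M * (J * (2 / (ε * b))) = 2 * (M * J * (1 / (ε * b))) := by ring
    rw [h6]
    nlinarith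

/-! ### Correlations at slowly varying times -/

theorem abs_rpow_sub_rpow_le {ε j y : ℝ} (hε : 0 < ε) (hε1 : ε ≤ 1) (hj : 1 ≤ j) (hjy : j ≤ y)
    (hy : y ≤ j + 1) : |j ^ ε - y ^ ε| ≤ j ^ ε / j := by
  have hj0 : 0 < j := by linarith
  have h1 : j ^ ε ≤ y ^ ε := Real.rpow_le_rpow hj0.le hjy hε.le
  have h2 : y ^ ε ≤ j ^ ε * (1 + 1 / j) := by
    calc y ^ ε ≤ (j + 1) ^ ε := Real.rpow_le_rpow (by linarith) hy hε.le
      _ = (j * (1 + 1 / j)) ^ ε := by congr 1; field_simp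
      _ = j ^ ε * (1 + 1 / j) ^ ε := Real.mul_rpow hj0.le (by positivity)
      _ ≤ _ := by
        gcongr
        exact (Real.rpow_le_rpow_of_exponent_le (by
          have : 0 ≤ 1 / j := by positivity
          linarith) hε1).trans_eq (Real.rpow_one _)
  rw [abs_sub_comm, abs_of_nonneg (by linarith)]
  have : j ^ ε * (1 + 1 / j) = j ^ ε + j ^ ε / j := by ring
  linarith

theorem continuous_of_norm_sub_le_rpow {V E : Type*} [SeminormedAddCommGroup V]
    [SeminormedAddCommGroup E] {F : V → E} {b ρ : ℝ} (hρ : 0 < ρ)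
    (h : ∀ s t, ‖F s - F t‖ ≤ b * ‖s - t‖ ^ ρ) : Continuous F := by
  refine continuous_iff_continuousAt.2 fun t => ?_
  rw [ContinuousAt, tendsto_iff_norm_sub_tendsto_zero]
  refine squeeze_zero (fun _ => norm_nonneg _) (fun s => h s t) ?_
  have : Tendsto (fun s : V => b * ‖s - t‖ ^ ρ) (𝓝 t) (𝓝 (b * ‖t - t‖ ^ ρ)) := by
    refine Tendsto.const_mul _ (Tendsto.rpow_const ?_ (Or.inr hρ.le))
    exact ((continuous_id.sub continuous_const).norm).tendsto t
  simpa [Real.zero_rpow hρ.ne'] using this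

/-- A Riemann sum along the slowly varying sequence `j ^ ε`. -/
theorem norm_sum_comp_rpow_sub_integral_le {ψ : ℝ → ℂ} {b ρ : ℝ} (hρ : 0 < ρ)
    (hb : ∀ t, ‖ψ t‖ ≤ b) (hψ : ∀ s t, ‖ψ s - ψ t‖ ≤ b * ‖s - t‖ ^ ρ) {ε c Λ : ℝ} (hε : 0 < ε)
    (hε1 : ε ≤ 1) (hc : 0 ≤ c) {j₀ M : ℕ} (hj₀ : 1 ≤ j₀)
    (hΛ : c * ((j₀ : ℝ) + M) ^ ε ≤ Λ) {a R : ℝ} (ha : 0 ≤ a) (haR : a ≤ R) :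
    ‖(∑ i : Fin M, ψ (a * (c * ((j₀ : ℝ) + (i : ℕ)) ^ ε)))
      - ∫ y in (0 : ℝ)..((j₀ : ℝ) + M), ψ (a * (c * y ^ ε))‖
      ≤ b * (((j₀ : ℝ) + M) * (R * Λ / j₀) ^ ρ + j₀) := by
  have hb0 : 0 ≤ b := (norm_nonneg _).trans (hb 0)
  have hj₀1 : (1 : ℝ) ≤ j₀ := by exact_mod_cast hj₀
  have hj₀0 : (0 : ℝ) < j₀ := by linarith
  have hcont : Continuous fun y : ℝ => ψ (a * (c * y ^ ε)) :=
    (continuous_of_norm_sub_le_rpow hρ hψ).comp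
      (continuous_const.mul (continuous_const.mul (Real.continuous_rpow_const hε.le)))
  have hint : ∀ u v : ℝ, IntervalIntegrable (fun y => ψ (a * (c * y ^ ε))) volume u v :=
    fun u v => hcont.intervalIntegrable u v
  have hΛ0 : 0 ≤ Λ := le_trans (by positivity) hΛ
  have hR : 0 ≤ R := ha.trans haR
  have hsum : ∑ i ∈ Finset.range M, ∫ y in ((j₀ : ℝ) + i)..((j₀ : ℝ) + (i + 1 : ℕ)),
      ψ (a * (c * y ^ ε)) = ∫ y in (j₀ : ℝ)..((j₀ : ℝ) + M), ψ (a * (c * y ^ ε)) := by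
    have := intervalIntegral.sum_integral_adjacent_intervals (n := M)
      (a := fun i : ℕ => (j₀ : ℝ) + i) (f := fun y => ψ (a * (c * y ^ ε))) (μ := volume)
      fun k _ => hint _ _
    simpa using this
  have hterm : ∀ i ∈ Finset.range M, ‖ψ (a * (c * ((j₀ : ℝ) + i) ^ ε))
      - ∫ y in ((j₀ : ℝ) + i)..((j₀ : ℝ) + (i + 1 : ℕ)), ψ (a * (c * y ^ ε))‖
      ≤ b * (R * Λ / j₀) ^ ρ := by
    intro i hi
    have hiM : (i : ℝ) ≤ M := by exact_mod_cast (Finset.mem_range.1 hi).le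
    have hi0 : (0 : ℝ) ≤ i := Nat.cast_nonneg i
    set j := (j₀ : ℝ) + i with hj
    have hj1 : 1 ≤ j := by linarith
    have hend : (j₀ : ℝ) + (i + 1 : ℕ) = j + 1 := by push_cast; ring
    rw [hend]
    have e : ψ (a * (c * j ^ ε)) - ∫ y in j..(j + 1), ψ (a * (c * y ^ ε))
        = ∫ y in j..(j + 1), (ψ (a * (c * j ^ ε)) - ψ (a * (c * y ^ ε))) := by
      rw [intervalIntegral.integral_sub intervalIntegrable_const (hint _ _)]
      simp
    rw [e]
    have := intervalIntegral.norm_integral_le_of_norm_le_const (a := j) (b := j + 1)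
      (C := b * (R * Λ / j₀) ^ ρ)
      (f := fun y => ψ (a * (c * j ^ ε)) - ψ (a * (c * y ^ ε))) fun y hy => by
        rw [Set.uIoc_of_le (by linarith)] at hy
        refine (hψ _ _).trans ?_
        gcongr
        rw [← mul_sub, ← mul_sub, norm_mul, norm_mul, Real.norm_of_nonneg ha,
          Real.norm_of_nonneg hc, Real.norm_eq_abs, mul_div_assoc]
        refine mul_le_mul haR ?_ (by positivity) hR
        calc c * |j ^ ε - y ^ ε| ≤ c * (j ^ ε / j) := by
              gcongr; exact abs_rpow_sub_rpow_le hε hε1 hj1 hy.1.le hy.2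
          _ = c * j ^ ε / j := by ring
          _ ≤ Λ / j₀ := by
              refine div_le_div₀ hΛ0 (le_trans ?_ hΛ) hj₀0 (by linarith)
              gcongr
              linarith
    simpa using this
  rw [← intervalIntegral.integral_add_adjacent_intervals (hint 0 j₀) (hint j₀ (j₀ + M)), ← hsum,
    Fin.sum_univ_eq_sum_range (fun i => ψ (a * (c * ((j₀ : ℝ) + (i : ℕ)) ^ ε))) M, add_comm (∫ _ in _.._, _),
    ← sub_sub, ← Finset.sum_sub_distrib]
  have h1 := norm_sum_le_of_le _ hterm
  have h2 := intervalIntegral.norm_integral_le_of_norm_le_const (a := 0) (b := j₀) (C := b)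
    (f := fun y : ℝ => ψ (a * (c * y ^ ε))) fun y _ => hb _
  rw [Finset.sum_const, Finset.card_range, nsmul_eq_mul] at h1
  rw [sub_zero, Nat.abs_cast] at h2
  refine (norm_sub_le _ _).trans ((add_le_add h1 h2).trans ?_)
  have h3 : (M : ℝ) * (b * (R * Λ / j₀) ^ ρ) ≤ ((j₀ : ℝ) + M) * (b * (R * Λ / j₀) ^ ρ) := by
    gcongr; linarith
  linarith

/-- Replacing `a` by a neighbour `w` in `∑ ψ (a c j ^ ε)` changes little if `a` is large. -/
theorem norm_sum_comp_rpow_sub_sum_le {ψ : ℝ → ℂ} {b ρ : ℝ} (hρ : 0 < ρ)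
    (hb : ∀ t, ‖ψ t‖ ≤ b) (hψ : ∀ s t, ‖ψ s - ψ t‖ ≤ b * ‖s - t‖ ^ ρ) {ε c Λ : ℝ} (hε : 0 < ε)
    (hε1 : ε ≤ 1) (hc : 0 ≤ c) {j₀ M : ℕ} (hj₀ : 1 ≤ j₀)
    (hΛ : c * ((j₀ : ℝ) + M) ^ ε ≤ Λ) {a w R H : ℝ} (hH : 1 ≤ H) (haw : |a - w| ≤ 1) (hHa : H ≤ |a|)
    (haR : |a| ≤ R) (hwR : |w| ≤ R) :
    ‖∑ i : Fin M, (ψ (a * (c * ((j₀ : ℝ) + (i : ℕ)) ^ ε)) - ψ (w * (c * ((j₀ : ℝ) + (i : ℕ)) ^ ε)))‖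
      ≤ b * (((j₀ : ℝ) + M) * (2 / (ε * H) + 2 * (R * Λ / j₀) ^ ρ) + 2 * j₀) := by
  have hb0 : 0 ≤ b := (norm_nonneg _).trans (hb 0)
  wlog ha : 0 ≤ a generalizing ψ a w
  · have := this (ψ := fun t => ψ (-t)) (a := -a) (w := -w) (fun t => hb _) (fun s t => by
        refine (hψ _ _).trans_eq ?_
        rw [← norm_neg (s - t)]
        congr 3; ring)
      (by rw [← abs_neg]; convert haw using 2; ring) (by rwa [abs_neg]) (by rwa [abs_neg])
      (by rwa [abs_neg]) (by linarith)
    simpa only [neg_mul, neg_neg] using this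
  rw [abs_of_nonneg ha] at hHa haR
  have haw' := abs_le.1 haw
  have hw : 0 ≤ w := by linarith
  rw [abs_of_nonneg hw] at hwR
  have r1 := norm_sum_comp_rpow_sub_integral_le hρ hb hψ hε hε1 hc hj₀ hΛ ha haR
  have r2 := norm_sum_comp_rpow_sub_integral_le hρ hb hψ hε hε1 hc hj₀ hΛ hw hwR
  have hJ : (0 : ℝ) ≤ j₀ + M := by positivity
  have r3 : ‖(∫ y in (0 : ℝ)..((j₀ : ℝ) + M), ψ (a * (c * y ^ ε)))
      - ∫ y in (0 : ℝ)..((j₀ : ℝ) + M), ψ (w * (c * y ^ ε))‖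
      ≤ b * (((j₀ : ℝ) + M) * (2 / (ε * H))) := by
    have hψc := continuous_of_norm_sub_le_rpow hρ hψ
    have hmono : ∀ B : ℝ, H ≤ B → b * (((j₀ : ℝ) + M) * (2 / (ε * B)))
        ≤ b * (((j₀ : ℝ) + M) * (2 / (ε * H))) := fun B hB => by gcongr
    -- the change of scale, by a factor `w / a` or `a / w` that is `1 + O(1 / H)`
    rcases le_total a w with h | h
    · exact (norm_integral_comp_rpow_sub_le hψc hb hε hε1 hJ ha h (by linarith)
        (by linarith)).trans (hmono _ (by linarith))
    · rw [norm_sub_rev]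
      exact (norm_integral_comp_rpow_sub_le hψc hb hε hε1 hJ hw h (by linarith)
        (by linarith)).trans (hmono _ hHa)
  rw [Finset.sum_sub_distrib]
  have e : ∀ s1 s2 i1 i2 : ℂ, s1 - s2 = (s1 - i1) + (i1 - i2) - (s2 - i2) := fun _ _ _ _ => by ring
  rw [e _ _ (∫ y in (0 : ℝ)..((j₀ : ℝ) + M), ψ (a * (c * y ^ ε)))
    (∫ y in (0 : ℝ)..((j₀ : ℝ) + M), ψ (w * (c * y ^ ε)))]
  refine (norm_sub_le _ _).trans ((add_le_add (norm_add_le _ _) le_rfl).trans ?_)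
  refine (add_le_add (add_le_add r1 r3) r2).trans (le_of_eq ?_)
  ring

theorem norm_update_sub_update {d : ℕ} (z : Fin d → ℝ) (l : Fin d) (s t : ℝ) :
    ‖Function.update z l s - Function.update z l t‖ ≤ ‖s - t‖ := by
  refine (pi_norm_le_iff_of_nonneg (norm_nonneg _)).2 fun i => ?_
  by_cases h : i = l
  · subst h; simp
  · simp [Function.update_of_ne h]

/-- Correlations at the times `a L_j` and `(a + v) L_j`, where `L_j` varies slowly with `j`, agree on
average over `j`. -/
theorem norm_sum_correlation_sub_le {d : ℕ} {Γ : (Fin d → ℝ) → ℂ} {b ρ : ℝ} (hρ : 0 < ρ)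
    (hb : ∀ t, ‖Γ t‖ ≤ b) (hΓ : ∀ s t, ‖Γ s - Γ t‖ ≤ b * ‖s - t‖ ^ ρ) {ε c : Fin d → ℝ} {Λ e₀ : ℝ}
    (hε : ∀ l, 0 < ε l) (hε1 : ∀ l, ε l ≤ 1) (hεe : ∀ l, e₀ ≤ ε l) (he₀ : 0 < e₀)
    (hc : ∀ l, 0 ≤ c l) {j₀ M : ℕ} (hj₀ : 1 ≤ j₀)
    (hΛ : ∀ l, c l * ((j₀ : ℝ) + M) ^ ε l ≤ Λ) {a R H : ℝ} {v : Fin d → ℝ} (hH : 1 ≤ H)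
    (hv : ∀ l, |v l| ≤ 1) (hHa : H ≤ |a|) (haR : |a| + 1 ≤ R) :
    ‖∑ j : Fin d → Fin M, (Γ (fun l => a * (c l * ((j₀ : ℝ) + (j l : ℕ)) ^ ε l))
        - Γ (fun l => (a + v l) * (c l * ((j₀ : ℝ) + (j l : ℕ)) ^ ε l)))‖
      ≤ ((j₀ : ℝ) + M) ^ d * (d * (b * (2 / (e₀ * H) + 2 * (R * Λ / j₀) ^ ρ
        + 2 * (j₀ / (j₀ + M))))) := by
  have hb0 : 0 ≤ b := (norm_nonneg _).trans (hb 0)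
  have hJ : (0 : ℝ) < j₀ + M := by
    have : (1 : ℝ) ≤ j₀ := by exact_mod_cast hj₀
    positivity
  have := norm_sum_pi_replace_le (M := M) Γ
    (fun l i => a * (c l * ((j₀ : ℝ) + (i : ℕ)) ^ ε l))
    (fun l i => (a + v l) * (c l * ((j₀ : ℝ) + (i : ℕ)) ^ ε l))
    (J := (j₀ : ℝ) + M) (by linarith [Nat.cast_nonneg (α := ℝ) j₀])
    (e := fun _ => b * (2 / (e₀ * H) + 2 * (R * Λ / j₀) ^ ρ + 2 * (j₀ / (j₀ + M)))) fun l z => by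
      have h1 := norm_sum_comp_rpow_sub_sum_le (ψ := fun t => Γ (Function.update z l t)) hρ
        (fun t => hb _) (fun s t => (hΓ _ _).trans (by
          gcongr; exact norm_update_sub_update z l s t)) (hε l) (hε1 l) (hc l) hj₀ (hΛ l)
        (a := a) (w := a + v l) (R := R) hH (by simpa using hv l) hHa (by linarith)
        ((abs_add_le _ _).trans (by linarith [hv l]))
      refine h1.trans ?_
      have h2 : 2 / (ε l * H) ≤ 2 / (e₀ * H) := by
        have := hεe l
        gcongr
      have h3 : b * (((j₀ : ℝ) + M) * (2 / (ε l * H) + 2 * (R * Λ / j₀) ^ ρ) + 2 * j₀)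
          ≤ b * (((j₀ : ℝ) + M) * (2 / (e₀ * H) + 2 * (R * Λ / j₀) ^ ρ) + 2 * j₀) := by gcongr
      refine h3.trans (le_of_eq ?_)
      field_simp
  simpa using this

/-- The substitution `t = p + v L`, coordinate by coordinate. -/
theorem setIntegral_box_comp_mul {d : ℕ} (p : Fin d → ℝ) {L : Fin d → ℝ} (hL : ∀ l, 0 < L l)
    {F : (Fin d → ℝ) → ℂ} (hF : Continuous F) :
    ∫ t in box p (p + L), F t
      = ((∏ l, L l : ℝ) : ℂ) * ∫ v in box 0 1, F (p + v * L) := by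
  have h1 := setIntegral_box_add 0 L p F
  rw [zero_add, add_comm L p] at h1
  rw [h1]
  have hdet : (Matrix.diagonal L).det = ∏ l, L l := Matrix.det_diagonal
  have hpos : 0 < ∏ l, L l := Finset.prod_pos fun l _ => hL l
  have hvol := Real.smul_map_diagonal_volume_pi (D := L) (by rw [hdet]; exact hpos.ne')
  rw [hdet, abs_of_pos hpos] at hvol
  have hlin : ∀ v, Matrix.toLin' (Matrix.diagonal L) v = v * L := fun v => by
    ext l
    simp [Matrix.toLin'_apply, Matrix.mulVec_diagonal, mul_comm]
  have hcont : Continuous (Matrix.toLin' (Matrix.diagonal L)) :=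
    LinearMap.continuous_of_finiteDimensional _
  conv_lhs => rw [← hvol]
  rw [Measure.restrict_smul, integral_smul_measure, setIntegral_map (measurableSet_box _ _)
    (show Continuous fun t => F (t + p) by fun_prop).aestronglyMeasurable hcont.aemeasurable,
    ENNReal.toReal_ofReal hpos.le, Complex.real_smul]
  congr 2
  · congr 1
    ext v
    simp only [Set.mem_preimage, hlin, box, Set.mem_univ_pi, Set.mem_Ico, Pi.zero_apply,
      Pi.mul_apply, Pi.one_apply]
    refine forall_congr' fun l => and_congr ?_ ?_
    · rw [mul_nonneg_iff_of_pos_right (hL l)]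
    · rw [mul_lt_iff_lt_one_left (hL l)]
  · ext v
    rw [hlin, add_comm]

section Bounds

variable {d : ℕ} {X 𝓑 : Type*} [MetricSpace X] [MeasurableSpace X] [NormedAddCommGroup 𝓑]
  [NormedSpace ℂ 𝓑]
variable {φ : Flow (Fin d → ℝ) X} {μ : Measure X} {B : FunctionAlgebra X 𝓑} {x : X}
  {C ρ : ℝ} {K : ℕ} {κ : ℝ}

/-- The correlation of `f` with its translate by `s`. -/
noncomputable def correlation (φ : Flow (Fin d → ℝ) X) (μ : Measure X) (f : X → ℂ)
    (s : Fin d → ℝ) : ℂ :=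
  ∫ y, f (φ s y) * starRingEnd ℂ (f y) ∂μ

theorem FlowBounds.integrable_mul_conj [BorelSpace X] [IsFiniteMeasure μ]
    (hB : FlowBounds φ μ B x C ρ K κ) (f : 𝓑) (s t : Fin d → ℝ) :
    Integrable (fun y => B.ev f (φ s y) * starRingEnd ℂ (B.ev f (φ t y))) μ := by
  have h1 : ∀ s, Continuous fun y => B.ev f (φ s y) := fun s =>
    (hB.continuous f).comp (φ.continuous continuous_const continuous_id)
  have hC := hB.nonneg
  refine Integrable.of_bound ((h1 s).mul (Complex.continuous_conj.comp (h1 t))).aestronglyMeasurable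
    (C * ‖f‖ * (C * ‖f‖)) (Eventually.of_forall fun y => ?_)
  rw [norm_mul, RCLike.norm_conj]
  exact mul_le_mul (hB.bound f _) (hB.bound f _) (norm_nonneg _) (by positivity)

/-- Correlations depend only on the difference of the times, by invariance of the measure. -/
theorem FlowBounds.integral_mul_conj [BorelSpace X]
    (hμ : ∀ t : Fin d → ℝ, MeasurePreserving (φ t) μ μ) (hB : FlowBounds φ μ B x C ρ K κ)
    (f : 𝓑) (s t : Fin d → ℝ) :
    ∫ y, B.ev f (φ s y) * starRingEnd ℂ (B.ev f (φ t y)) ∂μ = correlation φ μ (B.ev f) (s - t) := by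
  have h1 : Continuous fun y => B.ev f (φ (s - t) y) :=
    (hB.continuous f).comp (φ.continuous continuous_const continuous_id)
  have := integral_map (μ := μ) (hμ t).measurable.aemeasurable
    (f := fun y => B.ev f (φ (s - t) y) * starRingEnd ℂ (B.ev f y))
    (h1.mul (Complex.continuous_conj.comp (hB.continuous f))).aestronglyMeasurable
  rw [(hμ t).map_eq] at this
  rw [correlation, this]
  simp only [← φ.map_add, sub_add_cancel]

theorem FlowBounds.norm_correlation_le [IsFiniteMeasure μ]
    (hB : FlowBounds φ μ B x C ρ K κ) (f : 𝓑) (s : Fin d → ℝ) :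
    ‖correlation φ μ (B.ev f) s‖ ≤ (C * ‖f‖) ^ 2 * μ.real Set.univ := by
  have hC := hB.nonneg
  refine norm_integral_le_of_norm_le_const (Eventually.of_forall fun y => ?_)
  rw [norm_mul, RCLike.norm_conj, sq]
  exact mul_le_mul (hB.bound f _) (hB.bound f _) (norm_nonneg _) (by positivity)

theorem FlowBounds.norm_correlation_sub_le [BorelSpace X] [IsFiniteMeasure μ]
    (hB : FlowBounds φ μ B x C ρ K κ) (f : 𝓑) (s t : Fin d → ℝ) :
    ‖correlation φ μ (B.ev f) s - correlation φ μ (B.ev f) t‖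
      ≤ (C * ‖f‖) ^ 2 * μ.real Set.univ * ‖s - t‖ ^ ρ := by
  have hC := hB.nonneg
  have hi : ∀ s, Integrable (fun y => B.ev f (φ s y) * starRingEnd ℂ (B.ev f y)) μ := fun s => by
    simpa using hB.integrable_mul_conj f s 0
  rw [correlation, correlation, ← integral_sub (hi s) (hi t)]
  refine (norm_integral_le_of_norm_le_const (C := (C * ‖f‖) ^ 2 * ‖s - t‖ ^ ρ)
    (Eventually.of_forall fun y => ?_)).trans (le_of_eq (by ring))
  rw [← sub_mul, norm_mul, RCLike.norm_conj]
  calc _ ≤ (C * ‖f‖ * ‖s - t‖ ^ ρ) * (C * ‖f‖) :=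
        mul_le_mul (hB.holder f _ _ _) (hB.bound f _) (norm_nonneg _) (by positivity)
    _ = _ := by ring

/-- The mean square of the differences between the averages of `f` over the times `H a L` and over
the times `(H a + v) L`, `a < H`, expanded into correlations. -/
theorem FlowBounds.integral_sq_eq [BorelSpace X] [IsFiniteMeasure μ]
    (hμ : ∀ t : Fin d → ℝ, MeasurePreserving (φ t) μ μ) (hB : FlowBounds φ μ B x C ρ K κ)
    (f : 𝓑) (H : ℕ) (L v : Fin d → ℝ) :
    ((∫ y, ‖∑ a : Fin H, (B.ev f (φ (fun l => (H * a : ℝ) * L l) y)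
        - B.ev f (φ (fun l => (H * a + v l : ℝ) * L l) y))‖ ^ 2 ∂μ : ℝ) : ℂ)
      = ∑ a : Fin H, ∑ a' : Fin H,
        ((correlation φ μ (B.ev f) (fun l => (H * (a - a') : ℝ) * L l)
          - correlation φ μ (B.ev f) (fun l => (H * (a - a') + v l : ℝ) * L l))
        + (correlation φ μ (B.ev f) (fun l => (H * (a - a') : ℝ) * L l)
          - correlation φ μ (B.ev f) (fun l => (H * (a - a') + (-v) l : ℝ) * L l))) := by
  set s : Fin H → Fin d → ℝ := fun a l => (H * a : ℝ) * L l with hs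
  set t : Fin H → Fin d → ℝ := fun a l => (H * a + v l : ℝ) * L l with ht
  have hpt : ∀ y, ((‖∑ a : Fin H, (B.ev f (φ (s a) y) - B.ev f (φ (t a) y))‖ ^ 2 : ℝ) : ℂ)
      = ∑ a, ∑ a', (B.ev f (φ (s a) y) - B.ev f (φ (t a) y))
        * starRingEnd ℂ (B.ev f (φ (s a') y) - B.ev f (φ (t a') y)) := fun y => by
    rw [← Complex.normSq_eq_norm_sq, ← Complex.mul_conj, map_sum, Finset.sum_mul_sum]
  rw [← integral_complex_ofReal]
  change ∫ y, ((‖∑ a, (B.ev f (φ (s a) y) - B.ev f (φ (t a) y))‖ ^ 2 : ℝ) : ℂ) ∂μ = _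
  simp only [hpt]
  have hi := fun s t => hB.integrable_mul_conj f s t
  have hexp : ∀ a a' y, (B.ev f (φ (s a) y) - B.ev f (φ (t a) y))
        * starRingEnd ℂ (B.ev f (φ (s a') y) - B.ev f (φ (t a') y))
      = (B.ev f (φ (s a) y) * starRingEnd ℂ (B.ev f (φ (s a') y))
        - B.ev f (φ (t a) y) * starRingEnd ℂ (B.ev f (φ (s a') y)))
      + (B.ev f (φ (t a) y) * starRingEnd ℂ (B.ev f (φ (t a') y))
        - B.ev f (φ (s a) y) * starRingEnd ℂ (B.ev f (φ (t a') y))) := fun a a' y => by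
    rw [map_sub]; ring
  simp only [hexp]
  have hii : ∀ a a', Integrable (fun y =>
      (B.ev f (φ (s a) y) * starRingEnd ℂ (B.ev f (φ (s a') y))
        - B.ev f (φ (t a) y) * starRingEnd ℂ (B.ev f (φ (s a') y)))
      + (B.ev f (φ (t a) y) * starRingEnd ℂ (B.ev f (φ (t a') y))
        - B.ev f (φ (s a) y) * starRingEnd ℂ (B.ev f (φ (t a') y)))) μ := fun a a' =>
    ((hi _ _).sub (hi _ _)).add ((hi _ _).sub (hi _ _))
  rw [integral_finsetSum _ fun a _ => integrable_finsetSum _ fun a' _ => hii a a']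
  refine Finset.sum_congr rfl fun a _ => ?_
  rw [integral_finsetSum _ fun a' _ => hii a a']
  refine Finset.sum_congr rfl fun a' _ => ?_
  have hsub : ∀ s₁ t₁ s₂ t₂ : Fin d → ℝ,
      ∫ y, (B.ev f (φ s₁ y) * starRingEnd ℂ (B.ev f (φ t₁ y))
        - B.ev f (φ s₂ y) * starRingEnd ℂ (B.ev f (φ t₂ y))) ∂μ
      = correlation φ μ (B.ev f) (s₁ - t₁) - correlation φ μ (B.ev f) (s₂ - t₂) :=
    fun s₁ t₁ s₂ t₂ => by
      rw [integral_sub (hi s₁ t₁) (hi s₂ t₂), hB.integral_mul_conj hμ, hB.integral_mul_conj hμ]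
  refine (integral_add ((hi _ _).sub (hi _ _)) ((hi _ _).sub (hi _ _))).trans ?_
  refine congrArg₂ _ ((hsub _ _ _ _).trans ?_) ((hsub _ _ _ _).trans ?_)
  · congr 2 <;> (ext l; simp only [hs, ht, Pi.sub_apply]; ring)
  · congr 2 <;> (ext l; simp only [hs, ht, Pi.sub_apply, Pi.neg_apply]; ring)

/-- On average over `j` the averages of `f` along `H a L_j` and along `(H a + v) L_j` are close in
mean square: off the diagonal this is `norm_sum_correlation_sub_le`. -/
theorem FlowBounds.sum_integral_sq_le [BorelSpace X] [IsFiniteMeasure μ]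
    (hμ : ∀ t : Fin d → ℝ, MeasurePreserving (φ t) μ μ) (hB : FlowBounds φ μ B x C ρ K κ)
    (f : 𝓑) {ε c : Fin d → ℝ} {Λ e₀ : ℝ} (hε : ∀ l, 0 < ε l) (hε1 : ∀ l, ε l ≤ 1)
    (hεe : ∀ l, e₀ ≤ ε l) (he₀ : 0 < e₀) (hc : ∀ l, 0 ≤ c l) {j₀ M H : ℕ} (hj₀ : 1 ≤ j₀)
    (hΛ0 : 0 ≤ Λ) (hΛ : ∀ l, c l * ((j₀ : ℝ) + M) ^ ε l ≤ Λ) {v : Fin d → ℝ} (hH : 1 ≤ H)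
    (hv : ∀ l, |v l| ≤ 1) :
    ∑ j : Fin d → Fin M, ∫ y, ‖∑ a : Fin H,
        (B.ev f (φ (fun l => (H * a : ℝ) * (c l * ((j₀ : ℝ) + (j l : ℕ)) ^ ε l)) y)
        - B.ev f (φ (fun l => (H * a + v l : ℝ) * (c l * ((j₀ : ℝ) + (j l : ℕ)) ^ ε l)) y))‖ ^ 2 ∂μ
      ≤ ((j₀ : ℝ) + M) ^ d * ((C * ‖f‖) ^ 2 * μ.real Set.univ * (4 * H + 2 * (H : ℝ) ^ 2 *
        (d * (2 / (e₀ * H) + 2 * (((H : ℝ) ^ 2 + 1) * Λ / j₀) ^ ρ + 2 * (j₀ / (j₀ + M)))))) := by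
  have hC := hB.nonneg
  have hρ := hB.rho_pos
  have hH1 : (1 : ℝ) ≤ H := by exact_mod_cast hH
  have hj1 : (1 : ℝ) ≤ j₀ := by exact_mod_cast hj₀
  set b := (C * ‖f‖) ^ 2 * μ.real Set.univ with hb
  have hb0 : 0 ≤ b := by positivity
  set E := 2 / (e₀ * H) + 2 * (((H : ℝ) ^ 2 + 1) * Λ / j₀) ^ ρ + 2 * (j₀ / (j₀ + M)) with hE
  have hE0 : 0 ≤ E := by positivity
  set J := (j₀ : ℝ) + M with hJ
  have hJ0 : 0 ≤ J := by positivity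
  set Γ := correlation φ μ (B.ev f) with hΓ
  have hΓb := hB.norm_correlation_le f
  have hΓh := hB.norm_correlation_sub_le f
  set L : (Fin d → Fin M) → Fin d → ℝ := fun j l => c l * ((j₀ : ℝ) + (j l : ℕ)) ^ ε l with hL
  -- the `H` diagonal terms are bounded trivially; off the diagonal the time `k = H (a - a')` is at
  -- least `H`, so that passing to `k ± v` is a relative change of at most `1 / H`
  have hterm : ∀ a a' : Fin H, ‖∑ j : Fin d → Fin M,
      ((Γ (fun l => (H * (a - a') : ℝ) * L j l) - Γ (fun l => (H * (a - a') + v l : ℝ) * L j l))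
        + (Γ (fun l => (H * (a - a') : ℝ) * L j l)
          - Γ (fun l => (H * (a - a') + (-v) l : ℝ) * L j l)))‖
      ≤ J ^ d * (b * (if a = a' then 4 else 0)) + J ^ d * (b * (2 * (d * E))) := by
    intro a a'
    by_cases haa : a = a'
    · rw [if_pos haa]
      refine le_trans ?_ (le_add_of_nonneg_right (by positivity))
      refine (norm_sum_le_of_le (n := fun _ => b * 4) _ fun j _ => ?_).trans ?_
      · refine (norm_add_le _ _).trans ?_
        have h1 := fun s t => (norm_sub_le (Γ s) (Γ t)).trans (add_le_add (hΓb s) (hΓb t))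
        refine (add_le_add (h1 _ _) (h1 _ _)).trans (le_of_eq (by ring))
      · rw [Finset.sum_const, Finset.card_univ, Fintype.card_fun, Fintype.card_fin,
          Fintype.card_fin, nsmul_eq_mul]
        push_cast
        gcongr
        linarith
    · rw [if_neg haa, mul_zero, mul_zero, zero_add]
      have hdiff : (1 : ℝ) ≤ |(a : ℝ) - a'| := by
        have h1 : ((a : ℕ) : ℤ) ≠ ((a' : ℕ) : ℤ) := fun h => haa (Fin.ext (by exact_mod_cast h))
        have h2 : (1 : ℤ) ≤ |((a : ℕ) : ℤ) - ((a' : ℕ) : ℤ)| :=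
          Int.one_le_abs (sub_ne_zero.2 h1)
        exact_mod_cast h2
      have hdiff' : |(a : ℝ) - a'| ≤ H := by
        have h1 : (a : ℝ) ≤ H := by exact_mod_cast a.2.le
        have h2 : (a' : ℝ) ≤ H := by exact_mod_cast a'.2.le
        have h3 : (0 : ℝ) ≤ (a : ℕ) := Nat.cast_nonneg _
        have h4 : (0 : ℝ) ≤ (a' : ℕ) := Nat.cast_nonneg _
        rw [abs_le]; constructor <;> linarith
      have habs : |(H : ℝ) * (a - a')| = H * |(a : ℝ) - a'| := by
        rw [abs_mul, Nat.abs_cast]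
      have h1 : (H : ℝ) ≤ |(H : ℝ) * (a - a')| := by rw [habs]; nlinarith
      have h2 : |(H : ℝ) * (a - a')| + 1 ≤ (H : ℝ) ^ 2 + 1 := by rw [habs]; nlinarith
      have k := fun v (hv : ∀ l, |v l| ≤ 1) => norm_sum_correlation_sub_le (M := M) hρ hΓb hΓh hε hε1 hεe
        he₀ hc hj₀ hΛ (v := v) hH1 hv h1 h2
      rw [Finset.sum_add_distrib]
      refine (norm_add_le _ _).trans ((add_le_add (k v hv) (k (-v) fun l => by
        simpa using hv l)).trans (le_of_eq ?_))
      rw [← hE]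
      ring
  have hcast : ((∑ j : Fin d → Fin M, ∫ y, ‖∑ a : Fin H,
        (B.ev f (φ (fun l => (H * a : ℝ) * L j l) y)
        - B.ev f (φ (fun l => (H * a + v l : ℝ) * L j l) y))‖ ^ 2 ∂μ : ℝ) : ℂ)
      = ∑ a : Fin H, ∑ a' : Fin H, ∑ j : Fin d → Fin M,
      ((Γ (fun l => (H * (a - a') : ℝ) * L j l) - Γ (fun l => (H * (a - a') + v l : ℝ) * L j l))
        + (Γ (fun l => (H * (a - a') : ℝ) * L j l)
          - Γ (fun l => (H * (a - a') + (-v) l : ℝ) * L j l))) := by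
    rw [Complex.ofReal_sum]
    simp only [hB.integral_sq_eq hμ]
    rw [Finset.sum_comm]
    exact Finset.sum_congr rfl fun a _ => Finset.sum_comm
  have hnorm := congrArg norm hcast
  rw [Complex.norm_real] at hnorm
  refine (le_abs_self _).trans ?_
  rw [← Real.norm_eq_abs, hnorm]
  refine (norm_sum_le_of_le _ fun a _ => norm_sum_le_of_le _ fun a' _ => hterm a a').trans
    (le_of_eq ?_)
  simp only [Finset.sum_add_distrib, ← Finset.mul_sum, Finset.sum_ite_eq, Finset.mem_univ, if_true,
    Finset.sum_const, Finset.card_univ, Fintype.card_fin, nsmul_eq_mul]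
  ring

end Bounds

/-! ### Blocks of the sequence `n ^ (1 + ε)` -/

/-- The point `(n_l ^ (1 + ε_l))_l` of `ℝ^d`. -/
noncomputable def powPoint {d : ℕ} (ε : Fin d → ℝ) (n : Fin d → ℕ) : Fin d → ℝ :=
  fun l => (n l : ℝ) ^ (1 + ε l)

/-- The speed of `powPoint ε` in each coordinate at the corner `j Q` of a block of side `Q`. -/
noncomputable def speed {d : ℕ} (ε : Fin d → ℝ) (Q : ℕ) (j : Fin d → ℕ) : Fin d → ℝ :=
  fun l => (1 + ε l) * ((j l : ℝ) * Q) ^ ε l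

section Blocks

variable {d : ℕ} {ε : Fin d → ℝ} {Q j₀ : ℕ} {j : Fin d → ℕ}

/-- Within a block, and up to one block beyond, `powPoint ε` advances at a rate between the speed of
the block and `1 + 2 / j₀` times the speed. -/
theorem powPoint_sub_bounds (hε : ∀ l, 0 < ε l) (hε1 : ∀ l, ε l ≤ 1) (hQ : 1 ≤ Q) (hj₀ : 1 ≤ j₀)
    (hj : ∀ l, j₀ ≤ j l) (r : Fin d → Fin Q) {h : ℕ} (hh : h ≤ Q) (l : Fin d) :
    h * speed ε Q j l ≤ powPoint ε (fun l => j l * Q + r l + h) l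
        - powPoint ε (fun l => j l * Q + r l) l ∧
      powPoint ε (fun l => j l * Q + r l + h) l - powPoint ε (fun l => j l * Q + r l) l
        ≤ h * speed ε Q j l * (1 + 2 / j₀) := by
  have hQ0 : (0 : ℝ) < Q := by exact_mod_cast hQ
  have hj1 : (1 : ℝ) ≤ j₀ := by exact_mod_cast hj₀
  have hjl : (j₀ : ℝ) ≤ j l := by exact_mod_cast hj l
  have hr : ((r l : ℕ) : ℝ) ≤ Q := by exact_mod_cast (r l).2.le
  have hr0 : (0 : ℝ) ≤ (r l : ℕ) := Nat.cast_nonneg _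
  have hhR : (h : ℝ) ≤ Q := by exact_mod_cast hh
  have hh0 : (0 : ℝ) ≤ h := Nat.cast_nonneg _
  have := rpow_one_add_sub_bounds (hε l) (hε1 l) (j := j l) (q := Q) (y := (j l : ℝ) * Q + (r l : ℕ))
    (h := h) (hj1.trans hjl) hQ0 (by linarith) hh0 (by nlinarith)
  simp only [powPoint, speed]
  push_cast
  refine ⟨this.1, this.2.trans ?_⟩
  have h1 := (hε l).le
  have h2 : (0 : ℝ) < j₀ := by linarith
  gcongr

/-- Within a block the shift of the index by `h` is, on average, the translation by `h` times the
speed of the block. -/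
theorem norm_sum_block_sub_le {F : (Fin d → ℝ) → ℂ} {b ρ Λ : ℝ} (hρ : 0 < ρ)
    (hb : ∀ t, ‖F t‖ ≤ b) (hF : ∀ s t, ‖F s - F t‖ ≤ b * ‖s - t‖ ^ ρ)
    (hε : ∀ l, 0 < ε l) (hε1 : ∀ l, ε l ≤ 1) (hQ : 1 ≤ Q) (hj₀ : 1 ≤ j₀)
    (hj : ∀ l, j₀ ≤ j l) (hΛ0 : 0 ≤ Λ) (hΛ : ∀ l, speed ε Q j l ≤ Λ) {h : ℕ} (hh : h ≤ Q) :
    ‖∑ r : Fin d → Fin Q, (F (powPoint ε fun l => j l * Q + r l)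
        - F ((powPoint ε fun l => j l * Q + r l) + (h : ℝ) • speed ε Q j))‖
      ≤ (Q : ℝ) ^ d * (b * (2 * d * h / Q + (2 * h * Λ / j₀) ^ ρ)) := by
  have hb0 : 0 ≤ b := (norm_nonneg _).trans (hb 0)
  have h1 := norm_sum_cube_shift_sub_le hQ h
    (fun r : Fin d → ℕ => F (powPoint ε fun l => j l * Q + r l)) fun n => hb _
  rw [← norm_neg, ← Finset.sum_neg_distrib] at h1
  simp only [neg_sub] at h1
  have h2 : ‖∑ r : Fin d → Fin Q, (F (powPoint ε fun l => j l * Q + (r l + h))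
      - F ((powPoint ε fun l => j l * Q + r l) + (h : ℝ) • speed ε Q j))‖
      ≤ (Q : ℝ) ^ d * (b * (2 * h * Λ / j₀) ^ ρ) := by
    refine (norm_sum_le_of_le (n := fun _ => b * (2 * h * Λ / j₀) ^ ρ) _ fun r _ => ?_).trans ?_
    · refine (hF _ _).trans ?_
      gcongr
      refine (pi_norm_le_iff_of_nonneg (by positivity)).2 fun l => ?_
      have := powPoint_sub_bounds hε hε1 hQ hj₀ hj r hh l
      simp only [add_assoc] at this
      have h3 : (h : ℝ) * speed ε Q j l * (2 / j₀) ≤ 2 * h * Λ / j₀ := by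
        calc (h : ℝ) * speed ε Q j l * (2 / j₀) ≤ h * Λ * (2 / j₀) := by
              gcongr; exact hΛ l
          _ = _ := by ring
      rw [Pi.sub_apply, Pi.add_apply, Pi.smul_apply, smul_eq_mul, Real.norm_eq_abs, abs_le]
      constructor <;> nlinarith
    · simp
  have e : ∑ r : Fin d → Fin Q, (F (powPoint ε fun l => j l * Q + r l)
        - F ((powPoint ε fun l => j l * Q + r l) + (h : ℝ) • speed ε Q j))
      = ∑ r : Fin d → Fin Q, (F (powPoint ε fun l => j l * Q + r l)
          - F (powPoint ε fun l => j l * Q + (r l + h)))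
        + ∑ r : Fin d → Fin Q, (F (powPoint ε fun l => j l * Q + (r l + h))
      - F ((powPoint ε fun l => j l * Q + r l) + (h : ℝ) • speed ε Q j)) := by
    rw [← Finset.sum_add_distrib]
    exact Finset.sum_congr rfl fun r _ => by ring
  rw [e]
  refine (norm_add_le _ _).trans ((add_le_add h1 h2).trans (le_of_eq ?_))
  ring

/-- The box covered by a block is cut into the boxes between neighbouring points. -/
theorem setIntegral_block_eq_sum {E : Type*} [NormedAddCommGroup E] [NormedSpace ℝ E]
    (hε : ∀ l, 0 < ε l) {W : (Fin d → ℝ) → E} (hW : Continuous W) :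
    ∫ t in box (powPoint ε fun l => j l * Q) (powPoint ε fun l => (j l + 1) * Q), W t
      = ∑ r : Fin d → Fin Q, ∫ t in box (powPoint ε fun l => j l * Q + r l)
        (powPoint ε fun l => j l * Q + r l + 1), W t := by
  have := setIntegral_box_eq_sum (a := fun l i => ((j l * Q + i : ℕ) : ℝ) ^ (1 + ε l))
    (fun l i i' hi => Real.rpow_le_rpow (Nat.cast_nonneg _) (by exact_mod_cast (by omega))
      (by linarith [hε l])) Q (F := W) (integrableOn_box hW)
  simp only [add_zero] at this
  have e : ∀ l, j l * Q + Q = (j l + 1) * Q := fun l => by ring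
  simp only [e] at this
  exact this

/-- Neighbouring points are at distance at least one, so small boxes at them are disjoint. -/
theorem powPoint_add_one_le (hε : ∀ l, 0 < ε l) (n : Fin d → ℕ) (l : Fin d) :
    powPoint ε n l + 1 ≤ powPoint ε (fun l => n l + 1) l := by
  have := Real.add_rpow_le_rpow_add (a := (n l : ℝ)) (b := 1) (Nat.cast_nonneg _) zero_le_one
    (p := 1 + ε l) (by linarith [hε l])
  rw [Real.one_rpow] at this
  simpa only [powPoint, Nat.cast_add, Nat.cast_one] using this

/-- A sum over the points of a block is at most the integral over small boxes at these points. -/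
theorem sum_block_le_integral (hε : ∀ l, 0 < ε l) {W : (Fin d → ℝ) → ℝ} (hW : Continuous W)
    (hW0 : ∀ t, 0 ≤ W t) {δ η : ℝ} (hδ : 0 < δ) (hδ1 : δ ≤ 1)
    (hη : ∀ s t, ‖s - t‖ ≤ δ → W s ≤ W t + η) :
    ∑ r : Fin d → Fin Q, W (powPoint ε fun l => j l * Q + r l)
      ≤ (δ ^ d)⁻¹ * (∫ t in box (powPoint ε fun l => j l * Q)
        (powPoint ε fun l => (j l + 1) * Q), W t) + (Q : ℝ) ^ d * η := by
  rw [setIntegral_block_eq_sum hε hW, Finset.mul_sum]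
  have hterm : ∀ r : Fin d → Fin Q, W (powPoint ε fun l => j l * Q + r l)
      ≤ (δ ^ d)⁻¹ * (∫ t in box (powPoint ε fun l => j l * Q + r l)
        (powPoint ε fun l => j l * Q + r l + 1), W t) + η := by
    intro r
    set p := powPoint ε fun l => j l * Q + r l with hp
    set p' := powPoint ε fun l => j l * Q + r l + 1 with hp'
    have hgap : ∀ l, p l + 1 ≤ p' l := fun l => powPoint_add_one_le hε _ l
    have hsub : box p (fun l => p l + δ) ⊆ box p p' := fun t ht l _ =>
      ⟨(ht l trivial).1, (ht l trivial).2.trans_le (by linarith [hgap l])⟩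
    have hvol : volume.real (box p (fun l => p l + δ)) = δ ^ d := by
      rw [measureReal_box fun l => by linarith]
      simp
    have h1 : ∫ t in box p (fun l => p l + δ), W t ≤ ∫ t in box p p', W t :=
      setIntegral_mono_set (integrableOn_box hW _ _) (Eventually.of_forall hW0) hsub.eventuallyLE
    have h2 : ∫ _t in box p (fun l => p l + δ), (W p - η)
        ≤ ∫ t in box p (fun l => p l + δ), W t := by
      refine setIntegral_mono_on (integrableOn_const (measure_box_lt_top _ _).ne)
        (integrableOn_box hW _ _) (measurableSet_box _ _) fun t ht => ?_
      have := hη p t ((pi_norm_le_iff_of_nonneg hδ.le).2 fun l => by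
        have := ht l trivial
        rw [Pi.sub_apply, Real.norm_eq_abs, abs_le]
        constructor <;> linarith [this.1, this.2])
      linarith
    rw [setIntegral_const, hvol, smul_eq_mul] at h2
    have h3 : W p - η ≤ (δ ^ d)⁻¹ * ∫ t in box p p', W t := by
      rw [le_inv_mul_iff₀ (by positivity)]
      exact h2.trans h1
    linarith
  refine (Finset.sum_le_sum fun r _ => hterm r).trans (le_of_eq ?_)
  rw [Finset.sum_add_distrib]
  simp

theorem one_add_pow_le {x : ℝ} (hx : 0 ≤ x) (hx2 : x ≤ 2) (d : ℕ) :
    (1 + x) ^ d ≤ 1 + x * 4 ^ d := by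
  induction d with
  | zero => simp [hx]
  | succ d ih =>
    have h1 : (1 : ℝ) ≤ 4 ^ d := one_le_pow₀ (by norm_num)
    have h2 : x * x * 4 ^ d ≤ 2 * x * 4 ^ d := by gcongr
    calc (1 + x) ^ (d + 1) ≤ (1 + x * 4 ^ d) * (1 + x) := by
          rw [pow_succ]; gcongr
      _ ≤ _ := by
          rw [pow_succ]
          nlinarith

/-- Averaging a function over the boxes spanned by the speed at the points of a block gives,
approximately, its integral over the box that the block covers. -/
theorem norm_sum_block_integral_le {F : (Fin d → ℝ) → ℂ} (hFc : Continuous F) {b : ℝ}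
    (hb : ∀ t, ‖F t‖ ≤ b) (hε : ∀ l, 0 < ε l) (hε1 : ∀ l, ε l ≤ 1) (hQ : 1 ≤ Q) (hj₀ : 1 ≤ j₀)
    (hj : ∀ l, j₀ ≤ j l) :
    ‖∑ r : Fin d → Fin Q, ∫ v in box 0 1, F ((powPoint ε fun l => j l * Q + r l) + v * speed ε Q j)‖
      ≤ ‖∫ t in box (powPoint ε fun l => j l * Q) (powPoint ε fun l => (j l + 1) * Q), F t‖
        + (Q : ℝ) ^ d * (b * (2 / j₀ * 4 ^ d)) := by
  have hb0 : 0 ≤ b := (norm_nonneg _).trans (hb 0)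
  have hj1 : (1 : ℝ) ≤ j₀ := by exact_mod_cast hj₀
  set L := speed ε Q j with hL
  have hL1 : ∀ l, 1 ≤ L l := fun l => by
    have h1 : (1 : ℝ) ≤ (j l : ℝ) * Q := by
      exact_mod_cast Nat.mul_pos (hj₀.trans (hj l)) hQ
    have h2 := Real.one_le_rpow h1 (hε l).le
    simp only [hL, speed]
    nlinarith [hε l]
  have hL0 : ∀ l, 0 < L l := fun l => zero_lt_one.trans_le (hL1 l)
  have hP : 1 ≤ ∏ l, L l := by
    have := Finset.prod_le_prod (s := Finset.univ) (f := fun _ : Fin d => (1 : ℝ)) (g := L)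
      (fun _ _ => zero_le_one) fun l _ => hL1 l
    simpa using this
  have hP0 : 0 < ∏ l, L l := by linarith
  rw [setIntegral_block_eq_sum hε hFc]
  have hterm : ∀ r : Fin d → Fin Q,
      ‖((∏ l, L l : ℝ) : ℂ) * (∫ v in box 0 1, F ((powPoint ε fun l => j l * Q + r l) + v * L))
        - ∫ t in box (powPoint ε fun l => j l * Q + r l) (powPoint ε fun l => j l * Q + r l + 1), F t‖
      ≤ (∏ l, L l) * (b * (2 / j₀ * 4 ^ d)) := by
    intro r
    rw [← setIntegral_box_comp_mul _ hL0 hFc]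
    set p := powPoint ε fun l => j l * Q + r l with hp
    set p' := powPoint ε fun l => j l * Q + r l + 1 with hp'
    have hbd := powPoint_sub_bounds hε hε1 hQ hj₀ hj r hQ
    simp only [Nat.cast_one, one_mul] at hbd
    have hlo : ∀ l, p l + L l ≤ p' l := fun l => by linarith [(hbd l).1]
    have hhi : ∀ l, p' l - p l ≤ L l * (1 + 2 / j₀) := fun l => (hbd l).2
    have hsub : box p (p + L) ⊆ box p p' := fun t ht l _ =>
      ⟨(ht l trivial).1, (ht l trivial).2.trans_le (hlo l)⟩
    rw [norm_sub_rev, ← setIntegral_sdiff (measurableSet_box _ _) (integrableOn_box hFc _ _) hsub]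
    refine (norm_setIntegral_le_of_norm_le_const
      ((measure_mono Set.sdiff_subset).trans_lt (measure_box_lt_top p p')) fun t _ => hb t).trans ?_
    rw [measureReal_sdiff hsub (measurableSet_box _ _) (measure_box_lt_top _ _).ne,
      measureReal_box fun l => by linarith [hlo l, hL0 l],
      measureReal_box fun l => by simp [(hL0 l).le]]
    simp only [Pi.add_apply, add_sub_cancel_left]
    have hvol : ∏ l, (p' l - p l) ≤ (∏ l, L l) * (1 + 2 / j₀ * 4 ^ d) := by
      calc ∏ l, (p' l - p l) ≤ ∏ l, (L l * (1 + 2 / (j₀ : ℝ))) :=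
            Finset.prod_le_prod (fun l _ => by linarith [hlo l, hL0 l]) fun l _ => hhi l
        _ = (∏ l, L l) * (1 + 2 / (j₀ : ℝ)) ^ d := by
            rw [Finset.prod_mul_distrib]; simp
        _ ≤ _ := by
            gcongr
            refine one_add_pow_le (by positivity) ?_ d
            rw [div_le_iff₀ (by linarith)]; linarith
    calc b * (∏ l, (p' l - p l) - ∏ l, L l)
        ≤ b * ((∏ l, L l) * (1 + 2 / j₀ * 4 ^ d) - ∏ l, L l) := by gcongr
      _ = _ := by ring
  have hsum := norm_sum_le_of_le Finset.univ fun r _ => hterm r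
  rw [Finset.sum_sub_distrib, ← Finset.mul_sum] at hsum
  set S := ∑ r : Fin d → Fin Q, ∫ v in box 0 1, F ((powPoint ε fun l => j l * Q + r l) + v * L)
  set I := ∑ r : Fin d → Fin Q, ∫ t in box (powPoint ε fun l => j l * Q + r l)
    (powPoint ε fun l => j l * Q + r l + 1), F t
  have e : ∑ _r : Fin d → Fin Q, (∏ l, L l) * (b * (2 / j₀ * 4 ^ d))
      = (∏ l, L l) * ((Q : ℝ) ^ d * (b * (2 / j₀ * 4 ^ d))) := by
    simp; ring
  rw [e] at hsum
  have h1 : (∏ l, L l) * ‖S‖ ≤ ‖I‖ + (∏ l, L l) * ((Q : ℝ) ^ d * (b * (2 / j₀ * 4 ^ d))) := by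
    have h2 := norm_sub_norm_le (((∏ l, L l : ℝ) : ℂ) * S) I
    rw [norm_mul, Complex.norm_real, Real.norm_of_nonneg hP0.le] at h2
    linarith
  have h3 : ‖I‖ ≤ (∏ l, L l) * ‖I‖ := le_mul_of_one_le_left (norm_nonneg _) hP
  refine le_of_mul_le_mul_left ?_ hP0
  rw [mul_add]
  linarith

end Blocks

section Bounds

variable {d : ℕ} {X 𝓑 : Type*} [MetricSpace X] [MeasurableSpace X] [NormedAddCommGroup 𝓑]
  [NormedSpace ℂ 𝓑]
variable {φ : Flow (Fin d → ℝ) X} {μ : Measure X} {B : FunctionAlgebra X 𝓑} {x : X}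
  {C ρ : ℝ} {K : ℕ} {κ : ℝ}

/-! ### Replacing points by translates along the speed -/

/-- The difference of the sums of `f` over the times `H a L` and `(H a + v) L` belongs to the algebra,
with a norm that grows polynomially in `H` and `Λ`. -/
theorem FlowBounds.exists_shift_difference (hB : FlowBounds φ μ B x C ρ K κ) (f : 𝓑) (H : ℕ)
    {L v : Fin d → ℝ} {Λ : ℝ} (hΛ0 : 0 ≤ Λ) (hL : ∀ l, 0 ≤ L l ∧ L l ≤ Λ)
    (hv : ∀ l, 0 ≤ v l ∧ v l ≤ 1) :
    ∃ g : 𝓑, (∀ y, B.ev g y = ∑ a : Fin H, (B.ev f (φ (fun l => (H * a : ℝ) * L l) y)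
        - B.ev f (φ (fun l => (H * a + v l : ℝ) * L l) y))) ∧
      ‖g‖ ≤ H * (2 * (C * ‖f‖ * (1 + ((H : ℝ) ^ 2 + 1) * Λ) ^ K)) := by
  have hC := hB.nonneg
  choose τ hτ hτn using fun t => hB.trans t f
  have haH : ∀ a : Fin H, (H : ℝ) * a ≤ (H : ℝ) ^ 2 := fun a => by
    have : ((a : ℕ) : ℝ) ≤ H := by exact_mod_cast a.2.le
    nlinarith [Nat.cast_nonneg (α := ℝ) H]
  have hn : ∀ t : Fin d → ℝ, (∀ l, 0 ≤ t l ∧ t l ≤ ((H : ℝ) ^ 2 + 1)) →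
      ‖τ fun l => t l * L l‖ ≤ C * ‖f‖ * (1 + ((H : ℝ) ^ 2 + 1) * Λ) ^ K := fun t ht => by
    refine (hτn _).trans ?_
    gcongr
    exact norm_le_of_forall_mem_Icc (by positivity) fun l =>
      ⟨mul_nonneg (ht l).1 (hL l).1, mul_le_mul (ht l).2 (hL l).2 (hL l).1 (by positivity)⟩
  refine ⟨∑ a : Fin H, (τ (fun l => (H * a : ℝ) * L l) - τ fun l => (H * a + v l : ℝ) * L l),
    fun y => ?_, ?_⟩
  · rw [map_sum, Finset.sum_apply]
    simp only [map_sub, Pi.sub_apply, hτ]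
  · refine (norm_sum_le_of_le (n := fun _ => 2 * (C * ‖f‖ * (1 + ((H : ℝ) ^ 2 + 1) * Λ) ^ K)) _
      fun a _ => ?_).trans (by simp)
    have h1 := hn (fun _ => (H * a : ℝ)) fun l => ⟨by positivity, by linarith [haH a]⟩
    have h2 := hn (fun l => (H * a + v l : ℝ)) fun l =>
      ⟨by have := (hv l).1; positivity, by linarith [haH a, (hv l).2]⟩
    exact (norm_sub_le _ _).trans (by linarith)

/-- The square sum over a block of a difference of averages along the speed of the block is
controlled by its mean square over the whole space: the points are thickened to boxes of side `δ`,
and the integral over the box covered by the block is computed from the mean. -/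
theorem FlowBounds.exists_sum_sq_block_le [BorelSpace X] [IsFiniteMeasure μ]
    (hB : FlowBounds φ μ B x C ρ K κ) :
    ∃ C' : ℝ, 0 ≤ C' ∧ ∀ (f : 𝓑) {ε : Fin d → ℝ} {Q j₀ H : ℕ} {j : Fin d → ℕ} {Λ T δ : ℝ}
      {v : Fin d → ℝ}, (∀ l, 0 < ε l) → (∀ l, ε l ≤ 1) → 1 ≤ Q → 1 ≤ j₀ → (∀ l, j₀ ≤ j l) →
      0 ≤ Λ → (∀ l, speed ε Q j l ≤ Λ) → 1 ≤ T → (∀ l, powPoint ε (fun l => (j l + 1) * Q) l ≤ T) →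
      0 < δ → δ ≤ 1 → (∀ l, 0 ≤ v l ∧ v l ≤ 1) →
      ∑ r : Fin d → Fin Q, ‖∑ a : Fin H,
        (B.ev f (φ (fun l => (H * a : ℝ) * speed ε Q j l)
            (φ (powPoint ε fun l => j l * Q + r l) x))
          - B.ev f (φ (fun l => (H * a + v l : ℝ) * speed ε Q j l)
            (φ (powPoint ε fun l => j l * Q + r l) x)))‖ ^ 2
      ≤ (δ ^ d)⁻¹ * (C' * ((∫ y, ‖∑ a : Fin H, (B.ev f (φ (fun l => (H * a : ℝ) * speed ε Q j l) y)
          - B.ev f (φ (fun l => (H * a + v l : ℝ) * speed ε Q j l) y))‖ ^ 2 ∂μ) * (3 * Q * Λ) ^ d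
        + C * (H * (2 * (C * ‖f‖ * (1 + ((H : ℝ) ^ 2 + 1) * Λ) ^ K))) ^ 2 * (T ^ d * T ^ (-κ))))
        + (Q : ℝ) ^ d * (8 * (H : ℝ) ^ 2 * (C * ‖f‖) ^ 2 * δ ^ ρ) := by
  obtain ⟨C', hC'0, hbox⟩ := hB.exists_norm_integral_box_le
  refine ⟨C', hC'0, fun f ε Q j₀ H j Λ T δ v hε hε1 hQ hj₀ hj hΛ0 hΛ hT hPT hδ hδ1 hv => ?_⟩
  have hC := hB.nonneg
  have hρ := hB.rho_pos
  set L := speed ε Q j with hL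
  have hL0 : ∀ l, 0 ≤ L l ∧ L l ≤ Λ := fun l => ⟨by
    have := (hε l).le
    simp only [hL, speed]; positivity, hΛ l⟩
  obtain ⟨g, hg, hgn⟩ := hB.exists_shift_difference f H hΛ0 hL0 hv
  simp only [← hg]
  obtain ⟨G, hG, hGn⟩ := hB.mul_conj g g
  have hG2 : ∀ y, B.ev G y = ((‖B.ev g y‖ ^ 2 : ℝ) : ℂ) := fun y => by
    rw [hG, Complex.mul_conj, Complex.normSq_eq_norm_sq]
  set b := C * ‖f‖ with hb
  have hb0 : 0 ≤ b := by positivity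
  have hgb : ∀ y, ‖B.ev g y‖ ≤ H * (2 * b) := fun y => by
    rw [hg]
    refine (norm_sum_le_of_le (n := fun _ => 2 * b) _ fun a _ => ?_).trans (by simp)
    have h1 := hB.bound f (φ (fun l => (H * a : ℝ) * L l) y)
    have h2 := hB.bound f (φ (fun l => (H * a + v l : ℝ) * L l) y)
    exact (norm_sub_le _ _).trans (by linarith)
  have hgh : ∀ s t : Fin d → ℝ, ‖B.ev g (φ s x) - B.ev g (φ t x)‖ ≤ H * (2 * b) * ‖s - t‖ ^ ρ := by
    intro s t
    rw [hg, hg, ← Finset.sum_sub_distrib]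
    refine (norm_sum_le_of_le (n := fun _ => 2 * (b * ‖s - t‖ ^ ρ)) _ fun a _ => ?_).trans
      (le_of_eq (by simp; ring))
    have h1 : ∀ c : Fin d → ℝ, ‖B.ev f (φ c (φ s x)) - B.ev f (φ c (φ t x))‖ ≤ b * ‖s - t‖ ^ ρ :=
      fun c => by
        rw [← φ.map_add, ← φ.map_add]
        exact (hB.holder f x _ _).trans_eq (by rw [add_sub_add_left_eq_sub])
    rw [sub_sub_sub_comm]
    have h2 := h1 fun l => (H * a : ℝ) * L l
    have h3 := h1 fun l => (H * a + v l : ℝ) * L l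
    exact (norm_sub_le _ _).trans (by linarith)
  set W : (Fin d → ℝ) → ℝ := fun t => ‖B.ev g (φ t x)‖ ^ 2 with hW
  have hWc : Continuous W := (hB.continuous_orbit g).norm.pow 2
  have h1 := sum_block_le_integral (Q := Q) (j := j) hε hWc (fun t => by positivity) hδ hδ1
    (η := 8 * (H : ℝ) ^ 2 * b ^ 2 * δ ^ ρ) fun s t hst => by
      have e1 : ‖B.ev g (φ s x)‖ - ‖B.ev g (φ t x)‖ ≤ H * (2 * b) * δ ^ ρ := by
        refine (norm_sub_norm_le _ _).trans ((hgh s t).trans ?_)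
        gcongr
      have e2 := hgb (φ s x)
      have e3 := hgb (φ t x)
      have e4 : 0 ≤ H * (2 * b) * δ ^ ρ := by positivity
      have e5 : (‖B.ev g (φ s x)‖ - ‖B.ev g (φ t x)‖) * (‖B.ev g (φ s x)‖ + ‖B.ev g (φ t x)‖)
          ≤ (H * (2 * b) * δ ^ ρ) * (H * (2 * b) + H * (2 * b)) :=
        mul_le_mul e1 (by linarith) (by positivity) e4
      simp only [hW]
      nlinarith
  refine h1.trans (add_le_add_left ?_ _)
  gcongr
  have hmono : ∀ l, powPoint ε (fun l => j l * Q) l ≤ powPoint ε (fun l => (j l + 1) * Q) l :=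
    fun l => Real.rpow_le_rpow (Nat.cast_nonneg _)
      (by exact_mod_cast Nat.mul_le_mul_right Q (Nat.le_succ _)) (by linarith [hε l])
  have hp0 : ∀ l, 0 ≤ powPoint ε (fun l => j l * Q) l := fun l => by
    simp only [powPoint]; positivity
  have h2 := hbox G T hT (powPoint ε fun l => j l * Q) (powPoint ε fun l => (j l + 1) * Q)
    (fun l => by linarith [hp0 l]) hmono hPT
  simp only [hG2] at h2
  rw [integral_complex_ofReal, integral_complex_ofReal, Complex.norm_real, Complex.norm_real] at h2
  refine (le_abs_self _).trans (h2.trans ?_)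
  rw [Real.norm_of_nonneg (integral_nonneg fun y => by positivity)]
  gcongr
  · calc ∏ l, (powPoint ε (fun l => (j l + 1) * Q) l - powPoint ε (fun l => j l * Q) l)
        ≤ ∏ _l : Fin d, (3 * Q * Λ) := by
          refine Finset.prod_le_prod (fun l _ => by linarith [hmono l]) fun l _ => ?_
          have h3 := (powPoint_sub_bounds hε hε1 hQ hj₀ hj (fun _ => ⟨0, hQ⟩) le_rfl l).2
          have e : ∀ l, j l * Q + Q = (j l + 1) * Q := fun l => by ring
          simp only [add_zero, e] at h3
          refine h3.trans ?_
          have hj1 : (1 : ℝ) ≤ j₀ := by exact_mod_cast hj₀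
          have h4 : 1 + 2 / (j₀ : ℝ) ≤ 3 := by
            have : 2 / (j₀ : ℝ) ≤ 2 := by rw [div_le_iff₀ (by linarith)]; linarith
            linarith
          calc (Q : ℝ) * L l * (1 + 2 / j₀) ≤ Q * Λ * 3 := by
                have := hL0 l
                gcongr
                exact this.2
            _ = _ := by ring
      _ = _ := by simp
  · refine hGn.trans ?_
    rw [mul_assoc, ← sq]
    gcongr

end Bounds

section Bounds

variable {d : ℕ} {X 𝓑 : Type*} [MetricSpace X] [MeasurableSpace X] [NormedAddCommGroup 𝓑]
  [NormedSpace ℂ 𝓑]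
variable {φ : Flow (Fin d → ℝ) X} {μ : Measure X} {B : FunctionAlgebra X 𝓑} {x : X}
  {C ρ : ℝ} {K : ℕ} {κ : ℝ}

/-- Over a block, differences between `f` and its translate by `v` times the speed may be averaged
along the speed. -/
theorem FlowBounds.norm_block_average_sub_le (hB : FlowBounds φ μ B x C ρ K κ) (f : 𝓑)
    {ε : Fin d → ℝ} {Q j₀ H : ℕ} {j : Fin d → ℕ} {Λ : ℝ} (v : Fin d → ℝ) (hε : ∀ l, 0 < ε l)
    (hε1 : ∀ l, ε l ≤ 1) (hQ : 1 ≤ Q) (hj₀ : 1 ≤ j₀) (hj : ∀ l, j₀ ≤ j l) (hΛ0 : 0 ≤ Λ)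
    (hΛ : ∀ l, speed ε Q j l ≤ Λ) (hHQ : H ^ 2 ≤ Q) :
    ‖(H : ℂ) * (∑ r : Fin d → Fin Q, (B.ev f (φ (powPoint ε fun l => j l * Q + r l) x)
        - B.ev f (φ ((powPoint ε fun l => j l * Q + r l) + v * speed ε Q j) x)))
      - ∑ r : Fin d → Fin Q, ∑ a : Fin H, (B.ev f (φ (fun l => (H * a : ℝ) * speed ε Q j l)
            (φ (powPoint ε fun l => j l * Q + r l) x))
          - B.ev f (φ (fun l => (H * a + v l : ℝ) * speed ε Q j l)
            (φ (powPoint ε fun l => j l * Q + r l) x)))‖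
      ≤ H * ((Q : ℝ) ^ d * (2 * (C * ‖f‖) * (2 * d * (H : ℝ) ^ 2 / Q
        + (2 * (H : ℝ) ^ 2 * Λ / j₀) ^ ρ))) := by
  have hC := hB.nonneg
  have hρ := hB.rho_pos
  set L := speed ε Q j with hL
  set b := C * ‖f‖ with hb
  have hb0 : 0 ≤ b := by positivity
  set P : (Fin d → Fin Q) → Fin d → ℝ := fun r => powPoint ε fun l => j l * Q + r l with hP
  have hterm : ∀ a : Fin H, ‖(∑ r, (B.ev f (φ (P r) x) - B.ev f (φ (P r + v * L) x)))
      - ∑ r, (B.ev f (φ (fun l => (H * a : ℝ) * L l) (φ (P r) x))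
          - B.ev f (φ (fun l => (H * a + v l : ℝ) * L l) (φ (P r) x)))‖
      ≤ (Q : ℝ) ^ d * (2 * b * (2 * d * (H : ℝ) ^ 2 / Q + (2 * (H : ℝ) ^ 2 * Λ / j₀) ^ ρ)) := by
    intro a
    have haH : H * a ≤ H ^ 2 := by
      rw [sq]; exact Nat.mul_le_mul_left _ a.2.le
    have k : ∀ s : Fin d → ℝ, ‖∑ r, (B.ev f (φ (P r + s) x)
        - B.ev f (φ (P r + ((H * a : ℕ) : ℝ) • L + s) x))‖
        ≤ (Q : ℝ) ^ d * (b * (2 * d * (H : ℝ) ^ 2 / Q + (2 * (H : ℝ) ^ 2 * Λ / j₀) ^ ρ)) := by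
      intro s
      refine (norm_sum_block_sub_le (F := fun t => B.ev f (φ (t + s) x)) hρ (fun t => hB.bound f _)
        (fun t t' => (hB.holder f x _ _).trans_eq (by rw [add_sub_add_right_eq_sub]))
        hε hε1 hQ hj₀ hj hΛ0 hΛ (haH.trans hHQ)).trans ?_
      have h1 : ((H * a : ℕ) : ℝ) ≤ (H : ℝ) ^ 2 := by exact_mod_cast haH
      gcongr
    have e : (∑ r, (B.ev f (φ (P r) x) - B.ev f (φ (P r + v * L) x)))
        - ∑ r, (B.ev f (φ (fun l => (H * a : ℝ) * L l) (φ (P r) x))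
          - B.ev f (φ (fun l => (H * a + v l : ℝ) * L l) (φ (P r) x)))
        = (∑ r, (B.ev f (φ (P r + 0) x) - B.ev f (φ (P r + ((H * a : ℕ) : ℝ) • L + 0) x)))
        - ∑ r, (B.ev f (φ (P r + v * L) x) - B.ev f (φ (P r + ((H * a : ℕ) : ℝ) • L + v * L) x)) := by
      rw [← Finset.sum_sub_distrib, ← Finset.sum_sub_distrib]
      refine Finset.sum_congr rfl fun r _ => ?_
      rw [← φ.map_add, ← φ.map_add, add_zero, add_zero]
      have e1 : (fun l => (H * a : ℝ) * L l) + P r = P r + ((H * a : ℕ) : ℝ) • L := by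
        ext l; simp [add_comm]
      have e2 : (fun l => (H * a + v l : ℝ) * L l) + P r
          = P r + ((H * a : ℕ) : ℝ) • L + v * L := by
        ext l; simp; ring
      rw [e1, e2]
      ring
    rw [e]
    refine (norm_sub_le _ _).trans ((add_le_add (k 0) (k (v * L))).trans (le_of_eq (by ring)))
  have hsum := norm_sum_le_of_le Finset.univ fun a _ => hterm a
  rw [Finset.sum_sub_distrib, Finset.sum_const, Finset.sum_const, Finset.card_univ,
    Fintype.card_fin, nsmul_eq_mul, nsmul_eq_mul] at hsum
  rw [Finset.sum_comm]
  exact hsum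

/-- The average over all blocks of the difference between `f` and its translate by `v` times the
speed of the block. -/
theorem FlowBounds.exists_norm_sum_translate_sub_le [BorelSpace X] [IsFiniteMeasure μ]
    (hμ : ∀ t : Fin d → ℝ, MeasurePreserving (φ t) μ μ) (hB : FlowBounds φ μ B x C ρ K κ) :
    ∃ C' : ℝ, 0 ≤ C' ∧ ∀ (f : 𝓑) {ε : Fin d → ℝ} {Q j₀ M H : ℕ} {Λ T δ e₀ : ℝ}
      {v : Fin d → ℝ}, (∀ l, 0 < ε l) → (∀ l, ε l ≤ 1) → (∀ l, e₀ ≤ ε l) → 0 < e₀ →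
      1 ≤ Q → 1 ≤ j₀ → 1 ≤ H → H ^ 2 ≤ Q → 0 ≤ Λ →
      (∀ l, speed ε Q (fun _ => j₀ + M) l ≤ Λ) → 1 ≤ T →
      (∀ l, powPoint ε (fun _ => (j₀ + M) * Q) l ≤ T) →
      0 < δ → δ ≤ 1 → (∀ l, 0 ≤ v l ∧ v l ≤ 1) →
      ‖∑ j : Fin d → Fin M, ∑ r : Fin d → Fin Q,
        (B.ev f (φ (powPoint ε fun l => (j₀ + j l) * Q + r l) x)
        - B.ev f (φ ((powPoint ε fun l => (j₀ + j l) * Q + r l)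
          + v * speed ε Q fun l => j₀ + j l) x))‖
      ≤ (((j₀ : ℝ) + M) ^ d * (Q : ℝ) ^ d) * (C * ‖f‖ * (2 * (2 * d * (H : ℝ) ^ 2 / Q
          + (2 * (H : ℝ) ^ 2 * Λ / j₀) ^ ρ)
        + Real.sqrt ((δ ^ d)⁻¹ * (C' * (μ.real Set.univ * (4 / H
            + 2 * (d * (2 / (e₀ * H) + 2 * (((H : ℝ) ^ 2 + 1) * Λ / j₀) ^ ρ
              + 2 * (j₀ / (j₀ + M))))) * (3 * Λ) ^ d
          + 4 * C * ((1 + ((H : ℝ) ^ 2 + 1) * Λ) ^ K) ^ 2 * (T ^ d * T ^ (-κ) / (Q : ℝ) ^ d)))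
          + 8 * δ ^ ρ))) := by
  obtain ⟨C', hC'0, hblock⟩ := hB.exists_sum_sq_block_le
  refine ⟨C', hC'0, fun f ε Q j₀ M H Λ T δ e₀ v hε hε1 hεe he₀ hQ hj₀ hH hHQ hΛ0 hΛ hT hPT hδ hδ1 hv
    => ?_⟩
  have hC := hB.nonneg
  have hρ := hB.rho_pos
  have hH0 : (0 : ℝ) < H := by exact_mod_cast hH
  have hQ1 : (1 : ℝ) ≤ Q := by exact_mod_cast hQ
  have hj1 : (1 : ℝ) ≤ j₀ := by exact_mod_cast hj₀
  set b := C * ‖f‖ with hb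
  have hb0 : 0 ≤ b := by positivity
  set J := (j₀ : ℝ) + M with hJ
  have hJ0 : 0 < J := by positivity
  have hMJ : (M : ℝ) ≤ J := by linarith
  set jj : (Fin d → Fin M) → Fin d → ℕ := fun j l => j₀ + j l with hjj
  have hjle : ∀ j l, j₀ ≤ jj j l := fun j l => Nat.le_add_right _ _
  have hjlt : ∀ j l, jj j l + 1 ≤ j₀ + M := fun j l => by
    have := (j l).2
    simp only [hjj]; omega
  have hΛj : ∀ j l, speed ε Q (jj j) l ≤ Λ := fun j l => by
    refine le_trans ?_ (hΛ l)
    have h1 : ((jj j l : ℕ) : ℝ) ≤ ((j₀ + M : ℕ) : ℝ) := by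
      exact_mod_cast (Nat.le_succ _).trans (hjlt j l)
    have h2 := (hε l).le
    simp only [speed]
    gcongr
  have hPj : ∀ j l, powPoint ε (fun l => (jj j l + 1) * Q) l ≤ T := fun j l => by
    refine le_trans ?_ (hPT l)
    exact Real.rpow_le_rpow (Nat.cast_nonneg _)
      (by exact_mod_cast Nat.mul_le_mul_right Q (hjlt j l)) (by linarith [hε l])
  set w : (Fin d → Fin M) → X → ℂ := fun j y => ∑ a : Fin H,
    (B.ev f (φ (fun l => (H * a : ℝ) * speed ε Q (jj j) l) y)
      - B.ev f (φ (fun l => (H * a + v l : ℝ) * speed ε Q (jj j) l) y)) with hw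
  set P : (Fin d → Fin M) → (Fin d → Fin Q) → Fin d → ℝ :=
    fun j r => powPoint ε fun l => jj j l * Q + r l with hP
  set e2 := 2 * d * (H : ℝ) ^ 2 / Q + (2 * (H : ℝ) ^ 2 * Λ / j₀) ^ ρ with he2
  set E := 2 / (e₀ * H) + 2 * (((H : ℝ) ^ 2 + 1) * Λ / j₀) ^ ρ + 2 * (j₀ / J) with hE
  have hE0 : 0 ≤ E := by positivity
  set R := (1 + ((H : ℝ) ^ 2 + 1) * Λ) ^ K with hR
  have hT0 : 0 ≤ T ^ d * T ^ (-κ) := by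
    have : 0 ≤ T := by linarith
    positivity
  set Y := (δ ^ d)⁻¹ * (C' * (μ.real Set.univ * (4 / H + 2 * (d * E)) * (3 * Λ) ^ d
          + 4 * C * R ^ 2 * (T ^ d * T ^ (-κ) / (Q : ℝ) ^ d))) + 8 * δ ^ ρ with hY
  have hY0 : 0 ≤ Y := by positivity
  -- the mean squares
  have hI := hB.sum_integral_sq_le hμ f hε hε1 hεe he₀ (c := fun l => (1 + ε l) * (Q : ℝ) ^ ε l)
    (fun l => by have := (hε l).le; positivity) (M := M) hj₀ hΛ0 (fun l => by
      refine le_trans (le_of_eq ?_) (hΛ l)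
      simp only [speed]
      rw [Real.mul_rpow (Nat.cast_nonneg _) (Nat.cast_nonneg _)]
      push_cast; ring) hH (v := v) fun l => by
        rw [abs_of_nonneg (hv l).1]; exact (hv l).2
  have hspeed : ∀ j : Fin d → Fin M, ∀ l, (1 + ε l) * (Q : ℝ) ^ ε l * ((j₀ : ℝ) + (j l : ℕ)) ^ ε l
      = speed ε Q (jj j) l := fun j l => by
    simp only [speed, hjj]
    rw [Real.mul_rpow (Nat.cast_nonneg _) (Nat.cast_nonneg _)]
    push_cast; ring
  simp only [hspeed] at hI
  change ∑ j, ∫ y, ‖w j y‖ ^ 2 ∂μ ≤ _ at hI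
  rw [← hE] at hI
  have hsq : ∑ j, ∑ r, ‖w j (φ (P j r) x)‖ ^ 2 ≤ (J ^ d * (Q : ℝ) ^ d) * ((H * b) ^ 2 * Y) := by
    refine (Finset.sum_le_sum fun j _ => hblock f (H := H) hε hε1 hQ hj₀ (hjle j) hΛ0 (hΛj j) hT
      (hPj j) hδ hδ1 hv).trans ?_
    change ∑ j, ((δ ^ d)⁻¹ * (C' * ((∫ y, ‖w j y‖ ^ 2 ∂μ) * (3 * Q * Λ) ^ d
      + C * (H * (2 * (b * R))) ^ 2 * (T ^ d * T ^ (-κ))))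
      + (Q : ℝ) ^ d * (8 * (H : ℝ) ^ 2 * b ^ 2 * δ ^ ρ)) ≤ _
    rw [Finset.sum_add_distrib, ← Finset.mul_sum, ← Finset.mul_sum, Finset.sum_add_distrib,
      ← Finset.sum_mul, Finset.sum_const, Finset.sum_const, Finset.card_univ, Fintype.card_fun,
      Fintype.card_fin, Fintype.card_fin, nsmul_eq_mul, nsmul_eq_mul]
    have hMd : ((M ^ d : ℕ) : ℝ) ≤ J ^ d := by push_cast; gcongr
    have hQd : 0 < (Q : ℝ) ^ d := by positivity
    obtain ⟨V, hV⟩ : ∃ V, V = C * (H * (2 * (b * R))) ^ 2 * (T ^ d * T ^ (-κ)) := ⟨_, rfl⟩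
    have hV0 : 0 ≤ V := by rw [hV]; positivity
    have hVQ : V ≤ V / (Q : ℝ) ^ d * (Q : ℝ) ^ d := (div_mul_cancel₀ V hQd.ne').ge
    rw [← hV]
    calc _ ≤ (δ ^ d)⁻¹ * (C' * ((J ^ d * (b ^ 2 * μ.real Set.univ * (4 * H + 2 * (H : ℝ) ^ 2 *
          (d * E)))) * (3 * Q * Λ) ^ d + J ^ d * (V / (Q : ℝ) ^ d * (Q : ℝ) ^ d)))
          + J ^ d * ((Q : ℝ) ^ d * (8 * (H : ℝ) ^ 2 * b ^ 2 * δ ^ ρ)) := by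
          gcongr
      _ = _ := by
          rw [hY, hV, mul_pow, mul_pow, mul_pow]
          field_simp
          ring
  -- Cauchy–Schwarz over all points of all blocks
  have hCS : ‖∑ j, ∑ r, w j (φ (P j r) x)‖ ≤ (J ^ d * (Q : ℝ) ^ d) * (H * b * Real.sqrt Y) := by
    have h1 : ‖∑ j, ∑ r, w j (φ (P j r) x)‖ ≤ ∑ p : (Fin d → Fin M) × (Fin d → Fin Q),
        ‖w p.1 (φ (P p.1 p.2) x)‖ := by
      rw [← Fintype.sum_prod_type']
      exact norm_sum_le _ _
    have h2 := sq_sum_le_card_mul_sum_sq (s := Finset.univ)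
      (f := fun p : (Fin d → Fin M) × (Fin d → Fin Q) => ‖w p.1 (φ (P p.1 p.2) x)‖)
    rw [Fintype.sum_prod_type (f := fun p : (Fin d → Fin M) × (Fin d → Fin Q) =>
      ‖w p.1 (φ (P p.1 p.2) x)‖ ^ 2)] at h2
    refine h1.trans (le_of_sq_le_sq (h2.trans ?_) (by positivity))
    have hcard : ((Finset.univ : Finset ((Fin d → Fin M) × (Fin d → Fin Q))).card : ℝ)
        ≤ J ^ d * (Q : ℝ) ^ d := by
      rw [Finset.card_univ, Fintype.card_prod, Fintype.card_fun, Fintype.card_fun,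
        Fintype.card_fin, Fintype.card_fin, Fintype.card_fin]
      push_cast
      gcongr
    calc _ ≤ (J ^ d * (Q : ℝ) ^ d) * ((J ^ d * (Q : ℝ) ^ d) * ((H * b) ^ 2 * Y)) := by gcongr
      _ = _ := by
        rw [mul_pow _ (H * b * Real.sqrt Y), mul_pow _ (Real.sqrt Y), Real.sq_sqrt hY0]; ring
  have hav : ‖(H : ℂ) * (∑ j, ∑ r, (B.ev f (φ (P j r) x)
      - B.ev f (φ (P j r + v * speed ε Q (jj j)) x))) - ∑ j, ∑ r, w j (φ (P j r) x)‖
      ≤ (J ^ d * (Q : ℝ) ^ d) * (H * (2 * b * e2)) := by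
    rw [Finset.mul_sum, ← Finset.sum_sub_distrib]
    refine (norm_sum_le_of_le _ fun j _ => hB.norm_block_average_sub_le f v hε hε1 hQ hj₀ (hjle j)
      hΛ0 (hΛj j) hHQ).trans ?_
    rw [Finset.sum_const, Finset.card_univ, Fintype.card_fun, Fintype.card_fin, Fintype.card_fin,
      nsmul_eq_mul]
    push_cast
    calc (M : ℝ) ^ d * (H * ((Q : ℝ) ^ d * (2 * b * e2)))
        ≤ J ^ d * (H * ((Q : ℝ) ^ d * (2 * b * e2))) := by gcongr
      _ = _ := by ring
  have hfin := norm_le_norm_add_norm_sub' ((H : ℂ) * (∑ j, ∑ r, (B.ev f (φ (P j r) x)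
      - B.ev f (φ (P j r + v * speed ε Q (jj j)) x)))) (∑ j, ∑ r, w j (φ (P j r) x))
  rw [norm_mul, Complex.norm_natCast] at hfin
  refine le_of_mul_le_mul_left (hfin.trans ((add_le_add hCS hav).trans (le_of_eq ?_))) hH0
  ring

/-- The sum of `f` over the blocks of the sequence: averaging over all `v` in the unit cube turns
the translates of `f` into integrals over boxes. -/
theorem FlowBounds.exists_norm_sum_blocks_le [BorelSpace X] [IsFiniteMeasure μ]
    (hμ : ∀ t : Fin d → ℝ, MeasurePreserving (φ t) μ μ) (hB : FlowBounds φ μ B x C ρ K κ) :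
    ∃ C' : ℝ, 0 ≤ C' ∧ ∀ (f : 𝓑) {ε : Fin d → ℝ} {Q j₀ M H : ℕ} {Λ T δ e₀ : ℝ},
      InL20 μ (B.ev f) → (∀ l, 0 < ε l) → (∀ l, ε l ≤ 1) → (∀ l, e₀ ≤ ε l) → 0 < e₀ →
      1 ≤ Q → 1 ≤ j₀ → 1 ≤ H → H ^ 2 ≤ Q → 0 ≤ Λ →
      (∀ l, speed ε Q (fun _ => j₀ + M) l ≤ Λ) → 1 ≤ T →
      (∀ l, powPoint ε (fun _ => (j₀ + M) * Q) l ≤ T) →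
      0 < δ → δ ≤ 1 →
      ‖∑ j : Fin d → Fin M, ∑ r : Fin d → Fin Q,
        B.ev f (φ (powPoint ε fun l => (j₀ + j l) * Q + r l) x)‖
      ≤ (((j₀ : ℝ) + M) ^ d * (Q : ℝ) ^ d) * (C * ‖f‖ * (2 * (2 * d * (H : ℝ) ^ 2 / Q
          + (2 * (H : ℝ) ^ 2 * Λ / j₀) ^ ρ)
        + Real.sqrt ((δ ^ d)⁻¹ * (C' * (μ.real Set.univ * (4 / H
            + 2 * (d * (2 / (e₀ * H) + 2 * (((H : ℝ) ^ 2 + 1) * Λ / j₀) ^ ρ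
              + 2 * (j₀ / (j₀ + M))))) * (3 * Λ) ^ d
          + 4 * C * ((1 + ((H : ℝ) ^ 2 + 1) * Λ) ^ K) ^ 2 * (T ^ d * T ^ (-κ) / (Q : ℝ) ^ d)))
          + 8 * δ ^ ρ) + 2 / j₀ * 4 ^ d))
        + ((j₀ : ℝ) + M) ^ d * (C * ‖f‖ * (T ^ d * T ^ (-κ))) := by
  obtain ⟨C', hC'0, hdiff⟩ := hB.exists_norm_sum_translate_sub_le hμ
  refine ⟨C', hC'0, fun f ε Q j₀ M H Λ T δ e₀ hf hε hε1 hεe he₀ hQ hj₀ hH hHQ hΛ0 hΛ hT hPT hδ hδ1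
    => ?_⟩
  have hC := hB.nonneg
  have hT0 : 0 ≤ T := by linarith
  set J := (j₀ : ℝ) + M with hJ
  have hMJ : (M : ℝ) ≤ J := by rw [hJ]; linarith [Nat.cast_nonneg (α := ℝ) j₀]
  set jj : (Fin d → Fin M) → Fin d → ℕ := fun j l => j₀ + j l with hjj
  set P : (Fin d → Fin M) → (Fin d → Fin Q) → Fin d → ℝ :=
    fun j r => powPoint ε fun l => jj j l * Q + r l with hP
  set F : (Fin d → ℝ) → ℂ := fun t => B.ev f (φ t x) with hF
  have hFc : Continuous F := hB.continuous_orbit f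
  have hFb : ∀ t, ‖F t‖ ≤ C * ‖f‖ := fun t => hB.bound f _
  set D : (Fin d → ℝ) → ℂ := fun v => ∑ j, ∑ r, (F (P j r) - F (P j r + v * speed ε Q (jj j)))
    with hD
  have hvol1 : volume.real (box (0 : Fin d → ℝ) 1) = 1 := by
    rw [measureReal_box (a := 0) (b := 1) fun l => by simp]; simp
  have hcont : ∀ j r, Continuous fun v : Fin d → ℝ => F (P j r + v * speed ε Q (jj j)) :=
    fun j r => hFc.comp (continuous_const.add (continuous_id.mul continuous_const))
  set S := ∑ j, ∑ r, F (P j r) with hS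
  -- the points of the sequence against their translates, integrated over `v`
  have hsplit : S = (∫ v in box 0 1, D v)
      + ∑ j, ∑ r, ∫ v in box 0 1, F (P j r + v * speed ε Q (jj j)) := by
    have hi : ∀ j r, IntegrableOn (fun v : Fin d → ℝ => F (P j r + v * speed ε Q (jj j)))
        (box 0 1) := fun j r => integrableOn_box (hcont j r) _ _
    have hDe : ∀ v, D v = S - ∑ j, ∑ r, F (P j r + v * speed ε Q (jj j)) := fun v => by
      simp only [hD, hS, Finset.sum_sub_distrib]
    simp only [hDe]
    have hconst : Integrable (fun _ => S) (volume.restrict (box (0 : Fin d → ℝ) 1)) :=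
      integrableOn_const (measure_box_lt_top _ _).ne
    rw [integral_sub hconst (integrable_finsetSum _ fun j _ => integrable_finsetSum _ fun r _ => hi j r),
      integral_finsetSum _ fun j _ => integrable_finsetSum _ fun r _ => hi j r,
      setIntegral_const, hvol1, one_smul]
    have : ∀ j, ∫ v in box 0 1, ∑ r, F (P j r + v * speed ε Q (jj j))
        = ∑ r, ∫ v in box 0 1, F (P j r + v * speed ε Q (jj j)) := fun j =>
      integral_finsetSum _ fun r _ => hi j r
    simp only [this]
    ring
  have h1 : ‖∫ v in box 0 1, D v‖ ≤ _ := norm_setIntegral_le_of_norm_le_const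
    (measure_box_lt_top 0 1) fun v hv => hdiff f (v := v) hε hε1 hεe he₀ hQ hj₀ hH hHQ hΛ0 hΛ hT hPT hδ
      hδ1 fun l => ⟨(hv l trivial).1, (hv l trivial).2.le⟩
  rw [hvol1, mul_one] at h1
  have h2 : ‖∑ j, ∑ r, ∫ v in box 0 1, F (P j r + v * speed ε Q (jj j))‖
      ≤ J ^ d * (C * ‖f‖ * (T ^ d * T ^ (-κ)) + (Q : ℝ) ^ d * (C * ‖f‖ * (2 / j₀ * 4 ^ d))) := by
    refine (norm_sum_le_of_le (n := fun _ => C * ‖f‖ * (T ^ d * T ^ (-κ))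
      + (Q : ℝ) ^ d * (C * ‖f‖ * (2 / j₀ * 4 ^ d))) _ fun j _ => ?_).trans ?_
    · refine (norm_sum_block_integral_le hFc hFb hε hε1 hQ hj₀ fun l => Nat.le_add_right _ _).trans
        (add_le_add_left ?_ _)
      have htw := hB.twisted f hf T hT (powPoint ε fun l => jj j l * Q)
        (powPoint ε fun l => (jj j l + 1) * Q) 0 (fun l => by
          have : 0 ≤ powPoint ε (fun l => jj j l * Q) l := by simp only [powPoint]; positivity
          linarith) (fun l => Real.rpow_le_rpow (Nat.cast_nonneg _)
            (by exact_mod_cast Nat.mul_le_mul_right Q (Nat.le_succ _)) (by linarith [hε l]))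
        fun l => le_trans (Real.rpow_le_rpow (Nat.cast_nonneg _) (by
          have : jj j l + 1 ≤ j₀ + M := by
            have := (j l).2
            simp only [hjj]; omega
          exact_mod_cast Nat.mul_le_mul_right Q this) (by linarith [hε l])) (hPT l)
      simpa only [tw_zero, mul_one] using htw
    · rw [Finset.sum_const, Finset.card_univ, Fintype.card_fun, Fintype.card_fin, Fintype.card_fin,
        nsmul_eq_mul]
      push_cast
      gcongr
  change ‖S‖ ≤ _
  rw [hsplit]
  refine (norm_add_le _ _).trans ((add_le_add h1 h2).trans (le_of_eq ?_))
  ring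

end Bounds

section Bounds

variable {d : ℕ} {X 𝓑 : Type*} [MetricSpace X] [MeasurableSpace X] [NormedAddCommGroup 𝓑]
  [NormedSpace ℂ 𝓑]
variable {φ : Flow (Fin d → ℝ) X} {μ : Measure X} {B : FunctionAlgebra X 𝓑} {x : X}
  {C ρ : ℝ} {K : ℕ} {κ : ℝ}

/-! ### The rate along `n ^ (1 + ε)` -/

/-- The blocks `j ∈ [m ^ c, m ^ (2 c))^d` of side `N / m ^ (2 c)` fill the cube `[0, N)^d` up to a
proportion of order `1 / m`. -/
theorem FlowBounds.norm_sum_powers_sub_blocks_le (hB : FlowBounds φ μ B x C ρ K κ) (f : 𝓑)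
    (ε : Fin d → ℝ) {m c N : ℕ} (hm : 1 ≤ m) (hc : 1 ≤ c) (hmN : m ^ (2 * c + 1) ≤ N) :
    ‖∑ n : Fin d → Fin N, B.ev f (φ (powPoint ε fun l => n l) x)
      - ∑ j : Fin d → Fin (m ^ (2 * c) - m ^ c), ∑ r : Fin d → Fin (N / m ^ (2 * c)),
        B.ev f (φ (powPoint ε fun l => (m ^ c + j l) * (N / m ^ (2 * c)) + r l) x)‖
      ≤ C * ‖f‖ * ((N : ℝ) ^ d * (d * (2 * (m : ℝ)⁻¹))) := by
  have hC := hB.nonneg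
  set J := m ^ (2 * c) with hJ
  set Q := N / J with hQ
  have hm0 : (0 : ℝ) < m := by exact_mod_cast hm
  have hm1 : (1 : ℝ) ≤ m := by exact_mod_cast hm
  have hJ0 : 0 < J := Nat.pow_pos hm
  have hjJ : m ^ c ≤ J := Nat.pow_le_pow_right hm (by omega)
  have hJQ : J * Q ≤ N := Nat.mul_div_le N J
  have hle : (J - m ^ c) * Q + m ^ c * Q ≤ N := by
    rw [← Nat.add_mul, Nat.sub_add_cancel hjJ]; exact hJQ
  have h1 := norm_sum_cube_sub_le (d := d) hle (fun n => B.ev f (φ (powPoint ε n) x))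
    fun n => hB.bound f _
  rw [sum_cube_mul (J - m ^ c) Q fun n => B.ev f (φ (powPoint ε fun l => n l + m ^ c * Q) x)] at h1
  have e : ∀ (j : Fin d → Fin (J - m ^ c)) (r : Fin d → Fin Q),
      (fun l => ((r l : ℕ) + Q * j l) + m ^ c * Q) = fun l => (m ^ c + j l) * Q + r l :=
    fun j r => by ext l; ring
  simp only [e] at h1
  refine h1.trans ?_
  have hmN' : (m : ℝ) ^ (2 * c + 1) ≤ N := by exact_mod_cast hmN
  have hN0 : (0 : ℝ) < N := lt_of_lt_of_le (by positivity) hmN'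
  gcongr
  rw [div_le_iff₀ hN0]
  have hQN : (N : ℝ) ≤ J * Q + J := by
    have : N < J * Q + J := by
      have h2 := Nat.div_add_mod N J
      have h3 := Nat.mod_lt N hJ0
      rw [hQ]; omega
    exact_mod_cast this.le
  have hJQR : (J : ℝ) * Q ≤ N := by exact_mod_cast hJQ
  have hcast : (((J - m ^ c) * Q : ℕ) : ℝ) = J * Q - (m : ℝ) ^ c * Q := by
    rw [Nat.cast_mul, Nat.cast_sub hjJ, sub_mul]; push_cast; ring
  rw [hcast]
  have hJR : (J : ℝ) = (m : ℝ) ^ (2 * c) := by rw [hJ]; push_cast; ring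
  have h4 : (J : ℝ) ≤ (m : ℝ)⁻¹ * N := by
    rw [hJR, le_inv_mul_iff₀ hm0, ← pow_succ']; exact hmN'
  have h5 : (m : ℝ) ^ c * Q ≤ (m : ℝ)⁻¹ * N := by
    rw [le_inv_mul_iff₀ hm0]
    refine le_trans ?_ hJQR
    rw [← mul_assoc, ← pow_succ', hJR]
    exact mul_le_mul_of_nonneg_right (pow_le_pow_right₀ hm1 (by omega)) (Nat.cast_nonneg _)
  linarith

set_option maxHeartbeats 1600000 in
/-- The rate of decay along `n ^ (1 + ε)`: with `m` of order `N ^ (1 / A)` and `0 < ε < 1 / A`, the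
bound of `FlowBounds.exists_norm_sum_blocks_le` is a negative power of `m`. -/
theorem FlowBounds.polyRatesAlongPowers [BorelSpace X] [IsFiniteMeasure μ]
    (hμ : ∀ t : Fin d → ℝ, MeasurePreserving (φ t) μ μ) (hB : FlowBounds φ μ B x C ρ K κ) :
    PolyRatesAlongPowers φ μ B x := by
  obtain ⟨C', hC'0, hblocks⟩ := hB.exists_norm_sum_blocks_le hμ
  have hC := hB.nonneg
  have hρ := hB.rho_pos
  have hρ1 := hB.rho_le
  have hκ := hB.kappa_pos
  -- All parameters are powers of `m ≈ N ^ (1 / A)`: `H = m ^ b` shifts, blocks `j` from `m ^ c` to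
  -- `m ^ (2 c)`, boxes of side `δ = 1 / m`. The speeds are at most `4 m`. The factor `1 / H` has to
  -- beat `δ ^ (-d) (4 m) ^ d`, whence `b = 2 d + 1`; the Hölder errors `(H ^ 2 m / m ^ c) ^ ρ` have to
  -- be at most `1 / H`, whence `c₁ ρ ≥ b`; and `T ^ (-κ)` has to beat `δ ^ (-d)`, the norms of
  -- the shifts and `(T / Q) ^ d` with a factor `m` to spare, in total `m ^ D`, whence `A κ ≥ D`.
  set b := 2 * d + 1 with hb
  obtain ⟨c₁, hc₁⟩ := exists_nat_ge ((b : ℝ) / ρ)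
  set c := 2 * b + 1 + c₁ with hc
  set D := (d + 2 * K * (2 * b + 1) + 1) + d * (2 * c + 1) with hD
  obtain ⟨a₁, ha₁⟩ := exists_nat_ge ((D : ℝ) / κ)
  set A := 2 * b + 1 + 2 * c + a₁ with hA
  have hA0 : A ≠ 0 := by omega
  have hA1 : (1 : ℝ) ≤ A := by exact_mod_cast Nat.one_le_iff_ne_zero.2 hA0
  have hbρ : (b : ℝ) ≤ c₁ * ρ := (div_le_iff₀ hρ).1 hc₁
  have hDκ : (D : ℝ) ≤ A * κ := by
    have h1 := (div_le_iff₀ hκ).1 ha₁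
    have h2 : (a₁ : ℝ) ≤ A := by exact_mod_cast (by omega : a₁ ≤ A)
    nlinarith
  refine ⟨1 / A, by positivity, fun ε hε => ?_⟩
  have hε0 : ∀ l, 0 < ε l := fun l => (hε l).1
  have hε1 : ∀ l, ε l ≤ 1 := fun l => (hε l).2.le.trans ((div_le_one (by linarith)).2 hA1)
  obtain ⟨e₀, he₀, hεe⟩ : ∃ e₀ : ℝ, 0 < e₀ ∧ ∀ l, e₀ ≤ ε l := by
    rcases isEmpty_or_nonempty (Fin d) with h | h
    · exact ⟨1, one_pos, fun l => h.elim l⟩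
    · obtain ⟨l₀, hl₀⟩ := Finite.exists_min ε
      exact ⟨ε l₀, hε0 l₀, hl₀⟩
  set μ₀ := μ.real Set.univ with hμ₀
  have hμ₀0 : 0 ≤ μ₀ := measureReal_nonneg
  set k₁ := C' * (μ₀ * (4 + 2 * (d * (2 / e₀ + 18))) * 12 ^ d) with hk₁
  set k₂ := C' * (4 * C * 81 ^ K * 4 ^ d) with hk₂
  have hk₁0 : 0 ≤ k₁ := by positivity
  have hk₂0 : 0 ≤ k₂ := by positivity
  set k := 2 * d + (2 * (2 * d + 8) + Real.sqrt (k₁ + k₂ + 8) + 2 * 4 ^ d) + 4 ^ d with hk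
  have hk0 : 0 ≤ k := by positivity
  refine ⟨ρ / 2 / A, by positivity, C * k * 2 ^ (ρ / 2), fun f hf N hN => ?_⟩
  obtain ⟨m, hm, hmA, hNm⟩ := exists_nat_root hA0 hN
  have hN0 : (0 : ℝ) < N := by exact_mod_cast hN
  have hN1 : (1 : ℝ) ≤ N := by exact_mod_cast hN
  have hm1 : (1 : ℝ) ≤ m := by exact_mod_cast hm
  have hm0 : (0 : ℝ) < m := by linarith
  have hmpow : ∀ i, i ≤ A → m ^ i ≤ N := fun i hi => (Nat.pow_le_pow_right hm hi).trans hmA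
  have hinv : (m : ℝ)⁻¹ ≤ (m : ℝ) ^ (-ρ) := by
    rw [← Real.rpow_neg_one]
    exact Real.rpow_le_rpow_of_exponent_le hm1 (by linarith)
  have hhalf : (m : ℝ) ^ (-ρ) ≤ (m : ℝ) ^ (-(ρ / 2)) :=
    Real.rpow_le_rpow_of_exponent_le hm1 (by linarith)
  set σ := (m : ℝ) ^ (-(ρ / 2)) with hσ
  have hσ0 : 0 < σ := Real.rpow_pos_of_pos hm0 _
  have hinvσ : (m : ℝ)⁻¹ ≤ σ := hinv.trans hhalf
  set J := m ^ (2 * c) with hJ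
  set Q := N / J with hQ
  have hJ0 : 0 < J := Nat.pow_pos hm
  have hQm : m ^ (2 * b + 1) ≤ Q := by
    rw [hQ, Nat.le_div_iff_mul_le hJ0, hJ, ← pow_add]
    exact hmpow _ (by omega)
  have hQ1 : 1 ≤ Q := (Nat.one_le_pow _ _ hm).trans hQm
  have hQmR : (m : ℝ) ^ (2 * b + 1) ≤ Q := by exact_mod_cast hQm
  have hQ0 : (0 : ℝ) < Q := by exact_mod_cast hQ1
  have hJQ : J * Q ≤ N := Nat.mul_div_le N J
  have hJQR : (J : ℝ) * Q ≤ N := by exact_mod_cast hJQ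
  have hJR : (J : ℝ) = (m : ℝ) ^ (2 * c) := by rw [hJ]; push_cast; ring
  have hjJ : m ^ c ≤ J := Nat.pow_le_pow_right hm (by omega)
  have hsumJ : m ^ c + (J - m ^ c) = J := Nat.add_sub_cancel' hjJ
  have hsumJR : ((m ^ c : ℕ) : ℝ) + ((J - m ^ c : ℕ) : ℝ) = (m : ℝ) ^ (2 * c) := by
    rw [← hJR, ← Nat.cast_add, hsumJ]
  have hNε : ∀ l, (N : ℝ) ^ ε l ≤ 2 * m := fun l => by
    calc (N : ℝ) ^ ε l ≤ (N : ℝ) ^ (1 / A : ℝ) :=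
          Real.rpow_le_rpow_of_exponent_le hN1 (hε l).2.le
      _ ≤ ((2 * m : ℝ) ^ A) ^ (1 / A : ℝ) := Real.rpow_le_rpow hN0.le hNm (by positivity)
      _ = 2 * m := by
          rw [← Real.rpow_natCast, ← Real.rpow_mul (by positivity), mul_one_div_cancel (by positivity),
            Real.rpow_one]
  -- the points `n ^ (1 + ε)`, `n ≤ N`, lie in `[0, T]`, as `N ^ ε ≤ 2 m`
  set T : ℝ := 2 * m * N with hT
  have hTN : (N : ℝ) ≤ T := le_mul_of_one_le_left hN0.le (by linarith)
  have hT1 : 1 ≤ T := hN1.trans hTN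
  have hmain := hblocks f (Q := Q) (j₀ := m ^ c) (M := J - m ^ c) (H := m ^ b) (Λ := 4 * m) (T := T)
    (δ := (m : ℝ)⁻¹) hf hε0 hε1 hεe he₀ hQ1 (Nat.one_le_pow _ _ hm) (Nat.one_le_pow _ _ hm)
    (by
      rw [← pow_mul]
      exact (Nat.pow_le_pow_right hm (by omega)).trans hQm)
    (by positivity)
    (fun l => by
      simp only [speed, hsumJ]
      have h1 : ((J : ℝ) * Q) ^ ε l ≤ 2 * m :=
        (Real.rpow_le_rpow (by positivity) hJQR (hε0 l).le).trans (hNε l)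
      have h2 : 0 ≤ ((J : ℝ) * Q) ^ ε l := by positivity
      nlinarith [hε1 l, hε0 l])
    hT1
    (fun l => by
      simp only [powPoint, hsumJ]
      calc ((J * Q : ℕ) : ℝ) ^ (1 + ε l) ≤ (N : ℝ) ^ (1 + ε l) :=
            Real.rpow_le_rpow (Nat.cast_nonneg _) (by exact_mod_cast hJQ) (by linarith [hε0 l])
        _ = N * (N : ℝ) ^ ε l := by rw [Real.rpow_add hN0, Real.rpow_one]
        _ ≤ N * (2 * m) := by gcongr; exact hNε l
        _ = T := by rw [hT]; ring)
    (by positivity) (inv_le_one_of_one_le₀ hm1)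
  rw [hsumJR] at hmain
  push_cast at hmain
  -- each ingredient of the bound is at most a constant times a negative power of `m`
  have hmb : (m : ℝ) ≤ (m : ℝ) ^ b := le_self_pow₀ hm1 (by omega)
  have hmbinv : ((m : ℝ) ^ b)⁻¹ ≤ (m : ℝ)⁻¹ := inv_anti₀ hm0 hmb
  have hsq1 : (1 : ℝ) ≤ ((m : ℝ) ^ b) ^ 2 := one_le_pow₀ (one_le_pow₀ hm1)
  have hpow2 : ((m : ℝ) ^ b) ^ 2 * m = (m : ℝ) ^ (2 * b + 1) := by
    rw [← pow_mul, ← pow_succ, mul_comm b 2]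
  have hmsq : (m : ℝ) ≤ ((m : ℝ) ^ b) ^ 2 * m := le_mul_of_one_le_left hm0.le hsq1
  have h1 : 2 * d * ((m : ℝ) ^ b) ^ 2 / Q ≤ 2 * d * (m : ℝ)⁻¹ := by
    rw [mul_div_assoc]
    gcongr
    rw [div_le_iff₀ hQ0, le_inv_mul_iff₀ hm0, mul_comm, hpow2]
    exact hQmR
  have hρbound : (8 * (m : ℝ) ^ (2 * b + 1) / (m : ℝ) ^ c) ^ ρ ≤ 8 * ((m : ℝ) ^ b)⁻¹ := by
    have e : 8 * (m : ℝ) ^ (2 * b + 1) / (m : ℝ) ^ c = 8 / (m : ℝ) ^ c₁ := by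
      rw [hc, pow_add (m : ℝ) (2 * b + 1)]; field_simp
    rw [e, Real.div_rpow (by norm_num) (by positivity), div_eq_mul_inv]
    gcongr
    · exact (Real.rpow_le_rpow_of_exponent_le (by norm_num) hρ1).trans_eq (Real.rpow_one _)
    · rw [← Real.rpow_natCast _ c₁, ← Real.rpow_mul hm0.le, ← Real.rpow_natCast]
      exact Real.rpow_le_rpow_of_exponent_le hm1 hbρ
  have h2 : (2 * ((m : ℝ) ^ b) ^ 2 * (4 * m) / (m : ℝ) ^ c) ^ ρ ≤ 8 * ((m : ℝ) ^ b)⁻¹ := by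
    refine le_trans (le_of_eq ?_) hρbound
    rw [← hpow2]; ring_nf
  have h3 : ((((m : ℝ) ^ b) ^ 2 + 1) * (4 * m) / (m : ℝ) ^ c) ^ ρ ≤ 8 * ((m : ℝ) ^ b)⁻¹ := by
    refine le_trans ?_ hρbound
    rw [← hpow2]
    refine Real.rpow_le_rpow (by positivity) (div_le_div_of_nonneg_right ?_ (by positivity)) hρ.le
    linarith
  have h4 : (m : ℝ) ^ c / (m : ℝ) ^ (2 * c) ≤ ((m : ℝ) ^ b)⁻¹ := by
    have e : (m : ℝ) ^ c / (m : ℝ) ^ (2 * c) = ((m : ℝ) ^ c)⁻¹ := by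
      rw [two_mul, pow_add (m : ℝ) c c, div_mul_cancel_left₀ (by positivity)]
    rw [e]
    exact inv_anti₀ (by positivity) (pow_le_pow_right₀ hm1 (by omega))
  have hE : 2 / (e₀ * (m : ℝ) ^ b) + 2 * ((((m : ℝ) ^ b) ^ 2 + 1) * (4 * m) / (m : ℝ) ^ c) ^ ρ
      + 2 * ((m : ℝ) ^ c / (m : ℝ) ^ (2 * c)) ≤ (2 / e₀ + 18) * ((m : ℝ) ^ b)⁻¹ := by
    have e : 2 / (e₀ * (m : ℝ) ^ b) = 2 / e₀ * ((m : ℝ) ^ b)⁻¹ := by field_simp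
    rw [e]; linarith
  have hTκ : T ^ (-κ) ≤ ((m : ℝ) ^ D)⁻¹ := by
    calc T ^ (-κ) ≤ ((m : ℝ) ^ A) ^ (-κ) := by
          refine Real.rpow_le_rpow_of_nonpos (by positivity) (le_trans ?_ hTN) (by linarith)
          exact_mod_cast hmA
      _ ≤ ((m : ℝ) ^ D)⁻¹ := by
          rw [← Real.rpow_natCast, ← Real.rpow_mul hm0.le, ← Real.rpow_natCast, ← Real.rpow_neg hm0.le]
          exact Real.rpow_le_rpow_of_exponent_le hm1 (by linarith)
  have hTQ : T ≤ Q * (4 * (m : ℝ) ^ (2 * c + 1)) := by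
    have hNQ : (N : ℝ) ≤ 2 * (J * Q) := by
      have h : N < J * Q + J := by
        have h2 := Nat.div_add_mod N J
        have h3 := Nat.mod_lt N hJ0
        rw [hQ]; omega
      have h' : J ≤ J * Q := Nat.le_mul_of_pos_right J hQ1
      exact_mod_cast (by omega : N ≤ 2 * (J * Q))
    rw [hJR] at hNQ
    calc T ≤ 2 * m * (2 * ((m : ℝ) ^ (2 * c) * Q)) := by rw [hT]; gcongr
      _ = _ := by ring
  have h6 : T ^ d * T ^ (-κ) ≤ (Q : ℝ) ^ d * (4 ^ d * ((m : ℝ) ^ (d + 2 * K * (2 * b + 1) + 1))⁻¹) := by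
    calc T ^ d * T ^ (-κ) ≤ (Q * (4 * (m : ℝ) ^ (2 * c + 1))) ^ d * ((m : ℝ) ^ D)⁻¹ := by gcongr
      _ = _ := by
        rw [hD, pow_add (m : ℝ) _ (d * (2 * c + 1)), mul_pow, mul_pow, ← pow_mul,
          mul_comm (2 * c + 1) d]
        field_simp
  have h6' : T ^ d * T ^ (-κ) / (Q : ℝ) ^ d ≤ 4 ^ d * ((m : ℝ) ^ (d + 2 * K * (2 * b + 1) + 1))⁻¹ := by
    rw [div_le_iff₀' (by positivity)]; exact h6
  have h7 : ((1 + (((m : ℝ) ^ b) ^ 2 + 1) * (4 * m)) ^ K) ^ 2 ≤ 81 ^ K * (m : ℝ) ^ (2 * K * (2 * b + 1)) := by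
    have e : 1 + (((m : ℝ) ^ b) ^ 2 + 1) * (4 * m) ≤ 9 * (m : ℝ) ^ (2 * b + 1) := by
      rw [← hpow2]
      linarith
    calc _ ≤ ((9 * (m : ℝ) ^ (2 * b + 1)) ^ K) ^ 2 := by gcongr
      _ = _ := by
        rw [← pow_mul, mul_pow, ← pow_mul, mul_comm K 2, pow_mul (9 : ℝ) 2 K]
        norm_num
        congr 1; ring
  have hY : (((m : ℝ)⁻¹) ^ d)⁻¹ * (C' * (μ₀ * (4 / (m : ℝ) ^ b + 2 * (d *
        (2 / (e₀ * (m : ℝ) ^ b) + 2 * ((((m : ℝ) ^ b) ^ 2 + 1) * (4 * m) / (m : ℝ) ^ c) ^ ρ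
          + 2 * ((m : ℝ) ^ c / (m : ℝ) ^ (2 * c))))) * (3 * (4 * m)) ^ d
        + 4 * C * ((1 + (((m : ℝ) ^ b) ^ 2 + 1) * (4 * m)) ^ K) ^ 2
          * (T ^ d * T ^ (-κ) / (Q : ℝ) ^ d))) + 8 * ((m : ℝ)⁻¹) ^ ρ
      ≤ (k₁ + k₂ + 8) * (m : ℝ) ^ (-ρ) := by
    calc _ ≤ (((m : ℝ)⁻¹) ^ d)⁻¹ * (C' * (μ₀ * (4 / (m : ℝ) ^ b + 2 * (d *
        ((2 / e₀ + 18) * ((m : ℝ) ^ b)⁻¹))) * (3 * (4 * m)) ^ d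
        + 4 * C * (81 ^ K * (m : ℝ) ^ (2 * K * (2 * b + 1)))
          * (4 ^ d * ((m : ℝ) ^ (d + 2 * K * (2 * b + 1) + 1))⁻¹))) + 8 * ((m : ℝ)⁻¹) ^ ρ := by gcongr
      _ = (k₁ + k₂) * (m : ℝ)⁻¹ + 8 * (m : ℝ) ^ (-ρ) := by
          have e1 : (m : ℝ) ^ b = (m : ℝ) ^ d * (m : ℝ) ^ d * m := by rw [hb]; ring
          have e2 : (m : ℝ) ^ (d + 2 * K * (2 * b + 1) + 1)
              = (m : ℝ) ^ d * (m : ℝ) ^ (2 * K * (2 * b + 1)) * m := by ring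
          have e3 : (3 * (4 * (m : ℝ))) ^ d = 12 ^ d * (m : ℝ) ^ d := by rw [← mul_pow]; ring
          rw [Real.inv_rpow hm0.le, ← Real.rpow_neg hm0.le, e1, e2, e3, hk₁, hk₂, inv_pow, inv_inv]
          congr 1
          field_simp
      _ ≤ (k₁ + k₂) * (m : ℝ) ^ (-ρ) + 8 * (m : ℝ) ^ (-ρ) := by gcongr
      _ = _ := by ring
  have hsqrt : Real.sqrt ((k₁ + k₂ + 8) * (m : ℝ) ^ (-ρ)) = Real.sqrt (k₁ + k₂ + 8) * σ := by
    rw [Real.sqrt_mul (by positivity), hσ, Real.sqrt_eq_rpow ((m : ℝ) ^ (-ρ)), ← Real.rpow_mul hm0.le]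
    congr 2; ring
  have h8 : (2 : ℝ) / (m : ℝ) ^ c * 4 ^ d ≤ 2 * 4 ^ d * σ := by
    have : ((m : ℝ) ^ c)⁻¹ ≤ σ :=
      (inv_anti₀ hm0 (le_self_pow₀ hm1 (by omega))).trans hinvσ
    calc (2 : ℝ) / (m : ℝ) ^ c * 4 ^ d = 2 * 4 ^ d * ((m : ℝ) ^ c)⁻¹ := by ring
      _ ≤ _ := by gcongr
  have h9 : T ^ d * T ^ (-κ) ≤ (Q : ℝ) ^ d * (4 ^ d * σ) := by
    refine h6.trans ?_
    gcongr
    exact (inv_anti₀ hm0 (le_self_pow₀ hm1 (by omega))).trans hinvσ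
  have h10 : 2 * (2 * d * ((m : ℝ) ^ b) ^ 2 / Q + (2 * ((m : ℝ) ^ b) ^ 2 * (4 * m) / (m : ℝ) ^ c) ^ ρ)
      ≤ 2 * (2 * d + 8) * σ := by
    have : (2 * d : ℝ) * (m : ℝ)⁻¹ ≤ 2 * d * σ := by gcongr
    linarith
  have hJQd : ((m : ℝ) ^ (2 * c)) ^ d * (Q : ℝ) ^ d ≤ (N : ℝ) ^ d := by
    rw [← mul_pow, ← hJR]; gcongr
  have hdrop := hB.norm_sum_powers_sub_blocks_le f ε hm (c := c) (by omega) (hmpow (2 * c + 1) (by omega))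
  have hblk := hmain.trans (b := _) (c := (N : ℝ) ^ d * (C * ‖f‖ * ((2 * (2 * d + 8)
      + Real.sqrt (k₁ + k₂ + 8) + 2 * 4 ^ d) * σ)) + (N : ℝ) ^ d * (C * ‖f‖ * (4 ^ d * σ))) (by
    refine add_le_add ?_ ?_
    · refine mul_le_mul hJQd ?_ (by positivity) (by positivity)
      refine mul_le_mul_of_nonneg_left ?_ (by positivity)
      have := (Real.sqrt_le_sqrt hY).trans_eq hsqrt
      exact (add_le_add (add_le_add h10 this) h8).trans (le_of_eq (by ring))
    · calc _ ≤ ((m : ℝ) ^ (2 * c)) ^ d * (C * ‖f‖ * ((Q : ℝ) ^ d * (4 ^ d * σ))) := by gcongr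
        _ = (((m : ℝ) ^ (2 * c)) ^ d * (Q : ℝ) ^ d) * (C * ‖f‖ * (4 ^ d * σ)) := by ring
        _ ≤ _ := by gcongr)
  have htotal : ‖∑ n : Fin d → Fin N, B.ev f (φ (powPoint ε fun l => n l) x)‖
      ≤ (N : ℝ) ^ d * (C * ‖f‖ * (k * σ)) := by
    refine (norm_le_norm_add_norm_sub' _ _).trans ((add_le_add hblk hdrop).trans ?_)
    have : C * ‖f‖ * ((N : ℝ) ^ d * (d * (2 * (m : ℝ)⁻¹))) ≤ C * ‖f‖ * ((N : ℝ) ^ d * (d * (2 * σ))) := by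
      gcongr
    refine (add_le_add_right this _).trans (le_of_eq ?_)
    rw [hk]; ring
  have hσN := rpow_neg_le_of_le_pow hA0 hm0 hN0 hNm (s := ρ / 2) (by positivity)
  rw [sparseAverage, norm_mul, one_div, norm_inv, norm_pow, Complex.norm_natCast,
    inv_mul_le_iff₀ (by positivity)]
  refine htotal.trans (mul_le_mul_of_nonneg_left ?_ (by positivity))
  calc C * ‖f‖ * (k * σ) ≤ C * ‖f‖ * (k * (2 ^ (ρ / 2) * (N : ℝ) ^ (-(ρ / 2 / A)))) := by gcongr
    _ = _ := by ring

end Bounds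

/-! ### From rates to all test functions -/

section Bounds

variable {d : ℕ} {X 𝓑 : Type*} [MetricSpace X] [MeasurableSpace X] [NormedAddCommGroup 𝓑]
  [NormedSpace ℂ 𝓑]
variable {φ : Flow (Fin d → ℝ) X} {μ : Measure X} {B : FunctionAlgebra X 𝓑} {x : X}
  {C ρ : ℝ} {K : ℕ} {κ : ℝ}

/-- Uniformly bounded averages that tend to zero on the algebra tend to zero on its uniform limits:
an approximant is corrected to have mean zero, and the correction is as small as the
approximation error. -/
theorem FlowBounds.tendsto_of_isTestFunction [BorelSpace X] [IsFiniteMeasure μ]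
    (hB : FlowBounds φ μ B x C ρ K κ) {A : ℕ → (X → ℂ) → ℂ}
    (hsub : ∀ N f g, A N (f - g) = A N f - A N g) {c : ℝ}
    (hbd : ∀ N f b, (∀ y, ‖f y‖ ≤ b) → ‖A N f‖ ≤ c * b)
    (hA : ∀ g : 𝓑, InL20 μ (B.ev g) → Tendsto (fun N => A N (B.ev g)) atTop (𝓝 0))
    {f : X → ℂ} (hf : IsTestFunction μ B f) : Tendsto (fun N => A N f) atTop (𝓝 0) := by
  obtain ⟨-, ⟨hf2, hf0⟩, happ⟩ := hf
  obtain ⟨h, hh⟩ := hB.exists_corrector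
  have hC := hB.nonneg
  set S := 1 + μ.real Set.univ * (C * ‖h‖) with hS
  have hS1 : 1 ≤ S := by
    have : 0 ≤ μ.real Set.univ * (C * ‖h‖) := by positivity
    linarith
  have hc0 : 0 ≤ c := by
    have := (norm_nonneg _).trans (hbd 0 0 1 fun y => by simp)
    linarith
  rw [Metric.tendsto_atTop]
  intro e he
  set η := e / (2 * ((c + 1) * S)) with hη
  have hη0 : 0 < η := by positivity
  obtain ⟨g, hg⟩ := happ η hη0
  have hfi : Integrable f μ := hf2.integrable (by norm_num)
  have hm : ‖∫ y, B.ev g y ∂μ‖ ≤ η * μ.real Set.univ := by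
    have e1 : ∫ y, B.ev g y ∂μ = -∫ y, (f y - B.ev g y) ∂μ := by
      rw [integral_sub hfi (hB.integrable g), hf0]; ring
    rw [e1, norm_neg]
    exact norm_integral_le_of_norm_le_const (Eventually.of_forall hg)
  set g' := g - (∫ y, B.ev g y ∂μ) • h with hg'
  have hclose : ∀ y, ‖(f - B.ev g') y‖ ≤ η * S := fun y => by
    have e1 : (f - B.ev g') y = (f y - B.ev g y) + (∫ y, B.ev g y ∂μ) * B.ev h y := by
      rw [hg', map_sub, map_smul, Pi.sub_apply, Pi.sub_apply, Pi.smul_apply, smul_eq_mul]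
      ring
    rw [e1]
    refine (norm_add_le _ _).trans ?_
    rw [norm_mul]
    calc _ ≤ η + η * μ.real Set.univ * (C * ‖h‖) := by
          gcongr
          · exact hg y
          · exact hB.bound h y
      _ = _ := by rw [hS]; ring
  obtain ⟨N₀, hN₀⟩ := Metric.tendsto_atTop.1 (hA g' (hh g)) (e / 2) (by positivity)
  refine ⟨N₀, fun N hN => ?_⟩
  have h1 := hN₀ N hN
  rw [dist_zero_right] at h1 ⊢
  have h2 := hbd N (f - B.ev g') _ hclose
  rw [hsub] at h2
  have h3 : c * (η * S) ≤ e / 2 := by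
    have : (c + 1) * (η * S) = e / 2 := by rw [hη]; field_simp
    have : 0 ≤ η * S := by positivity
    linarith
  linarith [norm_le_norm_add_norm_sub' (A N f) (A N (B.ev g'))]

theorem tendsto_of_norm_le_rpow {u : ℕ → ℂ} {c δ : ℝ} (hδ : 0 < δ)
    (h : ∀ N : ℕ, 1 ≤ N → ‖u N‖ ≤ c * (N : ℝ) ^ (-δ)) : Tendsto u atTop (𝓝 0) := by
  refine squeeze_zero_norm' (a := fun N : ℕ => c * (N : ℝ) ^ (-δ)) ?_ ?_
  · filter_upwards [eventually_ge_atTop 1] with N hN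
    exact h N hN
  · simpa using ((tendsto_rpow_neg_atTop hδ).comp tendsto_natCast_atTop_atTop).const_mul c

theorem norm_one_div_pow_mul_sum_le {ι : Type*} (s : Finset ι) {N : ℕ} (hs : s.card = N ^ d)
    {u : ι → ℂ} {b : ℝ} (hb : 0 ≤ b) (hu : ∀ n ∈ s, ‖u n‖ ≤ b) :
    ‖(1 / (N : ℂ) ^ d) * ∑ n ∈ s, u n‖ ≤ b := by
  have h1 := norm_sum_le_of_le s hu
  rw [Finset.sum_const, hs, nsmul_eq_mul] at h1
  rw [norm_mul, norm_div, norm_one, norm_pow, Complex.norm_natCast]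
  push_cast at h1
  calc _ ≤ 1 / (N : ℝ) ^ d * ((N : ℝ) ^ d * b) := by gcongr
    _ = (N : ℝ) ^ d / (N : ℝ) ^ d * b := by ring
    _ ≤ 1 * b := by gcongr; exact div_self_le_one _
    _ = b := one_mul b

theorem FlowBounds.equidistributedAlongPowers [BorelSpace X] [IsFiniteMeasure μ]
    (hB : FlowBounds φ μ B x C ρ K κ) (h : PolyRatesAlongPowers φ μ B x) :
    EquidistributedAlongPowers φ μ B x := by
  obtain ⟨ε₀, hε₀, h⟩ := h
  refine ⟨ε₀, hε₀, fun ε hε f hf => ?_⟩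
  obtain ⟨δ, hδ, c, h⟩ := h ε hε
  refine hB.tendsto_of_isTestFunction (A := fun N f => sparseAverage φ ε f x N) (c := 1)
    (fun N f g => ?_) (fun N f b hb => ?_) (fun g hg => tendsto_of_norm_le_rpow hδ (h g hg)) hf
  · simp only [sparseAverage, Pi.sub_apply, Finset.sum_sub_distrib, mul_sub]
  · rw [one_mul]
    exact norm_one_div_pow_mul_sum_le _ (by simp) ((norm_nonneg _).trans (hb x)) fun n _ => hb _

theorem FlowBounds.equidistributedRandomWeights [BorelSpace X] [IsFiniteMeasure μ]
    (hB : FlowBounds φ μ B x C ρ K κ) (h : PolyRatesRandomWeights.{w} φ μ B x) :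
    EquidistributedRandomWeights.{w} φ μ B x := by
  obtain ⟨δ, hδ, h⟩ := h
  intro Ω _ P _ θ hθ
  obtain ⟨M, hM⟩ := hθ.bounded
  filter_upwards [h Ω P θ hθ, ae_all_iff.2 hM] with ω ⟨c, hc⟩ hω f hf
  have hM0 : 0 ≤ M := (abs_nonneg _).trans (hω 0)
  refine hB.tendsto_of_isTestFunction (A := fun N f => weightedAverage φ (fun n => θ n ω) f x N)
    (c := M) (fun N f g => ?_) (fun N f b hb => ?_)
    (fun g hg => tendsto_of_norm_le_rpow hδ (hc g hg)) hf
  · simp only [weightedAverage, Pi.sub_apply, Finset.sum_sub_distrib, mul_sub]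
  · have hb0 : 0 ≤ b := (norm_nonneg _).trans (hb x)
    refine norm_one_div_pow_mul_sum_le _ (by rw [Pi.card_Icc]; simp) (by positivity) fun n _ => ?_
    rw [norm_mul, Complex.norm_real]
    exact mul_le_mul (hω n) (hb _) (norm_nonneg _) hM0

end Bounds

section Zero

variable {X 𝓑 : Type*} [MetricSpace X] [MeasurableSpace X] [NormedAddCommGroup 𝓑]
  [NormedSpace ℂ 𝓑]
variable {φ : Flow (Fin 0 → ℝ) X} {μ : Measure X} {B : FunctionAlgebra X 𝓑} {x : X}
  {C ρ : ℝ} {K : ℕ} {κ : ℝ}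

/-- For the trivial group `ℝ^0` the decay of the twisted integrals says that functions of mean zero
vanish at `x`. -/
theorem FlowBounds.ev_eq_zero (hB : FlowBounds φ μ B x C ρ K κ) {f : 𝓑} (hf : InL20 μ (B.ev f))
    (t : Fin 0 → ℝ) : B.ev f (φ t x) = 0 := by
  have key : ∀ T : ℝ, 1 ≤ T → ‖B.ev f (φ t x)‖ ≤ C * ‖f‖ * T ^ (-κ) := fun T hT => by
    have h := hB.twisted f hf T hT 0 0 0 (fun l => l.elim0) (fun l => l.elim0) fun l => l.elim0
    have e : ∀ s : Fin 0 → ℝ, B.ev f (φ s x) * tw 0 s = B.ev f (φ t x) := fun s => by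
      rw [tw_zero, mul_one, Subsingleton.elim s t]
    simp only [e] at h
    rw [setIntegral_const, measureReal_box fun l => l.elim0] at h
    simpa using h
  have hlim : Tendsto (fun T : ℝ => C * ‖f‖ * T ^ (-κ)) atTop (𝓝 0) := by
    simpa using (tendsto_rpow_neg_atTop hB.kappa_pos).const_mul (C * ‖f‖)
  have := ge_of_tendsto hlim (eventually_atTop.2 ⟨1, key⟩)
  exact norm_le_zero_iff.1 this

theorem FlowBounds.polyRatesRandomWeights_zero (hB : FlowBounds φ μ B x C ρ K κ) :
    PolyRatesRandomWeights.{w} φ μ B x := by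
  refine ⟨1, one_pos, fun Ω _ P _ θ _ => Eventually.of_forall fun ω => ⟨0, fun f hf N _ => ?_⟩⟩
  simp [weightedAverage, hB.ev_eq_zero hf]

end Zero

theorem mainTheorem1 {d : ℕ} {X 𝓑 : Type*} [MetricSpace X] [MeasurableSpace X] [BorelSpace X]
    [NormedAddCommGroup 𝓑] [NormedSpace ℂ 𝓑] [CompleteSpace 𝓑]
    (φ : Flow (Fin d → ℝ) X) (μ : Measure X) [IsFiniteMeasure μ]
    (hμ : ∀ t : Fin d → ℝ, MeasurePreserving (φ t) μ μ)
    (hφ : HolderAction φ)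
    (B : FunctionAlgebra X 𝓑) (hN : ConditionN φ B)
    (x : X) (hx : PolyDecayingTwistedIntegrals φ μ B x) :
    (EquidistributedAlongPowers φ μ B x ∧ PolyRatesAlongPowers φ μ B x) ∧
      (EquidistributedRandomWeights.{w} φ μ B x ∧ PolyRatesRandomWeights.{w} φ μ B x) := by
  obtain ⟨C, ρ, K, κ, hB⟩ := exists_flowBounds φ μ hφ B hN x hx
  have h₁ := hB.polyRatesAlongPowers hμ
  have h₂ : PolyRatesRandomWeights.{w} φ μ B x := by
    rcases eq_or_ne d 0 with rfl | hd
    · exact hB.polyRatesRandomWeights_zero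
    · exact hB.polyRatesRandomWeights hμ hd
  exact ⟨⟨hB.equidistributedAlongPowers h₁, h₁⟩, hB.equidistributedRandomWeights h₂, h₂⟩
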